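/- Notation: for $R>0$ let $B_{2R}=\{x\in\mathbb R^2:|x|<2R\}$. Let $m\ge 1$ be an integer, $0<\alpha<1$, $\kappa>0$ and $M>0$. A function $\mathcal h:B_{2R}\to\mathbb R$ is called a gap profile (with data $m,\alpha,R,\kappa,M$) if (a) $\mathcal h\in C^{m+1,\alpha}(B_{2R})$, where all derivatives of order at most $m+1$ and the $\alpha$-Hölder seminorm of $\nabla^{m+1}\mathcal h$ are bounded by $M$ on $B_{2R}$; (b) $\mathcal h(x)=\sum_{j=1}^{m}a_j|x|^{j+1}+O(|x|^{m+1+\alpha})$ on $B_{2R}$ for some constants $a_1>0$, $a_2,\dots,a_m\in\mathbb R$; (c) $\mathcal h(x)\ge\kappa|x|^2$ on $B_{2R}$ (positivity away from the origin, in quantitative form). **Proposition.** Let $m\ge1$, $0<\alpha<1$, $R,\kappa,M>0$, $\varepsilon_0>0$, $-3\le\gamma<-1$ and $C_0>0$. There is a constant $C>0$, depending only on $m,\alpha,R,\kappa,M,\varepsilon_0,\gamma,C_0$ (in particular, not on $\varepsilon$, $\mathcal h$, $\mathcal F$ or $\mathcal U$), such that the following holds for every $0<\varepsilon\le\varepsilon_0$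 and every gap profile $\mathcal h$. Let $\mathcal F$ be smooth in $B_{2R}$ with $$|\nabla^l\mathcal F(x)|\le C_0\,(\varepsilon+\mathcal h(x))^{\gamma-\frac l2}\qquad\text{for all }0\le l\le m,\ x\in B_{2R},$$ and let $\mathcal U\in C^{m+1}(B_{2R})\cap C^0(\overline{B_{2R}})$ satisfy $$\Delta\mathcal U+\frac{3}{\varepsilon+\mathcal h}\,\nabla\mathcal h\cdot\nabla\mathcal U=\mathcal F\ \text{ in }B_{2R},\qquad \mathcal U=0\ \text{ on }|x|=2R.$$ Then $$|\nabla^l\mathcal U(x)|\le C\,(\varepsilon+\mathcal h(x))^{\gamma-\frac l2+1}\qquad\text{for all }0\le l\le m+1,\ x\in B_{2R}.$$ -/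

import Mathlib

open scoped ContDiff

/-- The horizontal plane `ℝ²` with its Euclidean norm. -/
abbrev Plane : Type := EuclideanSpace ℝ (Fin 2)

/-- The open disc of radius `2R` centred at the origin. -/
abbrev disc (R : ℝ) : Set Plane := Metric.ball (0 : Plane) (2 * R)

/-- `h` belongs to `C^{k,α}` on the open set `s`, and each derivative of order at most `k`, as well
as the `α`-Hölder seminorm of the derivative of order `k`, is bounded by `M` there. -/
structure HolderBound (k : ℕ) (α M : ℝ) (s : Set Plane) (h : Plane → ℝ) : Prop where
  contDiffOn : ContDiffOn ℝ k h s
  bound : ∀ l ≤ k, ∀ x ∈ s, ‖iteratedFDeriv ℝ l h x‖ ≤ M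
  holder : ∀ x ∈ s, ∀ y ∈ s,
    ‖iteratedFDeriv ℝ k h x - iteratedFDeriv ℝ k h y‖ ≤ M * ‖x - y‖ ^ α

/-- The gap profiles: `C^{m+1,α}` functions `h` on the disc with
`h(x) = ∑_{j=1}^m a_j |x|^{j+1} + O(|x|^{m+1+α})`, `a_1 > 0`, that are positive off the origin, in
the quantitative form `h(x) ≥ κ |x|²`. The Hölder bound is `M`. -/
structure IsGapProfile (m : ℕ) (α R κ M : ℝ) (h : Plane → ℝ) : Prop where
  holder : HolderBound (m + 1) α M (disc R) h
  expansion : ∃ (a : ℕ → ℝ) (K : ℝ), 0 < a 1 ∧ ∀ x ∈ disc R,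
    |h x - ∑ j ∈ Finset.Icc 1 m, a j * ‖x‖ ^ (j + 1)| ≤ K * ‖x‖ ^ ((m : ℝ) + 1 + α)
  positive : ∀ x ∈ disc R, κ * ‖x‖ ^ 2 ≤ h x

/-- The operator `U ↦ ΔU + 3 (ε + h)⁻¹ ∇h · ∇U`. -/
noncomputable def gapOperator (ε : ℝ) (h U : Plane → ℝ) (x : Plane) : ℝ :=
  Laplacian.laplacian U x + 3 / (ε + h x) * inner ℝ (gradient h x) (gradient U x)

/-!
The estimate rests on the maximum principle alone; no potential theory and no Hölder norms of the
solution are used, because one order of differentiability is spare: the data control `m` derivatives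
of the right-hand side and of the drift, whereas `m + 1` derivatives of `U` are to be bounded.

*Gradient estimates.* The odd part of `u` across a line through `x₀` lies below an explicit quadratic
polynomial on a half disc, which bounds `∇u(x₀)` by `sup |u|` and `sup |Δu|`
(`abs_pd_le_of_lap_bound`). A bounded drift is absorbed by maximizing the gradient weighted with the
distance to the boundary of the disc (`abs_pd_le_of_drift_bound`).

*Higher order.* Second derivatives are bounded by applying the gradient estimate to difference
quotients, which requires no regularity beyond `C²`; after that the equation can be differentiated.
In the interior the quotients are taken along translations (`interior_estimate`). Near the circle
`|x| = 2R` they are taken along rotations, which preserve both the Laplacian and the boundary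
condition; the gradient bound up to the circle follows from the interior one and from a barrier that
bounds `|u|` by the distance to the circle (`boundary_decay`). The second derivatives that are not
angular are recovered from the equation (`BddDeriv.of_rotDeriv_of_lap`, `boundary_estimate`).

*Supremum bound.* With `w = ε + h` and `-2 ≤ s < 0`, the drift term in the equation gives
`L (w ^ s) = s w ^ (s - 1) Δh + s (s + 2) w ^ (s - 2) |∇h|² ≤ s w ^ (s - 1) Δh`. Since
`h ≥ κ |x|²` and `h 0 = 0`, the Hessian of `h` is at least `2κ` at the origin, hence at least `κ` on
a disc of controlled radius. There `w ^ (γ + 1)` is a strict supersolution of the right order, and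
adding a multiple of `exp (4ΛR²) - exp (Λ |x|²)` makes it one on the whole disc
(`GapSolution.sup_bound`).

*Conclusion.* Around a point `x` away from the circle, the gap is comparable to `w x` on the disc of
radius `c √(w x)`, because `|∇h| ≤ M |x| ≤ C √w`. Rescaled to this disc, the equation has a bounded
drift and bounded data, and the interior estimate gives the weighted bound with the factor
`(w x) ^ (-l / 2)` for each derivative. Near the circle `w` is bounded from below and the
boundary estimate applies without rescaling. Uniformity of the constants is expressed by working
with families of functions throughout (`BddDeriv`).
-/


/-! ### Partial derivatives in the plane -/

/-- The `j`-th standard basis vector of the plane. -/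
noncomputable abbrev basisVec (j : Fin 2) : Plane := EuclideanSpace.single j (1 : ℝ)

/-- The `j`-th partial derivative. -/
noncomputable def pd (j : Fin 2) (f : Plane → ℝ) (x : Plane) : ℝ := fderiv ℝ f x (basisVec j)

/-- The Laplacian as the sum of the pure second partial derivatives. -/
noncomputable def lap (f : Plane → ℝ) (x : Plane) : ℝ := pd 0 (pd 0 f) x + pd 1 (pd 1 f) x

lemma norm_basisVec (j : Fin 2) : ‖basisVec j‖ = 1 := by simp [basisVec]

lemma plane_eq_sum (v : Plane) : v = v 0 • basisVec 0 + v 1 • basisVec 1 := by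
  ext i; fin_cases i <;> simp [basisVec]

lemma norm_sq_plane (x : Plane) : ‖x‖ ^ 2 = x 0 ^ 2 + x 1 ^ 2 := by
  rw [EuclideanSpace.norm_sq_eq]; simp

lemma abs_coord_le (x : Plane) (j : Fin 2) : |x j| ≤ ‖x‖ := by
  simpa using PiLp.norm_apply_le x j

lemma fderiv_apply_eq_pd (f : Plane → ℝ) (x v : Plane) :
    fderiv ℝ f x v = v 0 * pd 0 f x + v 1 * pd 1 f x := by
  conv_lhs => rw [plane_eq_sum v]
  simp [pd]

lemma abs_pd_le (j : Fin 2) (f : Plane → ℝ) (x : Plane) : |pd j f x| ≤ ‖fderiv ℝ f x‖ := by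
  have := (fderiv ℝ f x).le_opNorm (basisVec j)
  rwa [norm_basisVec, mul_one] at this

lemma pd_congr {f g : Plane → ℝ} {x : Plane} (j : Fin 2) (h : f =ᶠ[nhds x] g) :
    pd j f x = pd j g x := by
  simp only [pd, h.fderiv_eq]

lemma pd_congr_on {s : Set Plane} (hs : IsOpen s) {f g : Plane → ℝ} (j : Fin 2)
    (h : Set.EqOn f g s) : Set.EqOn (pd j f) (pd j g) s := fun _ hx =>
  pd_congr j (Filter.eventuallyEq_of_mem (hs.mem_nhds hx) h)

section rules
variable {f g : Plane → ℝ} {x : Plane} (j : Fin 2)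

lemma pd_const (c : ℝ) : pd j (fun _ => c) x = 0 := by simp [pd]

lemma pd_coord (l : Fin 2) : pd j (fun y => y l) x = if l = j then 1 else 0 := by
  have : HasFDerivAt (fun y : Plane => y l) (EuclideanSpace.proj l : Plane →L[ℝ] ℝ) x :=
    (EuclideanSpace.proj l : Plane →L[ℝ] ℝ).hasFDerivAt
  rw [pd, this.fderiv]; simp [basisVec]

lemma differentiable_coord (l : Fin 2) : Differentiable ℝ (fun y : Plane => y l) :=
  (EuclideanSpace.proj l : Plane →L[ℝ] ℝ).differentiable

lemma contDiff_coord (l : Fin 2) {n : ℕ∞ω} : ContDiff ℝ n (fun y : Plane => y l) :=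
  (EuclideanSpace.proj l : Plane →L[ℝ] ℝ).contDiff

lemma pd_add (hf : DifferentiableAt ℝ f x) (hg : DifferentiableAt ℝ g x) :
    pd j (fun y => f y + g y) x = pd j f x + pd j g x := by
  simp only [pd]; rw [fderiv_fun_add hf hg]; simp

lemma pd_sub (hf : DifferentiableAt ℝ f x) (hg : DifferentiableAt ℝ g x) :
    pd j (fun y => f y - g y) x = pd j f x - pd j g x := by
  simp only [pd]; rw [fderiv_fun_sub hf hg]; simp

lemma pd_neg : pd j (fun y => - f y) x = - pd j f x := by
  simp only [pd]; rw [fderiv_fun_neg]; simp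

lemma pd_mul (hf : DifferentiableAt ℝ f x) (hg : DifferentiableAt ℝ g x) :
    pd j (fun y => f y * g y) x = pd j f x * g x + f x * pd j g x := by
  simp only [pd]; rw [fderiv_fun_mul hf hg]; simp; ring

lemma pd_const_mul (c : ℝ) (hf : DifferentiableAt ℝ f x) :
    pd j (fun y => c * f y) x = c * pd j f x := by
  simp only [pd]; rw [fderiv_const_mul hf]; simp

lemma pd_comp {G : ℝ → ℝ} {G' : ℝ} (hG : HasDerivAt G G' (f x)) (hf : DifferentiableAt ℝ f x) :
    pd j (fun y => G (f y)) x = G' * pd j f x := by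
  have := hG.comp_hasFDerivAt x hf.hasFDerivAt
  simp only [pd]
  rw [show (fun y => G (f y)) = G ∘ f from rfl, this.fderiv]; simp

/-- Chain rule for an affine change of variables. -/
lemma pd_comp_affine (A : Plane →L[ℝ] Plane) (c : Plane)
    (hf : DifferentiableAt ℝ f (c + A x)) :
    pd j (fun y => f (c + A y)) x
      = (A (basisVec j)) 0 * pd 0 f (c + A x) + (A (basisVec j)) 1 * pd 1 f (c + A x) := by
  have h1 : HasFDerivAt (fun y => c + A y) A x := A.hasFDerivAt.const_add c
  have := hf.hasFDerivAt.comp x h1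
  simp only [pd]
  rw [show (fun y => f (c + A y)) = f ∘ (fun y => c + A y) from rfl, this.fderiv,
    ContinuousLinearMap.comp_apply, fderiv_apply_eq_pd]; rfl

lemma contDiffAt_pd {n : ℕ} (hf : ContDiffAt ℝ (n + 1 : ℕ) f x) : ContDiffAt ℝ n (pd j f) x := by
  have h := hf.fderiv_right (m := n) (by norm_cast)
  exact h.clm_apply contDiffAt_const

lemma contDiffOn_pd {n : ℕ} {s : Set Plane} (hs : IsOpen s) (hf : ContDiffOn ℝ (n + 1 : ℕ) f s) :
    ContDiffOn ℝ n (pd j f) s := fun _ hx =>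
  (contDiffAt_pd j (hf.contDiffAt (hs.mem_nhds hx))).contDiffWithinAt

lemma pd_pd_eq_iteratedFDeriv (a b : Fin 2) (hf : ContDiffAt ℝ 2 f x) :
    pd a (pd b f) x = iteratedFDeriv ℝ 2 f x ![basisVec a, basisVec b] := by
  have hd : DifferentiableAt ℝ (fderiv ℝ f) x :=
    (hf.fderiv_right (m := 1) (by norm_num)).differentiableAt (by simp)
  have h2 := hd.hasFDerivAt.clm_apply (hasFDerivAt_const (basisVec b) x)
  rw [iteratedFDeriv_two_apply]
  change fderiv ℝ (fun y => fderiv ℝ f y (basisVec b)) x (basisVec a) = _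
  rw [h2.fderiv]; simp

lemma pd_comm (i : Fin 2) (hf : ContDiffAt ℝ 2 f x) : pd i (pd j f) x = pd j (pd i f) x := by
  have hs : IsSymmSndFDerivAt ℝ f x := hf.isSymmSndFDerivAt (by simp)
  rw [pd_pd_eq_iteratedFDeriv i j hf, pd_pd_eq_iteratedFDeriv j i hf, iteratedFDeriv_two_apply,
    iteratedFDeriv_two_apply]
  exact hs.eq _ _

end rules

lemma laplacian_eq_lap {f : Plane → ℝ} {x : Plane} (hf : ContDiffAt ℝ 2 f x) :
    Laplacian.laplacian f x = lap f x := by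
  rw [InnerProductSpace.laplacian_eq_iteratedFDeriv_orthonormalBasis f
    (EuclideanSpace.basisFun (Fin 2) ℝ)]
  simp only [Fin.sum_univ_two, EuclideanSpace.basisFun_apply, lap]
  rw [pd_pd_eq_iteratedFDeriv _ _ hf, pd_pd_eq_iteratedFDeriv _ _ hf]

lemma inner_gradient_eq (h U : Plane → ℝ) (x : Plane) :
    inner ℝ (gradient h x) (gradient U x) = pd 0 h x * pd 0 U x + pd 1 h x * pd 1 U x := by
  have key : ∀ (f : Plane → ℝ) (j : Fin 2), gradient f x j = pd j f x := by
    intro f j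
    have : inner ℝ (gradient f x) (basisVec j) = fderiv ℝ f x (basisVec j) := by
      simp [gradient]
    rw [pd, ← this, real_inner_comm, basisVec, EuclideanSpace.inner_single_left]
    simp
  have : inner ℝ (gradient h x) (gradient U x) = fderiv ℝ h x (gradient U x) := by
    simp [gradient]
  rw [this, fderiv_apply_eq_pd, key, key]; ring

section lapRules
variable {f g : Plane → ℝ} {s : Set Plane}

lemma differentiableAt_pd {x : Plane} (j : Fin 2) (hf : ContDiffAt ℝ 2 f x) :
    DifferentiableAt ℝ (pd j f) x :=
  (contDiffAt_pd (n := 1) j hf).differentiableAt (by simp)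

lemma differentiableAt_near {x : Plane} (hf : ContDiffAt ℝ 2 f x) :
    ∀ᶠ y in nhds x, DifferentiableAt ℝ f y := by
  filter_upwards [(hf.eventually (by simp))] with y hy
  exact hy.differentiableAt (by simp)

lemma pd_pd_add {x : Plane} (i j : Fin 2) (hf : ContDiffAt ℝ 2 f x) (hg : ContDiffAt ℝ 2 g x) :
    pd i (pd j (fun y => f y + g y)) x = pd i (pd j f) x + pd i (pd j g) x := by
  have : pd j (fun y => f y + g y) =ᶠ[nhds x] fun y => pd j f y + pd j g y := by
    filter_upwards [differentiableAt_near hf, differentiableAt_near hg] with y h1 h2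
    exact pd_add j h1 h2
  rw [pd_congr i this, pd_add i (differentiableAt_pd j hf) (differentiableAt_pd j hg)]

lemma pd_pd_const_mul {x : Plane} (i j : Fin 2) (c : ℝ) (hf : ContDiffAt ℝ 2 f x) :
    pd i (pd j (fun y => c * f y)) x = c * pd i (pd j f) x := by
  have : pd j (fun y => c * f y) =ᶠ[nhds x] fun y => c * pd j f y := by
    filter_upwards [differentiableAt_near hf] with y h1
    exact pd_const_mul j c h1
  rw [pd_congr i this, pd_const_mul i c (differentiableAt_pd j hf)]

lemma lap_add {x : Plane} (hf : ContDiffAt ℝ 2 f x) (hg : ContDiffAt ℝ 2 g x) :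
    lap (fun y => f y + g y) x = lap f x + lap g x := by
  simp only [lap, pd_pd_add _ _ hf hg]; ring

lemma lap_const_mul {x : Plane} (c : ℝ) (hf : ContDiffAt ℝ 2 f x) :
    lap (fun y => c * f y) x = c * lap f x := by
  simp only [lap, pd_pd_const_mul _ _ c hf]; ring

lemma lap_sub {x : Plane} (hf : ContDiffAt ℝ 2 f x) (hg : ContDiffAt ℝ 2 g x) :
    lap (fun y => f y - g y) x = lap f x - lap g x := by
  have := lap_add hf (contDiffAt_const.mul hg : ContDiffAt ℝ 2 (fun y => (-1 : ℝ) * g y) x)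
  rw [lap_const_mul _ hg] at this
  have e : (fun y => f y - g y) = fun y => f y + -1 * g y := by funext y; ring
  rw [e, this]; ring

lemma pd_pd_comp {G G' : ℝ → ℝ} {G'' : ℝ} {x : Plane} (i j : Fin 2) (hf : ContDiffAt ℝ 2 f x)
    (hG : ∀ᶠ t in nhds (f x), HasDerivAt G (G' t) t) (hG' : HasDerivAt G' G'' (f x)) :
    pd i (pd j (fun y => G (f y))) x
      = G' (f x) * pd i (pd j f) x + G'' * (pd i f x * pd j f x) := by
  have hfd : DifferentiableAt ℝ f x := hf.differentiableAt (by simp)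
  have : pd j (fun y => G (f y)) =ᶠ[nhds x] fun y => G' (f y) * pd j f y := by
    filter_upwards [differentiableAt_near hf, hf.continuousAt.eventually hG] with y h1 h2
    exact pd_comp j h2 h1
  have hd : DifferentiableAt ℝ (fun y => G' (f y)) x := hG'.differentiableAt.comp x hfd
  rw [pd_congr i this, pd_mul i hd (differentiableAt_pd j hf), pd_comp i hG' hfd]
  ring

lemma lap_comp {G G' : ℝ → ℝ} {G'' : ℝ} {x : Plane} (hf : ContDiffAt ℝ 2 f x)
    (hG : ∀ᶠ t in nhds (f x), HasDerivAt G (G' t) t) (hG' : HasDerivAt G' G'' (f x)) :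
    lap (fun y => G (f y)) x = G' (f x) * lap f x + G'' * (pd 0 f x ^ 2 + pd 1 f x ^ 2) := by
  simp only [lap, pd_pd_comp _ _ hf hG hG']; ring

/-- Invariance of the Laplacian under affine isometries, given by the orthogonality relations of
the matrix of the linear part. -/
lemma lap_comp_affine (A : Plane →L[ℝ] Plane) (c : Plane) {x : Plane}
    (h00 : (A (basisVec 0)) 0 ^ 2 + (A (basisVec 1)) 0 ^ 2 = 1)
    (h11 : (A (basisVec 0)) 1 ^ 2 + (A (basisVec 1)) 1 ^ 2 = 1)
    (h01 : (A (basisVec 0)) 0 * (A (basisVec 0)) 1 + (A (basisVec 1)) 0 * (A (basisVec 1)) 1 = 0)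
    (hf : ContDiffAt ℝ 2 f (c + A x)) :
    lap (fun y => f (c + A y)) x = lap f (c + A x) := by
  have hcont : ContinuousAt (fun y => c + A y) x := by fun_prop
  have hne := hcont.eventually (differentiableAt_near hf)
  have key : ∀ i j : Fin 2, pd i (pd j (fun y => f (c + A y))) x
      = (A (basisVec j)) 0 * ((A (basisVec i)) 0 * pd 0 (pd 0 f) (c + A x)
          + (A (basisVec i)) 1 * pd 1 (pd 0 f) (c + A x))
        + (A (basisVec j)) 1 * ((A (basisVec i)) 0 * pd 0 (pd 1 f) (c + A x)
          + (A (basisVec i)) 1 * pd 1 (pd 1 f) (c + A x)) := by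
    intro i j
    have e : pd j (fun y => f (c + A y)) =ᶠ[nhds x] fun y =>
        (A (basisVec j)) 0 * pd 0 f (c + A y) + (A (basisVec j)) 1 * pd 1 f (c + A y) := by
      filter_upwards [hne] with y hy
      exact pd_comp_affine j A c hy
    have d : ∀ l : Fin 2, DifferentiableAt ℝ (fun y => pd l f (c + A y)) x := fun l =>
      DifferentiableAt.comp (g := pd l f) (f := fun y => c + A y) x (differentiableAt_pd l hf)
        (by fun_prop)
    rw [pd_congr i e, pd_add i ((d 0).const_mul _) ((d 1).const_mul _), pd_const_mul i _ (d 0),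
      pd_const_mul i _ (d 1), pd_comp_affine i A c (differentiableAt_pd 0 hf),
      pd_comp_affine i A c (differentiableAt_pd 1 hf)]
  simp only [lap, key]
  linear_combination (pd 0 (pd 0 f) (c + A x)) * h00 + (pd 1 (pd 1 f) (c + A x)) * h11
    + (pd 1 (pd 0 f) (c + A x) + pd 0 (pd 1 f) (c + A x)) * h01

lemma contDiffAt_of_isOpen {n : ℕ∞ω} {x : Plane} (hs : IsOpen s) (hf : ContDiffOn ℝ n f s)
    (hx : x ∈ s) : ContDiffAt ℝ n f x := hf.contDiffAt (hs.mem_nhds hx)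

/-- The Laplacian commutes with partial derivatives. -/
lemma pd_lap (j : Fin 2) (hs : IsOpen s) (hf : ContDiffOn ℝ 3 f s) {x : Plane} (hx : x ∈ s) :
    pd j (lap f) x = lap (pd j f) x := by
  have hf2 : ∀ y ∈ s, ContDiffAt ℝ 2 f y := fun y hy =>
    (contDiffAt_of_isOpen hs hf hy).of_le (by norm_num)
  have hp : ∀ l, ContDiffAt ℝ 2 (pd l f) x := fun l =>
    contDiffAt_pd (n := 2) l (contDiffAt_of_isOpen hs hf hx)
  have h1 : ∀ l, pd j (pd l (pd l f)) x = pd l (pd l (pd j f)) x := by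
    intro l
    rw [pd_comm _ _ (hp l)]
    exact pd_congr_on hs l (fun y hy => pd_comm _ _ (hf2 y hy)) hx
  have hd : ∀ l, DifferentiableAt ℝ (pd l (pd l f)) x := fun l => differentiableAt_pd l (hp l)
  change pd j (fun y => pd 0 (pd 0 f) y + pd 1 (pd 1 f) y) x = _
  rw [pd_add j (hd 0) (hd 1), h1, h1]; rfl

end lapRules

/-! ### The maximum principle -/

lemma hasDerivAt_line {f : Plane → ℝ} {x v : Plane} {t : ℝ}
    (hf : DifferentiableAt ℝ f (x + t • v)) :
    HasDerivAt (fun τ : ℝ => f (x + τ • v))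
      (v 0 * pd 0 f (x + t • v) + v 1 * pd 1 f (x + t • v)) t := by
  have h1 : HasDerivAt (fun τ : ℝ => x + τ • v) v t := by
    simpa using ((hasDerivAt_id t).smul_const v).const_add x
  have := hf.hasFDerivAt.comp_hasDerivAt t h1
  rwa [fderiv_apply_eq_pd] at this

/-- The second derivative of `f` at `x` along the vector `v`, in coordinates. -/
noncomputable def hess (f : Plane → ℝ) (x v : Plane) : ℝ :=
  v 0 * (v 0 * pd 0 (pd 0 f) x + v 1 * pd 1 (pd 0 f) x)
    + v 1 * (v 0 * pd 0 (pd 1 f) x + v 1 * pd 1 (pd 1 f) x)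

lemma hasDerivAt_line_line {f : Plane → ℝ} {x v : Plane} {t : ℝ}
    (hf : ContDiffAt ℝ 2 f (x + t • v)) :
    HasDerivAt (fun τ : ℝ => v 0 * pd 0 f (x + τ • v) + v 1 * pd 1 f (x + τ • v))
      (hess f (x + t • v) v) t :=
  ((hasDerivAt_line (differentiableAt_pd 0 hf)).const_mul (v 0)).add
    ((hasDerivAt_line (differentiableAt_pd 1 hf)).const_mul (v 1))

lemma deriv_deriv_nonpos_of_isLocalMax {f : ℝ → ℝ} {a : ℝ} (h : IsLocalMax f a)
    (hc : ContinuousAt f a) : deriv (deriv f) a ≤ 0 := by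
  by_contra! hpos
  have hmin := isLocalMin_of_deriv_deriv_pos hpos h.deriv_eq_zero hc
  have heq : f =ᶠ[nhds a] fun _ => f a := by
    filter_upwards [h, hmin] with y h1 h2 using le_antisymm h1 h2
  have : deriv (deriv f) a = 0 := by
    rw [heq.deriv.deriv_eq]; simp
  linarith

lemma hess_nonpos_of_isLocalMax {f : Plane → ℝ} {x : Plane} (hf : ContDiffAt ℝ 2 f x)
    (h : IsLocalMax f x) (v : Plane) : hess f x v ≤ 0 := by
  have hc : ContinuousAt (fun t : ℝ => x + t • v) 0 := by fun_prop
  have hx : x + (0 : ℝ) • v = x := by simp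
  have hmax : IsLocalMax (fun t : ℝ => f (x + t • v)) 0 := by
    have h' : ∀ᶠ y in nhds (x + (0 : ℝ) • v), f y ≤ f x := by rw [hx]; exact h
    have := hc.eventually h'
    filter_upwards [this] with t ht
    simpa using ht
  have hd : deriv (fun t : ℝ => f (x + t • v)) =ᶠ[nhds 0]
      fun τ => v 0 * pd 0 f (x + τ • v) + v 1 * pd 1 f (x + τ • v) := by
    have h' : ∀ᶠ y in nhds (x + (0 : ℝ) • v), DifferentiableAt ℝ f y := by
      rw [hx]; exact differentiableAt_near hf
    filter_upwards [hc.eventually h'] with t ht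
    exact (hasDerivAt_line ht).deriv
  have hdd := (hasDerivAt_line_line (f := f) (x := x) (v := v) (t := 0) (by rwa [hx])).deriv
  have hcf : ContinuousAt (fun t : ℝ => f (x + t • v)) 0 :=
    (hasDerivAt_line (f := f) (t := 0)
      (by rw [hx]; exact hf.differentiableAt (by simp))).continuousAt
  have := deriv_deriv_nonpos_of_isLocalMax hmax hcf
  rwa [hd.deriv_eq, hdd, hx] at this

lemma hess_basisVec (f : Plane → ℝ) (x : Plane) (j : Fin 2) :
    hess f x (basisVec j) = pd j (pd j f) x := by
  fin_cases j <;> simp [hess, basisVec]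

lemma lap_nonpos_of_isLocalMax {f : Plane → ℝ} {x : Plane} (hf : ContDiffAt ℝ 2 f x)
    (h : IsLocalMax f x) : lap f x ≤ 0 := by
  have h0 := hess_nonpos_of_isLocalMax hf h (basisVec 0)
  have h1 := hess_nonpos_of_isLocalMax hf h (basisVec 1)
  rw [hess_basisVec] at h0 h1
  unfold lap; linarith

lemma pd_eq_zero_of_isLocalMax {f : Plane → ℝ} {x : Plane} (h : IsLocalMax f x) (j : Fin 2) :
    pd j f x = 0 := by
  simp [pd, h.fderiv_eq_zero]

/-- Weak maximum principle: a function on a compact set is nonpositive if, at each point where it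
is positive, the point is interior, and the Laplacian is positive as soon as the gradient vanishes.
The hypothesis at critical points allows first-order terms with any coefficients. -/
lemma nonpos_of_maximum_principle {K : Set Plane} (hK : IsCompact K) {V : Plane → ℝ}
    (hc : ContinuousOn V K)
    (h : ∀ x ∈ K, 0 < V x → K ∈ nhds x ∧ ContDiffAt ℝ 2 V x ∧
      (pd 0 V x = 0 → pd 1 V x = 0 → 0 < lap V x)) :
    ∀ x ∈ K, V x ≤ 0 := by
  intro x hx
  by_contra! hpos
  obtain ⟨y, hy, hmax⟩ := hK.exists_isMaxOn ⟨x, hx⟩ hc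
  have hVy : 0 < V y := hpos.trans_le (hmax hx)
  obtain ⟨hn, hC, hl⟩ := h y hy hVy
  have hloc : IsLocalMax V y := hmax.isLocalMax hn
  exact absurd (hl (pd_eq_zero_of_isLocalMax hloc 0) (pd_eq_zero_of_isLocalMax hloc 1))
    (not_lt.2 (lap_nonpos_of_isLocalMax hC hloc))

/-! ### Interior gradient estimates -/

lemma lap_coord (l : Fin 2) (x : Plane) : lap (fun y => y l) x = 0 := by
  have : ∀ j, pd j (pd j (fun y : Plane => y l)) x = 0 := by
    intro j
    rw [show pd j (fun y : Plane => y l) = fun _ => if l = j then 1 else 0 from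
      funext fun y => pd_coord j l, pd_const]
  simp [lap, this]

lemma lap_coord_sq (l : Fin 2) (x : Plane) : lap (fun y => y l * y l) x = 2 := by
  have : ∀ j, pd j (pd j (fun y : Plane => y l * y l)) x = if l = j then 2 else 0 := by
    intro j
    have e : pd j (fun y : Plane => y l * y l) = fun y => (if l = j then 2 else 0) * y l := by
      funext y
      rw [pd_mul j (differentiable_coord l y) (differentiable_coord l y), pd_coord]
      split_ifs <;> ring
    rw [e, pd_const_mul j _ (differentiable_coord l x), pd_coord]
    split_ifs <;> simp
  simp only [lap, this]
  fin_cases l <;> simp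

/-- The reflection that changes the sign of the `j`-th coordinate. -/
noncomputable def flipCoord (j : Fin 2) : Plane →L[ℝ] Plane :=
  ContinuousLinearMap.id ℝ Plane
    - (2 : ℝ) • (EuclideanSpace.proj j : Plane →L[ℝ] ℝ).smulRight (basisVec j)

lemma flipCoord_apply (j l : Fin 2) (y : Plane) :
    flipCoord j y l = if l = j then - y l else y l := by
  by_cases h : l = j
  · subst h; simp [flipCoord, basisVec]; ring
  · simp [flipCoord, basisVec, h]

lemma norm_flipCoord (j : Fin 2) (y : Plane) : ‖flipCoord j y‖ = ‖y‖ := by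
  have : ‖flipCoord j y‖ ^ 2 = ‖y‖ ^ 2 := by
    rw [norm_sq_plane, norm_sq_plane, flipCoord_apply, flipCoord_apply]
    split_ifs <;> ring
  exact (sq_eq_sq₀ (norm_nonneg _) (norm_nonneg _)).1 this

lemma lap_comp_flipCoord (j : Fin 2) {f : Plane → ℝ} (c : Plane) {x : Plane}
    (hf : ContDiffAt ℝ 2 f (c + flipCoord j x)) :
    lap (fun y => f (c + flipCoord j y)) x = lap f (c + flipCoord j x) := by
  apply lap_comp_affine _ _ _ _ _ hf <;> fin_cases j <;> simp [flipCoord_apply, basisVec]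

lemma lap_comp_translate {f : Plane → ℝ} (c : Plane) {x : Plane}
    (hf : ContDiffAt ℝ 2 f (c + x)) :
    lap (fun y => f (c + y)) x = lap f (c + x) := by
  have := lap_comp_affine (f := f) (ContinuousLinearMap.id ℝ Plane) c (x := x) (by simp [basisVec])
    (by simp [basisVec]) (by simp [basisVec]) (by simpa using hf)
  simpa using this

lemma nonneg_of_hasDerivAt_of_nonneg {k : ℝ → ℝ} {c δ : ℝ} (hk : HasDerivAt k c 0) (hk0 : k 0 = 0)
    (hδ : 0 < δ) (h : ∀ t, 0 < t → t < δ → 0 ≤ k t) : 0 ≤ c := by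
  have := hk.tendsto_slope_zero_right
  refine ge_of_tendsto this ?_
  filter_upwards [Ioo_mem_nhdsGT hδ] with t ht
  simp only [zero_add, hk0, sub_zero, smul_eq_mul]
  exact mul_nonneg (inv_nonneg.2 ht.1.le) (h t ht.1 ht.2)

/-- One-sided gradient bound for the Poisson equation. The odd part of `u` in the direction `j` is
compared on a half disc with a quadratic polynomial that vanishes at the centre. -/
lemma pd_le_of_lap_bound_of_lt {u : Plane → ℝ} {x₀ : Plane} {D d S N N' : ℝ} (j : Fin 2) (hd : 0 < d)
    (hdD : d < D) (hu : ContDiffOn ℝ 2 u (Metric.ball x₀ D))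
    (hS : ∀ x ∈ Metric.ball x₀ D, |u x| ≤ S)
    (hN : ∀ x ∈ Metric.ball x₀ D, |lap u x| ≤ N) (hN' : N < N') :
    pd j u x₀ ≤ 2 * S / d + N' * d / 2 := by
  have hS0 : 0 ≤ S := (abs_nonneg _).trans (hS x₀ (by simp; linarith))
  have hN0 : 0 ≤ N := (abs_nonneg _).trans (hN x₀ (by simp; linarith))
  set A : ℝ := 2 * S / d + N' * d / 2 with hA
  set B : ℝ := -(2 * S / d ^ 2) - N' / 2 with hB
  set g : Plane → ℝ := fun y => (1 / 2) * (u (x₀ + y) - u (x₀ + flipCoord j y)) with hg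
  -- `ψ` has Laplacian `-N'`, is nonnegative on the diameter, and is at least `S` on the arc
  set ψ : Plane → ℝ := fun y =>
    (S / d ^ 2) * (y 0 * y 0 + y 1 * y 1) + (A * y j + B * (y j * y j)) with hψ
  have hball1 : ∀ y : Plane, ‖y‖ < D → x₀ + y ∈ Metric.ball x₀ D := by
    intro y hy; simpa using hy
  have hball2 : ∀ y : Plane, ‖y‖ < D → x₀ + flipCoord j y ∈ Metric.ball x₀ D := by
    intro y hy; apply hball1; rwa [norm_flipCoord]
  have hu2 : ∀ z ∈ Metric.ball x₀ D, ContDiffAt ℝ 2 u z := fun z hz =>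
    contDiffAt_of_isOpen Metric.isOpen_ball hu hz
  have c1 : ∀ y : Plane, ‖y‖ < D → ContDiffAt ℝ 2 (fun y => u (x₀ + y)) y := fun y hy =>
    ContDiffAt.comp y (hu2 _ (hball1 y hy)) (by fun_prop)
  have c2 : ∀ y : Plane, ‖y‖ < D → ContDiffAt ℝ 2 (fun y => u (x₀ + flipCoord j y)) y :=
    fun y hy => ContDiffAt.comp y (hu2 _ (hball2 y hy))
      (contDiffAt_const.add (flipCoord j).contDiff.contDiffAt)
  have cg : ∀ y : Plane, ‖y‖ < D → ContDiffAt ℝ 2 g y := fun y hy =>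
    contDiffAt_const.mul ((c1 y hy).sub (c2 y hy))
  have lg : ∀ y : Plane, ‖y‖ < D → -N ≤ lap g y := by
    intro y hy
    rw [hg, lap_const_mul _ ((c1 y hy).sub (c2 y hy)), lap_sub (c1 y hy) (c2 y hy),
      lap_comp_translate x₀ (hu2 _ (hball1 y hy)), lap_comp_flipCoord j x₀ (hu2 _ (hball2 y hy))]
    have h1 := abs_le.1 (hN _ (hball1 y hy))
    have h2 := abs_le.1 (hN _ (hball2 y hy))
    linarith [h1.1, h2.2]
  have q : ∀ l : Fin 2, ContDiff ℝ 2 (fun y : Plane => y l * y l) := fun l =>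
    (contDiff_coord l).mul (contDiff_coord l)
  have cψ : ContDiff ℝ 2 ψ :=
    (contDiff_const.mul ((q 0).add (q 1))).add
      ((contDiff_const.mul (contDiff_coord j)).add (contDiff_const.mul (q j)))
  have lψ : ∀ y, lap ψ y = - N' := by
    intro y
    rw [hψ, lap_add (contDiff_const.mul ((q 0).add (q 1))).contDiffAt
      ((contDiff_const.mul (contDiff_coord j)).add (contDiff_const.mul (q j))).contDiffAt,
      lap_const_mul _ ((q 0).add (q 1)).contDiffAt,
      lap_add (q 0).contDiffAt (q 1).contDiffAt,
      lap_add (contDiff_const.mul (contDiff_coord j)).contDiffAt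
        (contDiff_const.mul (q j)).contDiffAt, lap_const_mul _ (contDiff_coord j).contDiffAt,
      lap_const_mul _ (q j).contDiffAt]
    simp only [lap_coord, lap_coord_sq, hB]
    field_simp; ring
  have hK : IsCompact (Metric.closedBall (0 : Plane) d ∩ {y | 0 ≤ y j}) :=
    (isCompact_closedBall _ _).inter_right
      (isClosed_le continuous_const (differentiable_coord j).continuous)
  have key := nonpos_of_maximum_principle hK (V := fun y => g y - ψ y)
    (fun y hy => ((cg y (lt_of_le_of_lt (by simpa using hy.1) hdD)).sub
      cψ.contDiffAt).continuousAt.continuousWithinAt)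
    (by
      rintro y ⟨hy, hyj⟩ hpos
      have hyd : ‖y‖ ≤ d := by simpa using hy
      have hyD : ‖y‖ < D := hyd.trans_lt hdD
      have hyj : 0 ≤ y j := hyj
      have hψy : ψ y = S / d ^ 2 * ‖y‖ ^ 2 + (2 * S / d ^ 2 + N' / 2) * (y j * (d - y j)) := by
        rw [norm_sq_plane]; simp only [hψ, hA, hB]; field_simp; ring
      have hgS : g y ≤ S := by
        have h1 := abs_le.1 (hS _ (hball1 y hyD))
        have h2 := abs_le.1 (hS _ (hball2 y hyD))
        simp only [hg]; linarith [h1.2, h2.1]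
      have hjd : y j ≤ d := (le_abs_self _).trans ((abs_coord_le y j).trans hyd)
      have hpos' : 0 < g y - ψ y := hpos
      have hprod : 0 ≤ (2 * S / d ^ 2 + N' / 2) * (y j * (d - y j)) := by
        have : 0 ≤ d - y j := by linarith
        have : 0 ≤ N' := by linarith
        positivity
      have hj0 : 0 < y j := by
        rcases hyj.lt_or_eq with h | h
        · exact h
        · exfalso
          have hfl : flipCoord j y = y := by
            ext l; rw [flipCoord_apply]; split_ifs with hl
            · rw [hl, ← h]; simp
            · rfl
          have : g y = 0 := by simp only [hg, hfl]; ring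
          have h3 : 0 ≤ S / d ^ 2 * ‖y‖ ^ 2 := by positivity
          linarith
      have hlt : ‖y‖ < d := by
        rcases hyd.lt_or_eq with h | h
        · exact h
        · exfalso
          rw [h, div_mul_cancel₀ _ (by positivity)] at hψy
          linarith
      refine ⟨?_, (cg y hyD).sub cψ.contDiffAt, fun _ _ => ?_⟩
      · refine Filter.inter_mem (Metric.closedBall_mem_nhds_of_mem (by simpa using hlt)) ?_
        exact Filter.mem_of_superset ((isOpen_lt continuous_const
          (differentiable_coord j).continuous).mem_nhds hj0) fun z (hz : 0 < z j) =>
          show 0 ≤ z j from hz.le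
      · rw [lap_sub (cg y hyD) cψ.contDiffAt, lψ]
        have := lg y hyD
        linarith)
  -- Both sides vanish at the centre, so the comparison passes to the derivatives there.
  have hdu : DifferentiableAt ℝ u x₀ := (hu2 x₀ (by simp; linarith)).differentiableAt (by simp)
  have ev : ∀ t : ℝ, ((t • basisVec j : Plane)) j = t := fun t => by simp [basisVec]
  have efl : ∀ t : ℝ, x₀ + flipCoord j (t • basisVec j) = x₀ + t • (-basisVec j) := by
    intro t; congr 1; ext l; rw [flipCoord_apply]
    by_cases h : l = j
    · simp [h, basisVec]
    · simp [h, basisVec]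
  have hder1 : HasDerivAt (fun t : ℝ => u (x₀ + t • basisVec j)) (pd j u x₀) 0 := by
    have := hasDerivAt_line (f := u) (x := x₀) (v := basisVec j) (t := 0) (by simpa using hdu)
    convert this using 1
    fin_cases j <;> simp [basisVec]
  have hder2 : HasDerivAt (fun t : ℝ => u (x₀ + t • (-basisVec j))) (- pd j u x₀) 0 := by
    have := hasDerivAt_line (f := u) (x := x₀) (v := -basisVec j) (t := 0) (by simpa using hdu)
    convert this using 1
    fin_cases j <;> simp [basisVec]
  have hderk : HasDerivAt (fun t : ℝ => (A * t + (S / d ^ 2 + B) * t ^ 2)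
      - (1 / 2) * (u (x₀ + t • basisVec j) - u (x₀ + t • (-basisVec j)))) (A - pd j u x₀) 0 := by
    have h1 : HasDerivAt (fun t : ℝ => A * t + (S / d ^ 2 + B) * t ^ 2) A 0 := by
      have h0 : HasDerivAt (fun t : ℝ => A * t + (S / d ^ 2 + B) * t ^ 2)
          (A * 1 + (S / d ^ 2 + B) * (((2 : ℕ) : ℝ) * 0 ^ (2 - 1) * 1)) 0 :=
        ((hasDerivAt_id (0 : ℝ)).const_mul A).add
          (((hasDerivAt_id (0 : ℝ)).pow 2).const_mul (S / d ^ 2 + B))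
      simpa using h0
    exact (h1.sub ((hder1.sub hder2).const_mul (1 / 2))).congr_deriv (by ring)
  have := nonneg_of_hasDerivAt_of_nonneg hderk (by simp) hd (by
    intro t ht htd
    have hmem : (t • basisVec j : Plane) ∈ Metric.closedBall (0 : Plane) d ∩ {y | 0 ≤ y j} := by
      refine ⟨?_, ?_⟩
      · simp [norm_smul, abs_of_pos ht, htd.le]
      · change 0 ≤ (t • basisVec j : Plane) j
        rw [ev]; exact ht.le
    have h1 := key _ hmem
    simp only [hg, hψ, efl, ev] at h1
    have h2 : (t • basisVec j : Plane) 0 * (t • basisVec j : Plane) 0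
        + (t • basisVec j : Plane) 1 * (t • basisVec j : Plane) 1 = t ^ 2 := by
      have := norm_sq_plane (t • basisVec j)
      rw [norm_smul, norm_basisVec, mul_one, Real.norm_eq_abs, sq_abs] at this
      rw [this]; ring
    rw [h2] at h1
    linarith)
  linarith

lemma pd_neg_fun (j : Fin 2) (u : Plane → ℝ) : pd j (fun y => - u y) = fun y => - pd j u y :=
  funext fun _ => pd_neg j

lemma lap_neg (u : Plane → ℝ) (x : Plane) : lap (fun y => - u y) x = - lap u x := by
  simp only [lap, pd_neg_fun]; ring

/-- Interior gradient estimate for the Poisson equation. -/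
lemma abs_pd_le_of_lap_bound {u : Plane → ℝ} {x₀ : Plane} {D d S N : ℝ} (j : Fin 2) (hd : 0 < d)
    (hdD : d < D) (hu : ContDiffOn ℝ 2 u (Metric.ball x₀ D))
    (hS : ∀ x ∈ Metric.ball x₀ D, |u x| ≤ S)
    (hN : ∀ x ∈ Metric.ball x₀ D, |lap u x| ≤ N) :
    |pd j u x₀| ≤ 2 * S / d + N * d / 2 := by
  have main : ∀ v : Plane → ℝ, ContDiffOn ℝ 2 v (Metric.ball x₀ D) →
      (∀ x ∈ Metric.ball x₀ D, |v x| ≤ S) → (∀ x ∈ Metric.ball x₀ D, |lap v x| ≤ N) →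
      pd j v x₀ ≤ 2 * S / d + N * d / 2 := by
    intro v h1 h2 h3
    refine le_of_forall_pos_le_add fun η hη => ?_
    have := pd_le_of_lap_bound_of_lt (N' := N + 2 * η / d) j hd hdD h1 h2 h3
      (by have : 0 < 2 * η / d := by positivity
          linarith)
    refine this.trans (le_of_eq ?_)
    field_simp; ring
  rw [abs_le']
  refine ⟨main u hu hS hN, ?_⟩
  have := main (fun y => - u y) hu.neg (fun x hx => by rw [abs_neg]; exact hS x hx)
    (fun x hx => by rw [lap_neg, abs_neg]; exact hN x hx)
  rwa [pd_neg_fun] at this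

/-- Interior gradient estimate with a drift: the first-order term is absorbed by maximizing the
gradient against the distance to the boundary of a disc. -/
lemma abs_pd_le_of_drift_bound {u : Plane → ℝ} {x₀ : Plane} {β : Fin 2 → Plane → ℝ} {d S N B : ℝ}
    (hd : 0 < d) (hB : 0 ≤ B)
    (hu : ContDiffOn ℝ 2 u (Metric.ball x₀ d)) (hS : ∀ x ∈ Metric.ball x₀ d, |u x| ≤ S)
    (hβ : ∀ j, ∀ x ∈ Metric.ball x₀ d, |β j x| ≤ B / d)
    (hN : ∀ x ∈ Metric.ball x₀ d, |lap u x + (β 0 x * pd 0 u x + β 1 x * pd 1 u x)| ≤ N)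
    (j : Fin 2) :
    |pd j u x₀| ≤ 64 * (B + 1) * (S / d + d * N) := by
  have hx₀ : x₀ ∈ Metric.ball x₀ d := Metric.mem_ball_self hd
  have hS0 : 0 ≤ S := (abs_nonneg _).trans (hS x₀ hx₀)
  have hN0 : 0 ≤ N := (abs_nonneg _).trans (hN x₀ hx₀)
  set ρ := d / 2 with hρ
  have hρ0 : 0 < ρ := by positivity
  set G : Plane → ℝ := fun x => |pd 0 u x| + |pd 1 u x| with hG
  have hG0 : ∀ x, 0 ≤ G x := fun x => by positivity
  have hcl : Metric.closedBall x₀ ρ ⊆ Metric.ball x₀ d :=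
    Metric.closedBall_subset_ball (by rw [hρ]; linarith)
  have hGc : ContinuousOn G (Metric.closedBall x₀ ρ) := by
    have : ∀ l, ContinuousOn (pd l u) (Metric.closedBall x₀ ρ) := fun l =>
      ((contDiffOn_pd (n := 1) l Metric.isOpen_ball hu).continuousOn).mono hcl
    exact (this 0).abs.add (this 1).abs
  obtain ⟨z, hz, hmax⟩ := (isCompact_closedBall x₀ ρ).exists_isMaxOn
    ⟨x₀, Metric.mem_closedBall_self hρ0.le⟩
    (f := fun x => (ρ - dist x x₀) * G x) ((by fun_prop : ContinuousOn (fun x => ρ - dist x x₀)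
      (Metric.closedBall x₀ ρ)).mul hGc)
  set A := (ρ - dist z x₀) * G z with hA
  have hmax' : ∀ x ∈ Metric.closedBall x₀ ρ, (ρ - dist x x₀) * G x ≤ A := fun x hx => hmax hx
  have hzρ : dist z x₀ ≤ ρ := hz
  have hA0 : 0 ≤ A := mul_nonneg (by linarith) (hG0 z)
  have hGx₀ : ρ * G x₀ ≤ A := by
    have := hmax' x₀ (Metric.mem_closedBall_self hρ0.le); simpa using this
  have hfin : A ≤ 32 * (B + 1) * S + d ^ 2 * N := by
    rcases hzρ.lt_or_eq with hlt | heq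
    swap
    · have : A = 0 := by rw [hA, heq]; ring
      rw [this]; positivity
    set δ := ρ - dist z x₀ with hδ
    have hδ0 : 0 < δ := by rw [hδ]; linarith
    have hδρ : δ ≤ ρ := by rw [hδ]; linarith [dist_nonneg (x := z) (y := x₀)]
    -- with this `θ` the drift contributes at most `A / 2` to the bound for `A`
    set θ := 1 / (2 * (B + 1)) with hθ
    have hθ0 : 0 < θ := by positivity
    have hθ1 : θ ≤ 1 / 2 := by
      rw [hθ]; apply one_div_le_one_div_of_le <;> linarith
    have hθB : θ * (B + 1) = 1 / 2 := by rw [hθ]; field_simp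
    have hsub : ∀ y ∈ Metric.ball z (θ * δ), δ / 2 ≤ ρ - dist y x₀ := by
      intro y hy
      have h1 : dist y z < θ * δ := hy
      have h2 := dist_triangle y z x₀
      have h3 : θ * δ ≤ 1 / 2 * δ := by gcongr
      rw [hδ] at *; linarith
    have hsub' : Metric.ball z (θ * δ) ⊆ Metric.closedBall x₀ ρ := by
      intro y hy; have := hsub y hy; rw [Metric.mem_closedBall]; linarith
    have hGy : ∀ y ∈ Metric.ball z (θ * δ), G y ≤ 2 * A / δ := by
      intro y hy
      have h1 := hmax' y (hsub' hy)
      have h2 : δ / 2 * G y ≤ A := (mul_le_mul_of_nonneg_right (hsub y hy) (hG0 y)).trans h1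
      rw [le_div_iff₀ hδ0]; linarith
    have hlap : ∀ y ∈ Metric.ball z (θ * δ), |lap u y| ≤ N + B / d * (2 * A / δ) := by
      intro y hy
      have hyd := hcl (hsub' hy)
      have h1 := hN y hyd
      have h2 : |β 0 y * pd 0 u y + β 1 y * pd 1 u y| ≤ B / d * (2 * A / δ) := by
        calc _ ≤ |β 0 y| * |pd 0 u y| + |β 1 y| * |pd 1 u y| := by
              rw [← abs_mul, ← abs_mul]; exact abs_add_le _ _
          _ ≤ B / d * |pd 0 u y| + B / d * |pd 1 u y| := by
              gcongr
              · exact hβ 0 y hyd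
              · exact hβ 1 y hyd
          _ = B / d * G y := by rw [hG]; ring
          _ ≤ _ := by gcongr; exact hGy y hy
      calc |lap u y| = |(lap u y + (β 0 y * pd 0 u y + β 1 y * pd 1 u y))
            - (β 0 y * pd 0 u y + β 1 y * pd 1 u y)| := by congr 1; ring
        _ ≤ _ := (abs_sub _ _).trans (add_le_add h1 h2)
    have hest : ∀ l, |pd l u z| ≤ 2 * S / (θ * δ / 2)
        + (N + B / d * (2 * A / δ)) * (θ * δ / 2) / 2 := fun l =>
      abs_pd_le_of_lap_bound l (by positivity) (by have := mul_pos hθ0 hδ0; linarith)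
        (hu.mono (hsub'.trans hcl)) (fun x hx => hS x (hcl (hsub' hx))) hlap
    have hGz : G z ≤ 8 * S / (θ * δ) + N * (θ * δ) / 2 + B / d * A * θ := by
      have h0 := hest 0
      have h1 := hest 1
      have : G z ≤ 2 * (2 * S / (θ * δ / 2)
        + (N + B / d * (2 * A / δ)) * (θ * δ / 2) / 2) := by rw [hG]; linarith
      refine this.trans (le_of_eq ?_)
      field_simp; ring
    have hA1 : A ≤ 8 * S / θ + N * θ * δ ^ 2 / 2 + θ * B * A * (δ / d) := by
      calc A = δ * G z := rfl
        _ ≤ δ * (8 * S / (θ * δ) + N * (θ * δ) / 2 + B / d * A * θ) := by gcongr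
        _ = _ := by field_simp
    have hδd : δ / d ≤ 1 := by rw [div_le_one hd]; linarith
    have h3 : θ * B * A * (δ / d) ≤ A / 2 := by
      calc θ * B * A * (δ / d) ≤ θ * B * A * 1 := by gcongr
        _ ≤ θ * (B + 1) * A := by nlinarith [mul_nonneg hθ0.le hA0]
        _ = A / 2 := by rw [hθB]; ring
    have h4 : 8 * S / θ = 16 * (B + 1) * S := by rw [hθ]; field_simp; ring
    have h5 : N * θ * δ ^ 2 / 2 ≤ d ^ 2 * N / 2 := by
      have : δ ^ 2 ≤ d ^ 2 := by gcongr; linarith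
      have h6 : θ * δ ^ 2 ≤ 1 * d ^ 2 := by gcongr; linarith
      nlinarith
    linarith
  have hpj : |pd j u x₀| ≤ G x₀ := by
    fin_cases j
    · exact le_add_of_nonneg_right (abs_nonneg _)
    · exact le_add_of_nonneg_left (abs_nonneg _)
  have h6 : G x₀ ≤ (32 * (B + 1) * S + d ^ 2 * N) / ρ := by
    rw [le_div_iff₀ hρ0]; linarith
  have h7 : (32 * (B + 1) * S + d ^ 2 * N) / ρ = 64 * (B + 1) * (S / d) + 2 * (d * N) := by
    rw [hρ]; field_simp; ring
  have h8 : 0 ≤ d * N := by positivity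
  nlinarith [mul_nonneg hB h8]

/-! ### Uniform bounds for scaled derivatives of families of functions -/

section families
variable {ι : Type*} {r : ι → ℝ} {s s' : ι → Set Plane} {f g : ι → Plane → ℝ}

/-- The family `f i` is bounded on the sets `s i`, uniformly in `i`. -/
def UnifBdd (s : ι → Set Plane) (f : ι → Plane → ℝ) : Prop :=
  ∃ K : ℝ, ∀ i, ∀ x ∈ s i, |f i x| ≤ K

/-- The scaled partial derivatives `r i ^ |μ| ∂^μ (f i)` with `|μ| ≤ k` exist and are bounded on
the sets `s i`, uniformly in `i`. Estimates whose constants do not depend on `i` are thus statements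
about the whole family. -/
def BddDeriv (r : ι → ℝ) (s : ι → Set Plane) : ℕ → (ι → Plane → ℝ) → Prop
  | 0, f => UnifBdd s f
  | k + 1, f => UnifBdd s f ∧ (∀ i, DifferentiableOn ℝ (f i) (s i)) ∧
      ∀ j, BddDeriv r s k (fun i x => r i * pd j (f i) x)

lemma BddDeriv.unifBdd {k : ℕ} (h : BddDeriv r s k f) : UnifBdd s f := by
  cases k with
  | zero => exact h
  | succ k => exact h.1

lemma BddDeriv.pred {k : ℕ} (h : BddDeriv r s (k + 1) f) : BddDeriv r s k f := by
  induction k generalizing f with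
  | zero => exact h.1
  | succ k ih => exact ⟨h.1, h.2.1, fun j => ih (h.2.2 j)⟩

lemma BddDeriv.of_le {k l : ℕ} (h : BddDeriv r s k f) (hl : l ≤ k) : BddDeriv r s l f := by
  induction k, hl using Nat.le_induction with
  | base => exact h
  | succ k _ ih => exact ih h.pred

lemma UnifBdd.mono (h : UnifBdd s f) (hs : ∀ i, s' i ⊆ s i) : UnifBdd s' f :=
  let ⟨K, hK⟩ := h
  ⟨K, fun i x hx => hK i x (hs i hx)⟩

lemma BddDeriv.mono {k : ℕ} (h : BddDeriv r s k f) (hs : ∀ i, s' i ⊆ s i) :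
    BddDeriv r s' k f := by
  induction k generalizing f with
  | zero => exact UnifBdd.mono h hs
  | succ k ih => exact ⟨h.1.mono hs, fun i => (h.2.1 i).mono (hs i), fun j => ih (h.2.2 j)⟩

lemma UnifBdd.congr (h : UnifBdd s f) (hfg : ∀ i, Set.EqOn (g i) (f i) (s i)) : UnifBdd s g :=
  let ⟨K, hK⟩ := h
  ⟨K, fun i x hx => by rw [hfg i hx]; exact hK i x hx⟩

lemma BddDeriv.congr {k : ℕ} (h : BddDeriv r s k f) (hs : ∀ i, IsOpen (s i))
    (hfg : ∀ i, Set.EqOn (g i) (f i) (s i)) : BddDeriv r s k g := by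
  induction k generalizing f g with
  | zero => exact UnifBdd.congr h hfg
  | succ k ih =>
    refine ⟨h.1.congr hfg, fun i => (h.2.1 i).congr (hfg i), fun j => ih (h.2.2 j) fun i x hx => ?_⟩
    simp only [pd_congr_on (hs i) j (hfg i) hx]

lemma UnifBdd.add (hf : UnifBdd s f) (hg : UnifBdd s g) : UnifBdd s (fun i x => f i x + g i x) :=
  let ⟨K, hK⟩ := hf
  let ⟨L, hL⟩ := hg
  ⟨K + L, fun i x hx => (abs_add_le _ _).trans (add_le_add (hK i x hx) (hL i x hx))⟩

lemma UnifBdd.mul (hf : UnifBdd s f) (hg : UnifBdd s g) : UnifBdd s (fun i x => f i x * g i x) :=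
  let ⟨K, hK⟩ := hf
  let ⟨L, hL⟩ := hg
  ⟨K * L, fun i x hx => by
    rw [abs_mul]
    exact mul_le_mul (hK i x hx) (hL i x hx) (abs_nonneg _) ((abs_nonneg _).trans (hK i x hx))⟩

lemma bddDeriv_const {k : ℕ} {c : ι → ℝ} (hc : ∃ K, ∀ i, |c i| ≤ K) :
    BddDeriv r s k (fun i _ => c i) := by
  induction k generalizing c with
  | zero => exact let ⟨K, hK⟩ := hc; ⟨K, fun i _ _ => hK i⟩
  | succ k ih =>
    refine ⟨let ⟨K, hK⟩ := hc; ⟨K, fun i _ _ => hK i⟩, fun i => differentiableOn_const _,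
      fun j => ?_⟩
    simp only [pd_const, mul_zero]
    exact ih ⟨0, by simp⟩

lemma BddDeriv.add {k : ℕ} (hs : ∀ i, IsOpen (s i)) (hf : BddDeriv r s k f)
    (hg : BddDeriv r s k g) : BddDeriv r s k (fun i x => f i x + g i x) := by
  induction k generalizing f g with
  | zero => exact UnifBdd.add hf hg
  | succ k ih =>
    refine ⟨hf.1.add hg.1, fun i => (hf.2.1 i).add (hg.2.1 i), fun j =>
      (ih (hf.2.2 j) (hg.2.2 j)).congr hs fun i x hx => ?_⟩
    have h1 := (hf.2.1 i).differentiableAt ((hs i).mem_nhds hx)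
    have h2 := (hg.2.1 i).differentiableAt ((hs i).mem_nhds hx)
    simp only [pd_add j h1 h2]; ring

lemma BddDeriv.mul {k : ℕ} (hs : ∀ i, IsOpen (s i)) (hf : BddDeriv r s k f)
    (hg : BddDeriv r s k g) : BddDeriv r s k (fun i x => f i x * g i x) := by
  induction k generalizing f g with
  | zero => exact UnifBdd.mul hf hg
  | succ k ih =>
    refine ⟨hf.1.mul hg.1, fun i => (hf.2.1 i).mul (hg.2.1 i), fun j =>
      ((ih (hf.2.2 j) hg.pred).add hs (ih hf.pred (hg.2.2 j))).congr hs fun i x hx => ?_⟩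
    have h1 := (hf.2.1 i).differentiableAt ((hs i).mem_nhds hx)
    have h2 := (hg.2.1 i).differentiableAt ((hs i).mem_nhds hx)
    simp only [pd_mul j h1 h2]; ring

lemma BddDeriv.const_mul {k : ℕ} (hs : ∀ i, IsOpen (s i)) (c : ℝ) (hf : BddDeriv r s k f) :
    BddDeriv r s k (fun i x => c * f i x) :=
  (bddDeriv_const (c := fun _ => c) ⟨|c|, fun _ => le_rfl⟩).mul hs hf

lemma BddDeriv.sub {k : ℕ} (hs : ∀ i, IsOpen (s i)) (hf : BddDeriv r s k f)
    (hg : BddDeriv r s k g) : BddDeriv r s k (fun i x => f i x - g i x) :=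
  (hf.add hs (hg.const_mul hs (-1))).congr hs fun i x _ => by ring

lemma BddDeriv.inv {k : ℕ} (hs : ∀ i, IsOpen (s i)) (hf : BddDeriv r s k f) {c : ℝ} (hc : 0 < c)
    (hfc : ∀ i, ∀ x ∈ s i, c ≤ f i x) : BddDeriv r s k (fun i x => (f i x)⁻¹) := by
  have h0 : UnifBdd s (fun i x => (f i x)⁻¹) := ⟨c⁻¹, fun i x hx => by
    have := hfc i x hx
    rw [abs_of_nonneg (inv_nonneg.2 (hc.le.trans this))]
    exact inv_anti₀ hc this⟩
  induction k with
  | zero => exact h0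
  | succ k ih =>
    have hne : ∀ i, ∀ x ∈ s i, f i x ≠ 0 := fun i x hx => (hc.trans_le (hfc i x hx)).ne'
    refine ⟨h0, fun i => (hf.2.1 i).inv (hne i), fun j =>
      (((hf.2.2 j).mul hs ((ih hf.pred).mul hs (ih hf.pred))).const_mul hs (-1)).congr hs
        fun i x hx => ?_⟩
    have h1 := (hf.2.1 i).differentiableAt ((hs i).mem_nhds hx)
    have := pd_comp j (hasDerivAt_inv (hne i x hx)) h1
    simp only [this]
    have := hne i x hx
    field_simp

/-- Bounds on the scaled norms of the iterated derivatives give uniform bounds on partials. -/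
lemma bddDeriv_of_iteratedFDeriv {k : ℕ} (hr : ∀ i, 0 ≤ r i) (hs : ∀ i, IsOpen (s i))
    (hf : ∀ i, ContDiffOn ℝ k (f i) (s i))
    (hb : ∃ K : ℝ, ∀ i, ∀ l ≤ k, ∀ x ∈ s i, r i ^ l * ‖iteratedFDeriv ℝ l (f i) x‖ ≤ K) :
    BddDeriv r s k f := by
  have h0 : UnifBdd s f := by
    obtain ⟨K, hK⟩ := hb
    refine ⟨K, fun i x hx => ?_⟩
    simpa using hK i 0 (Nat.zero_le _) x hx
  induction k generalizing f with
  | zero => exact h0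
  | succ k ih =>
    obtain ⟨K, hK⟩ := hb
    refine ⟨h0, fun i => (hf i).differentiableOn (by norm_cast), fun j => ?_⟩
    have hc : ∀ i, ContDiffOn ℝ k (pd j (f i)) (s i) := fun i => contDiffOn_pd j (hs i) (hf i)
    have hbd : ∀ i, ∀ l ≤ k, ∀ x ∈ s i,
        r i ^ l * ‖iteratedFDeriv ℝ l (fun x => r i * pd j (f i) x) x‖ ≤ K := by
      intro i l hl x hx
      have hca : ContDiffAt ℝ (k + 1 : ℕ) (f i) x := contDiffAt_of_isOpen (hs i) (hf i) hx
      have hcl : ContDiffAt ℝ l (pd j (f i)) x :=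
        (contDiffAt_pd j hca).of_le (by exact_mod_cast hl)
      have e : iteratedFDeriv ℝ l (fun x => r i * pd j (f i) x) x
          = r i • iteratedFDeriv ℝ l (pd j (f i)) x :=
        iteratedFDeriv_const_smul_apply (a := r i) hcl
      have hfd : ContDiffAt ℝ l (fderiv ℝ (f i)) x :=
        hca.fderiv_right (by exact_mod_cast Nat.succ_le_succ hl)
      have h1 : ‖iteratedFDeriv ℝ l (pd j (f i)) x‖ ≤ ‖iteratedFDeriv ℝ (l + 1) (f i) x‖ := by
        have := norm_iteratedFDeriv_clm_apply_const (c := basisVec j) hfd le_rfl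
        rw [norm_basisVec, one_mul, norm_iteratedFDeriv_fderiv] at this
        exact this
      rw [e, norm_smul, Real.norm_eq_abs, abs_of_nonneg (hr i), ← mul_assoc, ← pow_succ]
      exact (mul_le_mul_of_nonneg_left h1 (pow_nonneg (hr i) _)).trans
        (hK i (l + 1) (Nat.succ_le_succ hl) x hx)
    refine ih (fun i => contDiffOn_const.mul (hc i)) ⟨K, hbd⟩ ⟨K, fun i x hx => ?_⟩
    simpa using hbd i 0 (Nat.zero_le _) x hx

/-- Uniform bounds on partials give bounds on the scaled norms of the iterated derivatives. -/
lemma BddDeriv.iteratedFDeriv_le {k : ℕ} (hr : ∀ i, 0 ≤ r i) (hs : ∀ i, IsOpen (s i))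
    (hf : ∀ i, ContDiffOn ℝ k (f i) (s i)) (hb : BddDeriv r s k f) :
    ∃ K : ℝ, ∀ i, ∀ l ≤ k, ∀ x ∈ s i, r i ^ l * ‖iteratedFDeriv ℝ l (f i) x‖ ≤ K := by
  induction k generalizing f with
  | zero =>
    obtain ⟨K, hK⟩ := hb
    refine ⟨K, fun i l hl x hx => ?_⟩
    obtain rfl := Nat.le_zero.1 hl
    simpa using hK i x hx
  | succ k ih =>
    obtain ⟨K, hK⟩ := hb.1
    have hc : ∀ j i, ContDiffOn ℝ k (pd j (f i)) (s i) :=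
      fun j i => contDiffOn_pd j (hs i) (hf i)
    choose L hL using fun j => ih (fun i => contDiffOn_const.mul (hc j i)) (hb.2.2 j)
    refine ⟨max K (L 0 + L 1), fun i l hl x hx => ?_⟩
    cases l with
    | zero => refine le_max_of_le_left ?_; simpa using hK i x hx
    | succ l =>
      refine le_max_of_le_right ?_
      have hl' : l ≤ k := Nat.le_of_succ_le_succ hl
      have hcl : ∀ j, ContDiffAt ℝ l (pd j (f i)) x := fun j =>
        (contDiffAt_of_isOpen (hs i) (hc j i) hx).of_le (by exact_mod_cast hl')
      set Φ : Fin 2 → ℝ →L[ℝ] (Plane →L[ℝ] ℝ) := fun j =>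
        ContinuousLinearMap.toSpanSingleton ℝ (EuclideanSpace.proj j : Plane →L[ℝ] ℝ) with hΦ
      have e : fderiv ℝ (f i) = (Φ 0 ∘ pd 0 (f i)) + (Φ 1 ∘ pd 1 (f i)) := by
        funext y
        ext v
        rw [fderiv_apply_eq_pd]
        simp [hΦ, ContinuousLinearMap.toSpanSingleton_apply]
        ring
      have hΦn : ∀ j, ‖Φ j‖ ≤ 1 := by
        intro j
        rw [hΦ, ContinuousLinearMap.norm_toSpanSingleton]
        refine ContinuousLinearMap.opNorm_le_bound _ zero_le_one fun v => ?_
        rw [one_mul]; exact PiLp.norm_apply_le v j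
      have h2 : ∀ j, ‖iteratedFDeriv ℝ l (Φ j ∘ pd j (f i)) x‖
          ≤ ‖iteratedFDeriv ℝ l (pd j (f i)) x‖ := fun j =>
        ((Φ j).norm_iteratedFDeriv_comp_left (hcl j) le_rfl).trans
          (mul_le_of_le_one_left (norm_nonneg _) (hΦn j))
      have h3 : ‖iteratedFDeriv ℝ (l + 1) (f i) x‖
          ≤ ‖iteratedFDeriv ℝ l (pd 0 (f i)) x‖
            + ‖iteratedFDeriv ℝ l (pd 1 (f i)) x‖ := by
        rw [← norm_iteratedFDeriv_fderiv, e, iteratedFDeriv_add_apply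
          ((Φ 0).contDiff.contDiffAt.comp x (hcl 0)) ((Φ 1).contDiff.contDiffAt.comp x (hcl 1))]
        exact (norm_add_le _ _).trans (add_le_add (h2 0) (h2 1))
      have h4 : ∀ j, r i ^ (l + 1) * ‖iteratedFDeriv ℝ l (pd j (f i)) x‖ ≤ L j := by
        intro j
        have := hL j i l hl' x hx
        have e : iteratedFDeriv ℝ l (fun x => r i * pd j (f i) x) x
            = r i • iteratedFDeriv ℝ l (pd j (f i)) x :=
          iteratedFDeriv_const_smul_apply (a := r i) (hcl j)
        rw [e, norm_smul, Real.norm_eq_abs, abs_of_nonneg (hr i), ← mul_assoc, ← pow_succ] at this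
        exact this
      calc _ ≤ r i ^ (l + 1) * (‖iteratedFDeriv ℝ l (pd 0 (f i)) x‖
            + ‖iteratedFDeriv ℝ l (pd 1 (f i)) x‖) :=
            mul_le_mul_of_nonneg_left h3 (pow_nonneg (hr i) _)
        _ = _ := mul_add _ _ _
        _ ≤ _ := add_le_add (h4 0) (h4 1)

end families

/-! ### Difference quotients along isometries -/

lemma abs_diffQuot_le {k k' : ℝ → ℝ} {t K : ℝ} (ht : 0 < t)
    (h : ∀ τ ∈ Set.Icc 0 t, HasDerivAt k (k' τ) τ) (hb : ∀ τ ∈ Set.Icc 0 t, |k' τ| ≤ K) :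
    |(k t - k 0) / t| ≤ K := by
  have := (convex_Icc (0 : ℝ) t).norm_image_sub_le_of_norm_hasDerivWithin_le
    (fun τ hτ => (h τ hτ).hasDerivWithinAt) hb (Set.left_mem_Icc.2 ht.le)
      (Set.right_mem_Icc.2 ht.le)
  rw [Real.norm_eq_abs, Real.norm_eq_abs, sub_zero, abs_of_pos ht] at this
  rwa [abs_div, abs_of_pos ht, div_le_iff₀ ht]

lemma abs_le_of_slope_le {k : ℝ → ℝ} {c K δ : ℝ} (hk : HasDerivAt k c 0) (hδ : 0 < δ)
    (h : ∀ t, 0 < t → t < δ → |(k t - k 0) / t| ≤ K) : |c| ≤ K := by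
  refine le_of_tendsto hk.tendsto_slope_zero_right.abs ?_
  filter_upwards [Ioo_mem_nhdsGT hδ] with t ht
  have := h t ht.1 ht.2
  rwa [zero_add, smul_eq_mul, mul_comm, ← div_eq_mul_inv]

/-- The equation satisfied by the difference quotient of a solution along an affine isometry
`y ↦ c + A y`; the vector field is transported by the adjoint of `A`. -/
lemma diffQuot_equation {u φ : Plane → ℝ} {β : Fin 2 → Plane → ℝ} (A : Plane →L[ℝ] Plane)
    (c : Plane) {x : Plane} (ρ t : ℝ)
    (h00 : (A (basisVec 0)) 0 ^ 2 + (A (basisVec 1)) 0 ^ 2 = 1)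
    (h11 : (A (basisVec 0)) 1 ^ 2 + (A (basisVec 1)) 1 ^ 2 = 1)
    (h01 : (A (basisVec 0)) 0 * (A (basisVec 0)) 1 + (A (basisVec 1)) 0 * (A (basisVec 1)) 1 = 0)
    (hu : ContDiffAt ℝ 2 u x) (hg : ContDiffAt ℝ 2 u (c + A x))
    (e1 : ρ ^ 2 * lap u x + (β 0 x * (ρ * pd 0 u x) + β 1 x * (ρ * pd 1 u x)) = φ x)
    (e2 : ρ ^ 2 * lap u (c + A x) + (β 0 (c + A x) * (ρ * pd 0 u (c + A x))
      + β 1 (c + A x) * (ρ * pd 1 u (c + A x))) = φ (c + A x)) :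
    ρ ^ 2 * lap (fun y => t⁻¹ * (u (c + A y) - u y)) x
      + (β 0 x * (ρ * pd 0 (fun y => t⁻¹ * (u (c + A y) - u y)) x)
        + β 1 x * (ρ * pd 1 (fun y => t⁻¹ * (u (c + A y) - u y)) x))
    = (φ (c + A x) - φ x) / t
      - (((A (basisVec 0)) 0 * β 0 (c + A x) + (A (basisVec 0)) 1 * β 1 (c + A x) - β 0 x) / t
          * (ρ * pd 0 (fun y => u (c + A y)) x)
        + ((A (basisVec 1)) 0 * β 0 (c + A x) + (A (basisVec 1)) 1 * β 1 (c + A x) - β 1 x) / t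
          * (ρ * pd 1 (fun y => u (c + A y)) x)) := by
  have hcomp : ContDiffAt ℝ 2 (fun y => u (c + A y)) x :=
    ContDiffAt.comp x hg (contDiffAt_const.add A.contDiff.contDiffAt)
  have d1 := hcomp.differentiableAt (by simp)
  have d2 := hu.differentiableAt (by simp)
  have dg := hg.differentiableAt (by simp)
  rw [lap_const_mul _ (hcomp.sub hu), lap_sub hcomp hu, lap_comp_affine A c h00 h11 h01 hg]
  simp only [pd_const_mul _ _ (d1.fun_sub d2), pd_sub _ d1 d2, pd_comp_affine _ A c dg,
    div_eq_mul_inv, ← e1, ← e2]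
  linear_combination (t⁻¹ * ρ * β 0 (c + A x) * pd 0 u (c + A x)) * h00
    + (t⁻¹ * ρ * β 1 (c + A x) * pd 1 u (c + A x)) * h11
    + (t⁻¹ * ρ * (β 0 (c + A x) * pd 1 u (c + A x) + β 1 (c + A x) * pd 0 u (c + A x))) * h01

/-! ### Interior estimates of arbitrary order -/

section interior
variable {ι : Type*} {r : ι → ℝ} {c : ι → Plane} {u φ : ι → Plane → ℝ}
  {β : Fin 2 → ι → Plane → ℝ} {a b : ℝ}

lemma ball_subset_scaled (hr : ∀ i, 0 < r i) (hab : b ≤ a) (i : ι) :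
    Metric.ball (c i) (b * r i) ⊆ Metric.ball (c i) (a * r i) :=
  Metric.ball_subset_ball (mul_le_mul_of_nonneg_right hab (hr i).le)

/-- The gradient estimate with a drift, for families, on discs of radius comparable to `r i`. -/
lemma interior_gradient (hr : ∀ i, 0 < r i) (hab : b < a)
    (hu : ∀ i, ContDiffOn ℝ 2 (u i) (Metric.ball (c i) (a * r i)))
    (hub : UnifBdd (fun i => Metric.ball (c i) (a * r i)) u)
    (hβ : ∀ j, UnifBdd (fun i => Metric.ball (c i) (a * r i)) (β j))
    (hφ : UnifBdd (fun i => Metric.ball (c i) (a * r i)) φ)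
    (heq : ∀ i, ∀ x ∈ Metric.ball (c i) (a * r i), r i ^ 2 * lap (u i) x
      + (β 0 i x * (r i * pd 0 (u i) x) + β 1 i x * (r i * pd 1 (u i) x)) = φ i x) :
    BddDeriv r (fun i => Metric.ball (c i) (b * r i)) 1 u := by
  have hsub := ball_subset_scaled (c := c) hr hab.le
  refine ⟨hub.mono hsub, fun i => ((hu i).differentiableOn (by simp)).mono (hsub i), fun j => ?_⟩
  obtain ⟨S, hS⟩ := hub
  obtain ⟨N, hN⟩ := hφ
  choose B hB using hβ
  set B' := |B 0| + |B 1| with hB'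
  have hBj : ∀ j, B j ≤ B' := by
    intro j
    fin_cases j
    · exact (le_abs_self _).trans (le_add_of_nonneg_right (abs_nonneg _))
    · exact (le_abs_self _).trans (le_add_of_nonneg_left (abs_nonneg _))
  have hB0 : 0 ≤ B' := by positivity
  set δ := a - b with hδ
  have hδ0 : 0 < δ := by rw [hδ]; linarith
  refine ⟨64 * (B' * δ + 1) * (S / δ + δ * N), fun i x hx => ?_⟩
  have hri := hr i
  have hd : 0 < δ * r i := mul_pos hδ0 hri
  have hsub' : Metric.ball x (δ * r i) ⊆ Metric.ball (c i) (a * r i) := by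
    apply Metric.ball_subset_ball'
    have : dist x (c i) < b * r i := hx
    rw [hδ]; linarith
  have key := abs_pd_le_of_drift_bound (u := u i) (x₀ := x) (β := fun j y => β j i y / r i)
    (d := δ * r i) (S := S) (N := N / r i ^ 2) (B := B' * δ) hd (by positivity)
    ((hu i).mono hsub') (fun y hy => hS i y (hsub' hy))
    (fun j y hy => by
      rw [abs_div, abs_of_pos hri, mul_comm δ, ← div_div, mul_div_right_comm,
        mul_div_cancel_right₀ _ hδ0.ne']
      gcongr
      exact (hB j i y (hsub' hy)).trans (hBj j))
    (fun y hy => by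
      have e := heq i y (hsub' hy)
      have : lap (u i) y + (β 0 i y / r i * pd 0 (u i) y + β 1 i y / r i * pd 1 (u i) y)
          = φ i y / r i ^ 2 := by
        rw [← e]; field_simp
      rw [this, abs_div, abs_of_pos (pow_pos hri 2)]
      gcongr
      exact hN i y (hsub' hy)) j
  rw [abs_mul, abs_of_pos hri]
  calc r i * |pd j (u i) x|
      ≤ r i * (64 * (B' * δ + 1) * (S / (δ * r i) + δ * r i * (N / r i ^ 2))) := by gcongr
    _ = _ := by field_simp

/-- Bounds for second derivatives, from the gradient estimate for the difference quotients. -/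
lemma interior_second (hr : ∀ i, 0 < r i) (hab : b < a)
    (hu : ∀ i, ContDiffOn ℝ 2 (u i) (Metric.ball (c i) (a * r i)))
    (hub : UnifBdd (fun i => Metric.ball (c i) (a * r i)) u)
    (hβ : ∀ j, BddDeriv r (fun i => Metric.ball (c i) (a * r i)) 1 (β j))
    (hφ : BddDeriv r (fun i => Metric.ball (c i) (a * r i)) 1 φ)
    (heq : ∀ i, ∀ x ∈ Metric.ball (c i) (a * r i), r i ^ 2 * lap (u i) x
      + (β 0 i x * (r i * pd 0 (u i) x) + β 1 i x * (r i * pd 1 (u i) x)) = φ i x) :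
    BddDeriv r (fun i => Metric.ball (c i) (b * r i)) 2 u := by
  set a₁ := b + 2 * (a - b) / 3 with ha₁
  set a₂ := b + (a - b) / 3 with ha₂
  set δ := (a - b) / 3 with hδ
  have hδ0 : 0 < δ := by rw [hδ]; linarith
  have h1a : a₁ < a := by rw [ha₁]; linarith
  have h21 : a₂ + δ = a₁ := by rw [ha₁, ha₂, hδ]; ring
  have hb2 : b < a₂ := by rw [ha₂]; linarith
  have g1 := interior_gradient hr h1a hu hub (fun j => (hβ j).unifBdd) hφ.unifBdd heq
  have s1 := ball_subset_scaled (c := c) hr h1a.le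
  have hop : ∀ i, IsOpen (Metric.ball (c i) (a * r i)) := fun i => Metric.isOpen_ball
  have hub' : BddDeriv r (fun i => Metric.ball (c i) (b * r i)) 1 u :=
    g1.mono (ball_subset_scaled hr (by linarith))
  have hc2 : ∀ i, ∀ x ∈ Metric.ball (c i) (a * r i), ContDiffAt ℝ 2 (u i) x := fun i x hx =>
    contDiffAt_of_isOpen (hop i) (hu i) hx
  refine ⟨hub'.1, hub'.2.1, fun l => ⟨hub'.2.2 l, fun i x hx => ?_, fun j => ?_⟩⟩
  · have hx' := ball_subset_scaled hr (hb2.le.trans (by linarith : a₂ ≤ a)) i hx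
    exact ((differentiableAt_pd l (hc2 i x hx')).const_mul _).differentiableWithinAt
  -- The second derivatives are limits of the gradients of the difference quotients, which solve an
  -- equation with the same drift and a bounded right-hand side.
  -- They form a family indexed by `i` and by the step `t`.
  let κ := ι × {t : ℝ // 0 < t ∧ t < δ}
  let sh : κ → Plane := fun p => (p.2.1 * r p.1) • basisVec j
  let v : κ → Plane → ℝ := fun p y => (p.2.1)⁻¹ *
    (u p.1 (sh p + ContinuousLinearMap.id ℝ Plane y) - u p.1 y)
  have hseg : ∀ i, ∀ x ∈ Metric.ball (c i) (a₂ * r i), ∀ t, 0 ≤ t → t < δ →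
      x + t • (r i • basisVec j) ∈ Metric.ball (c i) (a₁ * r i) := by
    intro i x hx t ht0 ht
    have h1 : ‖x - c i‖ < a₂ * r i := by rwa [← dist_eq_norm]
    rw [Metric.mem_ball, dist_eq_norm]
    have h2 : ‖t • (r i • basisVec j)‖ ≤ δ * r i := by
      rw [norm_smul, norm_smul, norm_basisVec, mul_one, Real.norm_eq_abs, Real.norm_eq_abs,
        abs_of_nonneg ht0, abs_of_pos (hr i)]
      exact mul_le_mul_of_nonneg_right ht.le (hr i).le
    calc ‖x + t • (r i • basisVec j) - c i‖ = ‖(x - c i) + t • (r i • basisVec j)‖ := by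
          congr 1; abel
      _ ≤ ‖x - c i‖ + ‖t • (r i • basisVec j)‖ := norm_add_le _ _
      _ < a₂ * r i + δ * r i := by linarith
      _ = a₁ * r i := by rw [← h21]; ring
  have hsh : ∀ (p : κ) (x : Plane),
      sh p + ContinuousLinearMap.id ℝ Plane x = x + p.2.1 • (r p.1 • basisVec j) := by
    intro p x; simp only [sh, smul_smul, ContinuousLinearMap.id_apply]; rw [add_comm]
  -- a family with one bounded scaled derivative has bounded difference quotients
  have hquot : ∀ f : ι → Plane → ℝ, BddDeriv r (fun i => Metric.ball (c i) (a₁ * r i)) 1 f →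
      UnifBdd (fun p : κ => Metric.ball (c p.1) (a₂ * r p.1)) (fun p y =>
        (f p.1 (sh p + ContinuousLinearMap.id ℝ Plane y) - f p.1 y) / p.2.1) := by
    intro f hf
    obtain ⟨K, hK⟩ := hf.2.2 j
    refine ⟨K, fun p x hx => ?_⟩
    beta_reduce
    rw [hsh]
    have := abs_diffQuot_le (k := fun t => f p.1 (x + t • (r p.1 • basisVec j)))
      (k' := fun t => r p.1 * pd j (f p.1) (x + t • (r p.1 • basisVec j))) (K := K) p.2.2.1
      (fun t ht => by
        have hm := hseg p.1 x hx t ht.1 (ht.2.trans_lt p.2.2.2)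
        have := hasDerivAt_line
          ((hf.2.1 p.1).differentiableAt (Metric.isOpen_ball.mem_nhds hm))
        convert this using 1
        fin_cases j <;> simp [basisVec])
      (fun t ht => hK p.1 _ (hseg p.1 x hx t ht.1 (ht.2.trans_lt p.2.2.2)))
    simpa using this
  have hmem : ∀ (p : κ), ∀ x ∈ Metric.ball (c p.1) (a₂ * r p.1),
      sh p + ContinuousLinearMap.id ℝ Plane x ∈ Metric.ball (c p.1) (a * r p.1) := by
    intro p x hx; rw [hsh]
    exact s1 _ (hseg p.1 x hx _ p.2.2.1.le p.2.2.2)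
  have s2 : ∀ i, Metric.ball (c i) (a₂ * r i) ⊆ Metric.ball (c i) (a * r i) :=
    ball_subset_scaled hr (by linarith)
  have hpdsh : ∀ l (p : κ), ∀ x ∈ Metric.ball (c p.1) (a₂ * r p.1),
      pd l (fun y => u p.1 (sh p + ContinuousLinearMap.id ℝ Plane y)) x
        = pd l (u p.1) (sh p + ContinuousLinearMap.id ℝ Plane x) := by
    intro l p x hx
    rw [pd_comp_affine l _ _ ((hc2 p.1 _ (hmem p x hx)).differentiableAt (by simp))]
    fin_cases l <;> simp [basisVec]
  have hvC : ∀ p : κ, ContDiffOn ℝ 2 (v p) (Metric.ball (c p.1) (a₂ * r p.1)) := fun p x hx => by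
    refine (contDiffAt_const.mul (ContDiffAt.sub ?_ (hc2 p.1 x (s2 _ hx)))).contDiffWithinAt
    exact ContDiffAt.comp x (hc2 p.1 _ (hmem p x hx))
      (contDiffAt_const.add (ContinuousLinearMap.id ℝ Plane).contDiff.contDiffAt)
  have key := interior_gradient (ι := κ) (r := fun p => r p.1) (c := fun p => c p.1) (u := v)
    (β := fun l p => β l p.1) (a := a₂) (b := b)
    (φ := fun p x => r p.1 ^ 2 * lap (v p) x + (β 0 p.1 x * (r p.1 * pd 0 (v p) x)
      + β 1 p.1 x * (r p.1 * pd 1 (v p) x))) (fun p => hr p.1) hb2 hvC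
    ((hquot u g1).congr fun p x _ => by simp only [v]; rw [div_eq_mul_inv, mul_comm])
    (fun l => let ⟨K, hK⟩ := (hβ l).unifBdd; ⟨K, fun p x hx => hK p.1 x (s2 _ hx)⟩)
    (by
      have hpdu : ∀ l, UnifBdd (fun p : κ => Metric.ball (c p.1) (a₂ * r p.1)) (fun p y =>
          r p.1 * pd l (u p.1) (sh p + ContinuousLinearMap.id ℝ Plane y)) := by
        intro l
        obtain ⟨K, hK⟩ := g1.2.2 l
        refine ⟨K, fun p x hx => hK p.1 _ ?_⟩
        rw [hsh]; exact hseg p.1 x hx _ p.2.2.1.le p.2.2.2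
      have hq : ∀ l, _ := fun l => hquot (β l) ((hβ l).mono s1)
      obtain ⟨K, hK⟩ := (hquot φ (hφ.mono s1))
      obtain ⟨K', hK'⟩ := ((hq 0).mul (hpdu 0)).add ((hq 1).mul (hpdu 1))
      refine ⟨K + K', fun p x hx => ?_⟩
      have := diffQuot_equation (u := u p.1) (φ := φ p.1) (β := fun l => β l p.1)
        (ContinuousLinearMap.id ℝ Plane) (sh p) (x := x) (r p.1) p.2.1 (by simp [basisVec])
        (by simp [basisVec]) (by simp [basisVec]) (hc2 _ _ (s2 _ hx)) (hc2 _ _ (hmem p x hx))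
        (heq _ _ (s2 _ hx)) (heq _ _ (hmem p x hx))
      simp only [v]
      rw [this, hpdsh 0 p x hx, hpdsh 1 p x hx]
      have e0 : ∀ y : ℝ, ∀ z : ℝ, (ContinuousLinearMap.id ℝ Plane (basisVec 0)) 0 * y
        + (ContinuousLinearMap.id ℝ Plane (basisVec 0)) 1 * z = y := by simp [basisVec]
      have e1 : ∀ y : ℝ, ∀ z : ℝ, (ContinuousLinearMap.id ℝ Plane (basisVec 1)) 0 * y
        + (ContinuousLinearMap.id ℝ Plane (basisVec 1)) 1 * z = z := by simp [basisVec]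
      rw [e0, e1]
      exact (abs_sub _ _).trans (add_le_add (hK p x hx) (hK' p x hx)))
    (fun p x _ => rfl)
  obtain ⟨K, hK⟩ := key.2.2 l
  refine ⟨K, fun i x hx => ?_⟩
  have hx2 : x ∈ Metric.ball (c i) (a₂ * r i) := ball_subset_scaled hr hb2.le i hx
  have hcx := hc2 i x (s2 i hx2)
  have hdpd := differentiableAt_pd l hcx
  have hder : HasDerivAt (fun t : ℝ => r i * pd l (u i) (x + t • (r i • basisVec j)))
      (r i * (r i * pd j (pd l (u i)) x)) 0 := by
    refine ((hasDerivAt_line (f := pd l (u i)) (x := x) (v := r i • basisVec j) (t := 0)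
      (by simpa using hdpd)).const_mul (r i)).congr_deriv ?_
    fin_cases j <;> simp [basisVec]
  have := abs_le_of_slope_le hder hδ0 (K := K) (fun t ht0 ht => by
    have h1 := hK (i, ⟨t, ht0, ht⟩) x hx
    have hm := hmem (i, ⟨t, ht0, ht⟩) x hx2
    have hcm : ContDiffAt ℝ 2 (fun y => u i (sh (i, ⟨t, ht0, ht⟩)
        + ContinuousLinearMap.id ℝ Plane y)) x := ContDiffAt.comp x (hc2 i _ hm)
      (contDiffAt_const.add (ContinuousLinearMap.id ℝ Plane).contDiff.contDiffAt)
    simp only [v] at h1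
    have d1 := hcm.differentiableAt (by simp)
    have d2 := hcx.differentiableAt (by simp)
    rw [pd_const_mul l _ (d1.fun_sub d2), pd_sub l d1 d2,
      hpdsh l (i, ⟨t, ht0, ht⟩) x hx2, hsh] at h1
    convert h1 using 2
    simp only [zero_smul, add_zero]
    ring)
  beta_reduce
  rw [pd_const_mul j _ hdpd]
  exact this

/-- Interior estimates of all orders for `r² Δu + β · (r ∇u) = φ` on discs of radius comparable to
`r`. -/
theorem interior_estimate (hr : ∀ i, 0 < r i) (k : ℕ) (hab : b < a)
    (hu : ∀ i, ContDiffOn ℝ (k + 2 : ℕ) (u i) (Metric.ball (c i) (a * r i)))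
    (hub : UnifBdd (fun i => Metric.ball (c i) (a * r i)) u)
    (hβ : ∀ j, BddDeriv r (fun i => Metric.ball (c i) (a * r i)) (k + 1) (β j))
    (hφ : BddDeriv r (fun i => Metric.ball (c i) (a * r i)) (k + 1) φ)
    (heq : ∀ i, ∀ x ∈ Metric.ball (c i) (a * r i), r i ^ 2 * lap (u i) x
      + (β 0 i x * (r i * pd 0 (u i) x) + β 1 i x * (r i * pd 1 (u i) x)) = φ i x) :
    BddDeriv r (fun i => Metric.ball (c i) (b * r i)) (k + 2) u := by
  induction k generalizing u φ a b with
  | zero => exact interior_second hr hab hu hub hβ hφ heq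
  | succ k ih =>
    set a₁ := (a + b) / 2 with ha₁
    have h1 : a₁ < a := by rw [ha₁]; linarith
    have h2 : b < a₁ := by rw [ha₁]; linarith
    have hu1 := ih h1 (fun i => (hu i).of_le (by norm_cast; omega)) hub (fun j => (hβ j).pred)
      hφ.pred heq
    have s1 := ball_subset_scaled (c := c) hr h1.le
    have hop : ∀ i, IsOpen (Metric.ball (c i) (a * r i)) := fun i => Metric.isOpen_ball
    have hop1 : ∀ i, IsOpen (Metric.ball (c i) (a₁ * r i)) := fun i => Metric.isOpen_ball
    have hu1' := hu1.mono (ball_subset_scaled hr h2.le)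
    refine ⟨hu1'.unifBdd, hu1'.2.1, fun j => ?_⟩
    have hC : ∀ l i, ContDiffOn ℝ (k + 2 : ℕ) (pd l (u i)) (Metric.ball (c i) (a * r i)) :=
      fun l i => contDiffOn_pd l (hop i) (hu i)
    refine ih (u := fun i x => r i * pd j (u i) x)
      (φ := fun i x => r i * pd j (φ i) x - ((r i * pd j (β 0 i) x) * (r i * pd 0 (u i) x)
        + (r i * pd j (β 1 i) x) * (r i * pd 1 (u i) x))) h2
      (fun i => contDiffOn_const.mul ((hC j i).mono (s1 i))) (hu1.2.2 j).unifBdd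
      (fun l => (hβ l).pred.mono s1)
      (((hφ.2.2 j).mono s1).sub hop1 ((((hβ 0).2.2 j).mono s1 |>.mul hop1 (hu1.2.2 0)).add hop1
        (((hβ 1).2.2 j).mono s1 |>.mul hop1 (hu1.2.2 1)))) (fun i x hx => ?_)
    have hx' := s1 i hx
    have hn : Metric.ball (c i) (a * r i) ∈ nhds x := (hop i).mem_nhds hx'
    have hu3 : ContDiffOn ℝ 3 (u i) (Metric.ball (c i) (a * r i)) :=
      (hu i).of_le (by norm_cast; omega)
    have hCx : ∀ l, ContDiffAt ℝ 2 (pd l (u i)) x := fun l =>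
      ((hC l i).of_le (by norm_cast; omega)).contDiffAt hn
    have hCl : DifferentiableAt ℝ (lap (u i)) x :=
      (differentiableAt_pd 0 (hCx 0)).add (differentiableAt_pd 1 (hCx 1))
    have hdβ : ∀ l, DifferentiableAt ℝ (β l i) x := fun l => ((hβ l).2.1 i).differentiableAt hn
    have hdp : ∀ l, DifferentiableAt ℝ (fun y => r i * pd l (u i) y) x := fun l =>
      ((hCx l).differentiableAt (by simp)).const_mul _
    have hpd := pd_congr_on (hop i) j (fun x hx => heq i x hx) hx'
    rw [pd_add j (hCl.const_mul _) (((hdβ 0).fun_mul (hdp 0)).fun_add ((hdβ 1).fun_mul (hdp 1))),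
      pd_add j ((hdβ 0).fun_mul (hdp 0)) ((hdβ 1).fun_mul (hdp 1)), pd_mul j (hdβ 0) (hdp 0),
      pd_mul j (hdβ 1) (hdp 1), pd_const_mul j _ hCl, pd_lap j (hop i) hu3 hx',
      pd_const_mul j _ ((hCx 0).differentiableAt (by simp)),
      pd_const_mul j _ ((hCx 1).differentiableAt (by simp))] at hpd
    have hcm : ∀ l, pd j (pd l (u i)) x = pd l (pd j (u i)) x := fun l =>
      pd_comm l j ((hu3.contDiffAt hn).of_le (by norm_num))
    rw [lap_const_mul _ (hCx j), pd_const_mul 0 _ ((hCx j).differentiableAt (by simp)),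
      pd_const_mul 1 _ ((hCx j).differentiableAt (by simp)), ← hcm, ← hcm, ← hpd]
    ring

end interior

/-! ### The exponential barrier -/

lemma lap_const (c : ℝ) (x : Plane) : lap (fun _ => c) x = 0 := by
  have : ∀ j, pd j (fun _ : Plane => c) = fun _ => 0 := fun j => funext fun y => pd_const j c
  simp [lap, this, pd_const]

/-- The function `exp (Λ |x|²)`, which is strictly subharmonic, and a strict subsolution for any
bounded drift away from the origin once `Λ` is large. -/
noncomputable def expSq (Λ : ℝ) (x : Plane) : ℝ := Real.exp (Λ * (x 0 * x 0 + x 1 * x 1))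

lemma expSq_eq (Λ : ℝ) (x : Plane) : expSq Λ x = Real.exp (Λ * ‖x‖ ^ 2) := by
  rw [expSq, norm_sq_plane]; ring_nf

lemma contDiff_expSq_arg (Λ : ℝ) {n : ℕ∞ω} :
    ContDiff ℝ n (fun x : Plane => Λ * (x 0 * x 0 + x 1 * x 1)) :=
  contDiff_const.mul (((contDiff_coord 0).mul (contDiff_coord 0)).add
    ((contDiff_coord 1).mul (contDiff_coord 1)))

lemma contDiff_expSq (Λ : ℝ) {n : ℕ∞ω} : ContDiff ℝ n (expSq Λ) :=
  Real.contDiff_exp.comp (contDiff_expSq_arg Λ)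

lemma pd_expSq_arg (Λ : ℝ) (j : Fin 2) (x : Plane) :
    pd j (fun x : Plane => Λ * (x 0 * x 0 + x 1 * x 1)) x = 2 * Λ * x j := by
  have d := fun l => differentiable_coord l x
  rw [pd_const_mul j _ (((d 0).fun_mul (d 0)).fun_add ((d 1).fun_mul (d 1))),
    pd_add j ((d 0).fun_mul (d 0)) ((d 1).fun_mul (d 1)), pd_mul j (d 0) (d 0),
    pd_mul j (d 1) (d 1), pd_coord, pd_coord]
  fin_cases j <;> simp <;> ring

lemma pd_expSq (Λ : ℝ) (j : Fin 2) (x : Plane) :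
    pd j (expSq Λ) x = 2 * Λ * x j * expSq Λ x := by
  have := pd_comp (G := Real.exp) j (Real.hasDerivAt_exp _)
    ((contDiff_expSq_arg Λ (n := 1)).differentiable (by simp) x)
  rw [pd_expSq_arg] at this
  exact this.trans (mul_comm _ _)

lemma lap_expSq (Λ : ℝ) (x : Plane) :
    lap (expSq Λ) x = (4 * Λ ^ 2 * ‖x‖ ^ 2 + 4 * Λ) * expSq Λ x := by
  have := lap_comp (G := Real.exp) (G' := Real.exp) (x := x)
    ((contDiff_expSq_arg Λ).contDiffAt)
    (Filter.Eventually.of_forall fun t => Real.hasDerivAt_exp t) (Real.hasDerivAt_exp _)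
  rw [pd_expSq_arg, pd_expSq_arg] at this
  have hl : lap (fun x : Plane => Λ * (x 0 * x 0 + x 1 * x 1)) x = 4 * Λ := by
    have q : ∀ l : Fin 2, ContDiff ℝ 2 (fun y : Plane => y l * y l) := fun l =>
      (contDiff_coord l).mul (contDiff_coord l)
    rw [lap_const_mul _ ((q 0).add (q 1)).contDiffAt, lap_add (q 0).contDiffAt (q 1).contDiffAt,
      lap_coord_sq, lap_coord_sq]
    ring
  rw [hl] at this
  refine this.trans ?_
  rw [norm_sq_plane]; simp only [expSq]; ring

lemma one_le_expSq {Λ : ℝ} (hΛ : 0 ≤ Λ) (x : Plane) : 1 ≤ expSq Λ x := by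
  rw [expSq_eq]; exact Real.one_le_exp (by positivity)

lemma expSq_gap_le {Λ ρ : ℝ} (hΛ : 0 ≤ Λ) {x : Plane} :
    Real.exp (Λ * ρ ^ 2) - expSq Λ x ≤ Real.exp (Λ * ρ ^ 2) * Λ * (2 * ρ) * (ρ - ‖x‖) := by
  have h1 : expSq Λ x = Real.exp (Λ * ρ ^ 2) * Real.exp (-(Λ * (ρ ^ 2 - ‖x‖ ^ 2))) := by
    rw [expSq_eq, ← Real.exp_add]; ring_nf
  have h2 := Real.add_one_le_exp (-(Λ * (ρ ^ 2 - ‖x‖ ^ 2)))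
  have h3 := Real.exp_pos (Λ * ρ ^ 2)
  have h4 : ρ ^ 2 - ‖x‖ ^ 2 ≤ 2 * ρ * (ρ - ‖x‖) := by nlinarith [sq_nonneg (ρ - ‖x‖)]
  have h5 : 1 - Real.exp (-(Λ * (ρ ^ 2 - ‖x‖ ^ 2))) ≤ Λ * (2 * ρ * (ρ - ‖x‖)) := by
    have := mul_le_mul_of_nonneg_left h4 hΛ
    linarith
  calc _ = Real.exp (Λ * ρ ^ 2) * (1 - Real.exp (-(Λ * (ρ ^ 2 - ‖x‖ ^ 2)))) := by rw [h1]; ring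
    _ ≤ Real.exp (Λ * ρ ^ 2) * (Λ * (2 * ρ * (ρ - ‖x‖))) := by gcongr
    _ = _ := by ring

lemma le_expSq_gap {Λ ρ : ℝ} (hΛ : 0 ≤ Λ) {x : Plane} (hx : ‖x‖ ≤ ρ) :
    Λ * (ρ ^ 2 - ‖x‖ ^ 2) ≤ Real.exp (Λ * ρ ^ 2) - expSq Λ x := by
  have hδ : 0 ≤ Λ * (ρ ^ 2 - ‖x‖ ^ 2) := by
    have : ‖x‖ ^ 2 ≤ ρ ^ 2 := by gcongr
    exact mul_nonneg hΛ (by linarith)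
  have h1 : Real.exp (Λ * ρ ^ 2) = expSq Λ x * Real.exp (Λ * (ρ ^ 2 - ‖x‖ ^ 2)) := by
    rw [expSq_eq, ← Real.exp_add]; ring_nf
  have h2 := Real.add_one_le_exp (Λ * (ρ ^ 2 - ‖x‖ ^ 2))
  have h3 := one_le_expSq hΛ x
  rw [h1]
  nlinarith

/-! ### Decay and gradient bounds at the outer circle -/

/-- The annulus of width `a` inside the circle of radius `ρ`. -/
def annulus (ρ a : ℝ) : Set Plane := {x | ρ - a < ‖x‖ ∧ ‖x‖ < ρ}

lemma isOpen_annulus (ρ a : ℝ) : IsOpen (annulus ρ a) :=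
  (isOpen_lt continuous_const continuous_norm).inter (isOpen_lt continuous_norm continuous_const)

lemma annulus_mono {ρ a b : ℝ} (h : b ≤ a) : annulus ρ b ⊆ annulus ρ a := fun _ hx =>
  ⟨by linarith [hx.1], hx.2⟩

section boundary
variable {ι : Type*} {u φ : ι → Plane → ℝ} {β : Fin 2 → ι → Plane → ℝ} {ρ a b : ℝ}

/-- Each member of the family tends to zero at the circle of radius `ρ`, from inside. No uniformity
in `i` is asked for. -/
def VanishesAtCircle (ρ : ℝ) (u : ι → Plane → ℝ) : Prop :=
  ∀ i, ∀ η > 0, ∃ τ > 0, ∀ x : Plane, ρ - τ < ‖x‖ → ‖x‖ < ρ → |u i x| ≤ η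

lemma UnifBdd.pair {s : ι → Set Plane} (hβ : ∀ j, UnifBdd s (β j)) :
    ∃ B : ℝ, 0 ≤ B ∧ ∀ j i, ∀ x ∈ s i, |β j i x| ≤ B := by
  choose B hB using hβ
  refine ⟨|B 0| + |B 1|, by positivity, fun j i x hx => (hB j i x hx).trans ?_⟩
  fin_cases j
  · exact (le_abs_self _).trans (le_add_of_nonneg_right (abs_nonneg _))
  · exact (le_abs_self _).trans (le_add_of_nonneg_left (abs_nonneg _))

/-- Solutions that vanish on the circle are bounded by the distance to it. -/
lemma boundary_decay (hb : 0 < b) (hab : b < a) (haρ : a < ρ)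
    (hu : ∀ i, ContDiffOn ℝ 2 (u i) (annulus ρ a)) (hub : UnifBdd (fun _ => annulus ρ a) u)
    (hz : VanishesAtCircle ρ u)
    (hβ : ∀ j, UnifBdd (fun _ => annulus ρ a) (β j)) (hφ : UnifBdd (fun _ => annulus ρ a) φ)
    (heq : ∀ i, ∀ x ∈ annulus ρ a,
      lap (u i) x + (β 0 i x * pd 0 (u i) x + β 1 i x * pd 1 (u i) x) = φ i x) :
    ∃ C : ℝ, 0 ≤ C ∧ ∀ i, ∀ x ∈ annulus ρ b, |u i x| ≤ C * (ρ - ‖x‖) := by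
  obtain ⟨S, hS⟩ := hub
  obtain ⟨N, hN⟩ := hφ
  obtain ⟨B, hB0, hB⟩ := UnifBdd.pair hβ
  have hρ : 0 < ρ := by linarith
  set ρ₁ := ρ - a with hρ₁
  have hρ₁0 : 0 < ρ₁ := by rw [hρ₁]; linarith
  set Λ := 1 + B / ρ₁ with hΛ
  have hΛ1 : 1 ≤ Λ := by rw [hΛ]; linarith [div_nonneg hB0 hρ₁0.le]
  have hΛ0 : 0 ≤ Λ := by linarith
  have hΛB : B ≤ Λ * ρ₁ := by rw [hΛ, add_mul, div_mul_cancel₀ _ hρ₁0.ne']; linarith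
  set C₁ := |N| + 1 + |S| / (b * ρ) with hC₁
  have hC₁0 : 0 ≤ C₁ := by positivity
  have hC₁N : |N| + 1 ≤ C₁ := le_add_of_nonneg_right (by positivity)
  -- `exp (Λ |x|²)` is a strict subsolution on the annulus
  have hsub : ∀ i, ∀ x ∈ annulus ρ a, 4 ≤ lap (expSq Λ) x
      + (β 0 i x * pd 0 (expSq Λ) x + β 1 i x * pd 1 (expSq Λ) x) := by
    intro i x hx
    rw [lap_expSq, pd_expSq, pd_expSq]
    have h1 : |β 0 i x * x 0| ≤ B * ‖x‖ := by
      rw [abs_mul]; exact mul_le_mul (hB 0 i x hx) (abs_coord_le x 0) (abs_nonneg _) hB0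
    have h2 : |β 1 i x * x 1| ≤ B * ‖x‖ := by
      rw [abs_mul]; exact mul_le_mul (hB 1 i x hx) (abs_coord_le x 1) (abs_nonneg _) hB0
    have h3 := (abs_le.1 h1).1
    have h4 := (abs_le.1 h2).1
    have hx1 : ρ₁ ≤ ‖x‖ := hx.1.le
    have h5 : B * ‖x‖ ≤ Λ * ‖x‖ * ‖x‖ := by
      have : B ≤ Λ * ‖x‖ := hΛB.trans (by gcongr)
      exact mul_le_mul_of_nonneg_right this (norm_nonneg _)
    have h6 : 4 ≤ 4 * Λ ^ 2 * ‖x‖ ^ 2 + 4 * Λ + 2 * Λ * (β 0 i x * x 0 + β 1 i x * x 1) := by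
      have : 0 ≤ 2 * Λ * (2 * (Λ * ‖x‖ * ‖x‖) + (β 0 i x * x 0 + β 1 i x * x 1)) := by
        apply mul_nonneg (by linarith); linarith
      nlinarith
    have h7 := one_le_expSq hΛ0 x
    calc (4 : ℝ) ≤ (4 * Λ ^ 2 * ‖x‖ ^ 2 + 4 * Λ + 2 * Λ * (β 0 i x * x 0 + β 1 i x * x 1)) * 1 := by
          linarith
      _ ≤ (4 * Λ ^ 2 * ‖x‖ ^ 2 + 4 * Λ + 2 * Λ * (β 0 i x * x 0 + β 1 i x * x 1))
          * expSq Λ x := by gcongr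
      _ = _ := by ring
  have main : ∀ i, ∀ w : Plane → ℝ, ContDiffOn ℝ 2 w (annulus ρ a) →
      (∀ x ∈ annulus ρ a, |w x| ≤ S) →
      (∀ η > 0, ∃ τ > 0, ∀ x : Plane, ρ - τ < ‖x‖ → ‖x‖ < ρ → |w x| ≤ η) →
      (∀ x ∈ annulus ρ a, |lap w x + (β 0 i x * pd 0 w x + β 1 i x * pd 1 w x)| ≤ N) →
      ∀ x ∈ annulus ρ b, w x ≤ C₁ * (Real.exp (Λ * ρ ^ 2) - expSq Λ x) := by
    intro i w hw hwS hwz hwN x hx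
    refine le_of_forall_pos_le_add fun η hη => ?_
    obtain ⟨τ, hτ, hwτ⟩ := hwz η hη
    set τ' := min (τ / 2) (ρ - ‖x‖) with hτ'
    have hτ'0 : 0 < τ' := lt_min (by positivity) (by linarith [hx.2])
    have hτ'τ : τ' < τ := (min_le_left _ _).trans_lt (by linarith)
    set K : Set Plane := {y | ρ - b ≤ ‖y‖ ∧ ‖y‖ ≤ ρ - τ'} with hK
    have hKc : IsCompact K := by
      refine (isCompact_closedBall (0 : Plane) (ρ - τ')).of_isClosed_subset ?_ ?_
      · exact (isClosed_le continuous_const continuous_norm).inter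
          (isClosed_le continuous_norm continuous_const)
      · intro y hy; simpa using hy.2
    have hKa : K ⊆ annulus ρ a := fun y hy => ⟨by linarith [hy.1], by linarith [hy.2]⟩
    set V : Plane → ℝ := fun y => (w y + C₁ * expSq Λ y) - (C₁ * Real.exp (Λ * ρ ^ 2) + η) with hV
    have hwx : ∀ y ∈ annulus ρ a, ContDiffAt ℝ 2 w y := fun y hy =>
      contDiffAt_of_isOpen (isOpen_annulus ρ a) hw hy
    have hce : ∀ y, ContDiffAt ℝ 2 (fun y => C₁ * expSq Λ y) y := fun y =>
      contDiffAt_const.mul (contDiff_expSq Λ).contDiffAt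
    have hde : ∀ y, DifferentiableAt ℝ (expSq Λ) y := fun y =>
      (contDiff_expSq Λ (n := 1)).differentiable (by simp) y
    have hVC : ∀ y ∈ annulus ρ a, ContDiffAt ℝ 2 V y := fun y hy =>
      ((hwx y hy).add (hce y)).sub contDiffAt_const
    have hle := nonpos_of_maximum_principle hKc (V := V)
      (fun y hy => (hVC y (hKa hy)).continuousAt.continuousWithinAt) (by
        intro y hy hpos
        have hya := hKa hy
        have hgap : 0 ≤ C₁ * (Real.exp (Λ * ρ ^ 2) - expSq Λ y) := by
          refine mul_nonneg hC₁0 (le_trans ?_ (le_expSq_gap hΛ0 hya.2.le))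
          have : ‖y‖ ^ 2 ≤ ρ ^ 2 := by gcongr; exact hya.2.le
          exact mul_nonneg hΛ0 (by linarith)
        have hpos' : C₁ * (Real.exp (Λ * ρ ^ 2) - expSq Λ y) + η < w y := by
          simp only [hV] at hpos; linarith
        have h1 : ρ - b < ‖y‖ := by
          rcases hy.1.lt_or_eq with h | h
          · exact h
          · exfalso
            have h2 := le_expSq_gap hΛ0 hya.2.le
            have h3 : b * ρ ≤ ρ ^ 2 - ‖y‖ ^ 2 := by rw [← h]; nlinarith
            have h4 : b * ρ ≤ Real.exp (Λ * ρ ^ 2) - expSq Λ y := by nlinarith [mul_pos hb hρ]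
            have h5 : |S| ≤ C₁ * (Real.exp (Λ * ρ ^ 2) - expSq Λ y) := by
              calc |S| = |S| / (b * ρ) * (b * ρ) := by field_simp
                _ ≤ C₁ * (Real.exp (Λ * ρ ^ 2) - expSq Λ y) := by
                  gcongr
                  rw [hC₁]; linarith [abs_nonneg N]
            linarith [le_abs_self (w y), hwS y hya, le_abs_self S]
        have h2 : ‖y‖ < ρ - τ' := by
          rcases hy.2.lt_or_eq with h | h
          · exact h
          · exfalso
            linarith [hwτ y (by linarith) hya.2, le_abs_self (w y)]
        refine ⟨?_, hVC y hya, fun p0 p1 => ?_⟩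
        · refine Filter.mem_of_superset (IsOpen.mem_nhds ((isOpen_lt continuous_const
            continuous_norm).inter (isOpen_lt continuous_norm continuous_const)) ⟨h1, h2⟩) ?_
          exact fun z hz => ⟨le_of_lt hz.1, le_of_lt hz.2⟩
        · have hdw := (hwx y hya).differentiableAt (by simp)
          have hpd : ∀ j, pd j V y = pd j w y + C₁ * pd j (expSq Λ) y := by
            intro j
            rw [hV, pd_sub j (hdw.fun_add ((hde y).const_mul _)) (differentiableAt_const _),
              pd_add j hdw ((hde y).const_mul _), pd_const_mul j _ (hde y), pd_const, sub_zero]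
          have hl : lap V y = lap w y + C₁ * lap (expSq Λ) y := by
            rw [hV, lap_sub ((hwx y hya).add (hce y)) contDiffAt_const,
              lap_add (hwx y hya) (hce y), lap_const_mul _ (contDiff_expSq Λ).contDiffAt,
              lap_const, sub_zero]
          rw [hpd] at p0 p1
          have e0 : pd 0 w y = - (C₁ * pd 0 (expSq Λ) y) := by linarith
          have e1 : pd 1 w y = - (C₁ * pd 1 (expSq Λ) y) := by linarith
          have hwN' := (abs_le.1 (hwN y hya)).1
          rw [e0, e1] at hwN'
          have h4 := mul_le_mul_of_nonneg_left (hsub i y hya) hC₁0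
          rw [hl]
          linarith [le_abs_self N, abs_nonneg N])
    have := hle x ⟨hx.1.le, by linarith [min_le_right (τ / 2) (ρ - ‖x‖)]⟩
    simp only [hV] at this
    linarith
  refine ⟨C₁ * (Real.exp (Λ * ρ ^ 2) * Λ * (2 * ρ)), by positivity, fun i x hx => ?_⟩
  have hE := mul_le_mul_of_nonneg_left (expSq_gap_le (ρ := ρ) (x := x) hΛ0) hC₁0
  rw [← mul_assoc] at hE
  rw [abs_le']
  constructor
  · exact (main i (u i) (hu i) (hS i) (hz i) (fun y hy => by rw [heq i y hy]; exact hN i y hy)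
      x hx).trans hE
  · refine (main i (fun y => - u i y) (hu i).neg (fun y hy => by rw [abs_neg]; exact hS i y hy)
      (fun η hη => ?_) (fun y hy => ?_) x hx).trans hE
    · obtain ⟨τ, h1, h2⟩ := hz i η hη
      exact ⟨τ, h1, fun y h3 h4 => by rw [abs_neg]; exact h2 y h3 h4⟩
    · have : lap (fun y => - u i y) y + (β 0 i y * pd 0 (fun y => - u i y) y
          + β 1 i y * pd 1 (fun y => - u i y) y) = - φ i y := by
        rw [lap_neg, pd_neg_fun, pd_neg_fun, ← heq i y hy]; ring
      rw [this, abs_neg]; exact hN i y hy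

/-- Gradient bound up to the circle: the interior estimate on discs of radius comparable to the
distance to the circle, where the solution is bounded by that distance. -/
lemma boundary_gradient (hb : 0 < b) (hab : b < a) (haρ : a < ρ)
    (hu : ∀ i, ContDiffOn ℝ 2 (u i) (annulus ρ a)) (hub : UnifBdd (fun _ => annulus ρ a) u)
    (hz : VanishesAtCircle ρ u)
    (hβ : ∀ j, UnifBdd (fun _ => annulus ρ a) (β j)) (hφ : UnifBdd (fun _ => annulus ρ a) φ)
    (heq : ∀ i, ∀ x ∈ annulus ρ a,
      lap (u i) x + (β 0 i x * pd 0 (u i) x + β 1 i x * pd 1 (u i) x) = φ i x) :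
    BddDeriv (fun _ => 1) (fun _ : ι => annulus ρ b) 1 u := by
  have hsub := annulus_mono (ρ := ρ) hab.le
  refine ⟨hub.mono fun _ => hsub, fun i => ((hu i).differentiableOn (by simp)).mono hsub,
    fun j => ?_⟩
  set a' := (a + b) / 2 with ha'
  have h1 : a' < a := by rw [ha']; linarith
  have h2 : b < a' := by rw [ha']; linarith
  obtain ⟨C, hC0, hC⟩ := boundary_decay (hb.trans h2) h1 haρ hu hub hz hβ hφ heq
  obtain ⟨N, hN⟩ := hφ
  obtain ⟨B, hB0, hB⟩ := UnifBdd.pair hβ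
  have hρ : 0 < ρ := by linarith
  set θ := min (1 / 2) ((a' - b) / ρ) with hθ
  have hθ0 : 0 < θ := lt_min (by norm_num) (div_pos (by linarith) hρ)
  have hθ1 : θ ≤ 1 / 2 := min_le_left _ _
  have hθ2 : θ * ρ ≤ a' - b := by
    rw [← le_div_iff₀ hρ]; exact min_le_right _ _
  refine ⟨64 * (B * ρ + 1) * (2 * C / θ + ρ * |N|), fun i x hx => ?_⟩
  set δ := ρ - ‖x‖ with hδ
  have hδ0 : 0 < δ := by rw [hδ]; linarith [hx.2]
  have hδρ : δ ≤ ρ := by rw [hδ]; linarith [norm_nonneg x]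
  have hd : 0 < θ * δ := by positivity
  have hdρ : θ * δ ≤ ρ := by nlinarith
  have hball : Metric.ball x (θ * δ) ⊆ annulus ρ a' := by
    intro y hy
    rw [Metric.mem_ball, dist_eq_norm] at hy
    have h3 := norm_sub_norm_le x y
    rw [norm_sub_rev] at h3
    have h4 := norm_sub_norm_le y x
    have h5 : θ * δ ≤ θ * ρ := by gcongr
    have h6 : θ * δ ≤ 1 / 2 * δ := by gcongr
    exact ⟨by linarith [hx.1], by linarith⟩
  have hballa := hball.trans (annulus_mono h1.le)
  have key := abs_pd_le_of_drift_bound (u := u i) (x₀ := x) (β := fun j => β j i) (d := θ * δ)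
    (S := 2 * C * δ) (N := |N|) (B := B * ρ) hd (by positivity) ((hu i).mono hballa)
    (fun y hy => by
      refine (hC i y (hball hy)).trans ?_
      rw [Metric.mem_ball, dist_eq_norm] at hy
      have h3 := norm_sub_norm_le x y
      rw [norm_sub_rev] at h3
      have h6 : θ * δ ≤ 1 / 2 * δ := by gcongr
      have : ρ - ‖y‖ ≤ 2 * δ := by linarith
      calc C * (ρ - ‖y‖) ≤ C * (2 * δ) := by gcongr
        _ = _ := by ring)
    (fun l y hy => by
      refine (hB l i y (hballa hy)).trans ?_
      rw [le_div_iff₀ hd]; gcongr)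
    (fun y hy => by
      rw [heq i y (hballa hy)]; exact (hN i y (hballa hy)).trans (le_abs_self _)) j
  beta_reduce
  rw [one_mul]
  refine key.trans ?_
  have e : 2 * C * δ / (θ * δ) = 2 * C / θ := by field_simp
  rw [e]
  gcongr

end boundary

/-! ### Rotations -/

/-- The rotation by the angle `t`. -/
noncomputable def rot (t : ℝ) : Plane →L[ℝ] Plane :=
  Real.cos t • ContinuousLinearMap.id ℝ Plane
    + Real.sin t • ((EuclideanSpace.proj 0 : Plane →L[ℝ] ℝ).smulRight (basisVec 1)
      - (EuclideanSpace.proj 1 : Plane →L[ℝ] ℝ).smulRight (basisVec 0))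

lemma rot_apply_zero (t : ℝ) (x : Plane) : rot t x 0 = Real.cos t * x 0 - Real.sin t * x 1 := by
  simp [rot, basisVec]; ring

lemma rot_apply_one (t : ℝ) (x : Plane) : rot t x 1 = Real.sin t * x 0 + Real.cos t * x 1 := by
  simp [rot, basisVec]; ring

lemma norm_rot (t : ℝ) (x : Plane) : ‖rot t x‖ = ‖x‖ := by
  have : ‖rot t x‖ ^ 2 = ‖x‖ ^ 2 := by
    rw [norm_sq_plane, norm_sq_plane, rot_apply_zero, rot_apply_one]
    linear_combination (x 0 ^ 2 + x 1 ^ 2) * Real.sin_sq_add_cos_sq t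
  exact (sq_eq_sq₀ (norm_nonneg _) (norm_nonneg _)).1 this

lemma rot_zero (x : Plane) : rot 0 x = x := by simp [rot]

/-- The angular derivative `x₀ ∂₁ - x₁ ∂₀`. -/
noncomputable def rotDeriv (f : Plane → ℝ) (x : Plane) : ℝ := x 0 * pd 1 f x - x 1 * pd 0 f x

lemma hasDerivAt_rot {f : Plane → ℝ} {x : Plane} {t : ℝ} (hf : DifferentiableAt ℝ f (rot t x)) :
    HasDerivAt (fun τ => f (rot τ x)) (rotDeriv f (rot t x)) t := by
  set J : Plane →L[ℝ] Plane := (EuclideanSpace.proj 0 : Plane →L[ℝ] ℝ).smulRight (basisVec 1)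
      - (EuclideanSpace.proj 1 : Plane →L[ℝ] ℝ).smulRight (basisVec 0) with hJ
  have h1 : HasDerivAt (fun τ => rot τ x) ((-Real.sin t) • x + Real.cos t • J x) t :=
    ((Real.hasDerivAt_cos t).smul_const x).add ((Real.hasDerivAt_sin t).smul_const (J x))
  have h2 := hf.hasFDerivAt.comp_hasDerivAt t h1
  refine h2.congr_deriv ?_
  rw [fderiv_apply_eq_pd, rotDeriv, rot_apply_zero, rot_apply_one]
  simp [hJ, basisVec]
  ring

lemma contDiffOn_rotDeriv {n : ℕ} {s : Set Plane} (hs : IsOpen s) {f : Plane → ℝ}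
    (hf : ContDiffOn ℝ (n + 1 : ℕ) f s) : ContDiffOn ℝ n (rotDeriv f) s :=
  ((contDiff_coord 0).contDiffOn.mul (contDiffOn_pd 1 hs hf)).sub
    ((contDiff_coord 1).contDiffOn.mul (contDiffOn_pd 0 hs hf))

lemma pd_rotDeriv {f : Plane → ℝ} {x : Plane} (hf : ContDiffAt ℝ 2 f x) (j : Fin 2) :
    pd j (rotDeriv f) x = (if j = 0 then pd 1 f x else 0) - (if j = 1 then pd 0 f x else 0)
      + rotDeriv (pd j f) x := by
  have d := fun l => differentiable_coord l x
  have e := fun l => differentiableAt_pd l hf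
  have : pd j (rotDeriv f) x = pd j (fun y => y 0 * pd 1 f y - y 1 * pd 0 f y) x := rfl
  rw [this, pd_sub j ((d 0).fun_mul (e 1)) ((d 1).fun_mul (e 0)), pd_mul j (d 0) (e 1),
    pd_mul j (d 1) (e 0), pd_coord, pd_coord, rotDeriv, pd_comm 1 j hf, pd_comm 0 j hf]
  fin_cases j <;> simp <;> ring

lemma lap_coord_mul {g : Plane → ℝ} {x : Plane} (l : Fin 2) (hg : ContDiffAt ℝ 2 g x) :
    lap (fun y => y l * g y) x = x l * lap g x + 2 * pd l g x := by
  have key : ∀ j, pd j (pd j (fun y => y l * g y)) x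
      = x l * pd j (pd j g) x + if l = j then 2 * pd j g x else 0 := by
    intro j
    have e : pd j (fun y => y l * g y) =ᶠ[nhds x]
        fun y => (if l = j then 1 else 0) * g y + y l * pd j g y := by
      filter_upwards [differentiableAt_near hg] with y hy
      rw [pd_mul j (differentiable_coord l y) hy, pd_coord]
    have dg := hg.differentiableAt (by simp)
    have dp := differentiableAt_pd j hg
    have dl := differentiable_coord l x
    rw [pd_congr j e, pd_add j (dg.const_mul _) (dl.fun_mul dp), pd_const_mul j _ dg,
      pd_mul j dl dp, pd_coord]
    split_ifs <;> ring
  simp only [lap, key]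
  fin_cases l <;> simp <;> ring

/-- The Laplacian commutes with the angular derivative. -/
lemma lap_rotDeriv {f : Plane → ℝ} {s : Set Plane} (hs : IsOpen s) (hf : ContDiffOn ℝ 3 f s)
    {x : Plane} (hx : x ∈ s) : lap (rotDeriv f) x = rotDeriv (lap f) x := by
  have hp : ∀ l, ContDiffAt ℝ 2 (pd l f) x := fun l =>
    contDiffAt_pd (n := 2) l (contDiffAt_of_isOpen hs hf hx)
  have : lap (rotDeriv f) x = lap (fun y => y 0 * pd 1 f y - y 1 * pd 0 f y) x := rfl
  rw [this, lap_sub ((contDiff_coord 0).contDiffAt.mul (hp 1))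
    ((contDiff_coord 1).contDiffAt.mul (hp 0)), lap_coord_mul 0 (hp 1), lap_coord_mul 1 (hp 0),
    rotDeriv, pd_lap 1 hs hf hx, pd_lap 0 hs hf hx,
    pd_comm 0 1 ((contDiffAt_of_isOpen hs hf hx).of_le (by norm_num))]
  ring

lemma rotDeriv_mul {f g : Plane → ℝ} {x : Plane} (hf : DifferentiableAt ℝ f x)
    (hg : DifferentiableAt ℝ g x) :
    rotDeriv (fun y => f y * g y) x = rotDeriv f x * g x + f x * rotDeriv g x := by
  simp only [rotDeriv, pd_mul _ hf hg]; ring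

lemma rotDeriv_add {f g : Plane → ℝ} {x : Plane} (hf : DifferentiableAt ℝ f x)
    (hg : DifferentiableAt ℝ g x) :
    rotDeriv (fun y => f y + g y) x = rotDeriv f x + rotDeriv g x := by
  simp only [rotDeriv, pd_add _ hf hg]; ring

section boundary
variable {ι : Type*} {u φ f : ι → Plane → ℝ} {β : Fin 2 → ι → Plane → ℝ} {ρ a b : ℝ}

lemma bddDeriv_coord {k : ℕ} (l : Fin 2) :
    BddDeriv (fun _ => 1) (fun _ : ι => annulus ρ a) k (fun _ y => y l) := by
  have h0 : UnifBdd (fun _ : ι => annulus ρ a) (fun _ y => y l) :=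
    ⟨ρ, fun _ x hx => (abs_coord_le x l).trans hx.2.le⟩
  cases k with
  | zero => exact h0
  | succ k =>
    refine ⟨h0, fun i => (differentiable_coord l).differentiableOn, fun j => ?_⟩
    simp only [pd_coord]
    exact bddDeriv_const ⟨1, fun i => by split_ifs <;> simp⟩

lemma BddDeriv.pd_one {s : ι → Set Plane} {k : ℕ}
    (h : BddDeriv (fun _ => 1) s (k + 1) f) (j : Fin 2) :
    BddDeriv (fun _ => 1) s k (fun i x => pd j (f i) x) := by
  simpa only [one_mul] using h.2.2 j

lemma BddDeriv.rotDeriv {k : ℕ} (h : BddDeriv (fun _ => 1) (fun _ : ι => annulus ρ a) (k + 1) f) :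
    BddDeriv (fun _ => 1) (fun _ : ι => annulus ρ a) k (fun i x => rotDeriv (f i) x) := by
  have hop : ∀ _ : ι, IsOpen (annulus ρ a) := fun _ => isOpen_annulus ρ a
  exact ((bddDeriv_coord 0).mul hop (h.pd_one 1)).sub hop ((bddDeriv_coord 1).mul hop (h.pd_one 0))

/-- First derivatives of the angular derivative are bounded up to the circle, and the angular
derivative vanishes there, by the estimates for the difference quotients along rotations. -/
lemma boundary_rotDeriv (hb : 0 < b) (hab : b < a) (haρ : a < ρ)
    (hu : ∀ i, ContDiffOn ℝ 2 (u i) (annulus ρ a)) (hub : UnifBdd (fun _ => annulus ρ a) u)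
    (hz : VanishesAtCircle ρ u)
    (hβ : ∀ j, BddDeriv (fun _ => 1) (fun _ => annulus ρ a) 1 (β j))
    (hφ : BddDeriv (fun _ => 1) (fun _ => annulus ρ a) 1 φ)
    (heq : ∀ i, ∀ x ∈ annulus ρ a,
      lap (u i) x + (β 0 i x * pd 0 (u i) x + β 1 i x * pd 1 (u i) x) = φ i x) :
    BddDeriv (fun _ => 1) (fun _ : ι => annulus ρ b) 1 (fun i x => rotDeriv (u i) x) ∧
      VanishesAtCircle ρ (fun i x => rotDeriv (u i) x) := by
  have hρ : 0 < ρ := by linarith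
  set a₁ := (a + b) / 2 with ha₁
  have h1 : a₁ < a := by rw [ha₁]; linarith
  have h2 : b < a₁ := by rw [ha₁]; linarith
  have hsub := annulus_mono (ρ := ρ) h1.le
  have hsb := annulus_mono (ρ := ρ) h2.le
  have g1 := boundary_gradient (hb.trans h2) h1 haρ hu hub hz (fun j => (hβ j).unifBdd)
    hφ.unifBdd heq
  have hc2 : ∀ i, ∀ x ∈ annulus ρ a, ContDiffAt ℝ 2 (u i) x := fun i x hx =>
    contDiffAt_of_isOpen (isOpen_annulus ρ a) (hu i) hx
  have hrot : ∀ (t : ℝ) {x : Plane} {w : ℝ}, x ∈ annulus ρ w → rot t x ∈ annulus ρ w :=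
    fun t x w hx => ⟨by rw [norm_rot]; exact hx.1, by rw [norm_rot]; exact hx.2⟩
  let κ := ι × {t : ℝ // 0 < t}
  let v : κ → Plane → ℝ := fun p y => (p.2.1)⁻¹ * (u p.1 (0 + rot p.2.1 y) - u p.1 y)
  have hcr : ∀ i t, ∀ x ∈ annulus ρ a, ContDiffAt ℝ 2 (fun y => u i (0 + rot t y)) x :=
    fun i t x hx => ContDiffAt.comp x (by rw [zero_add]; exact hc2 i _ (hrot t hx))
      (contDiffAt_const.add (rot t).contDiff.contDiffAt)
  have hvC : ∀ p : κ, ContDiffOn ℝ 2 (v p) (annulus ρ a₁) := fun p x hx =>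
    (contDiffAt_const.mul ((hcr p.1 p.2.1 x (hsub hx)).sub
      (hc2 p.1 x (hsub hx)))).contDiffWithinAt
  have hpdr : ∀ l i t, ∀ x ∈ annulus ρ a, pd l (fun y => u i (0 + rot t y)) x
      = rot t (basisVec l) 0 * pd 0 (u i) (rot t x) + rot t (basisVec l) 1 * pd 1 (u i) (rot t x) :=
    fun l i t x hx => by
      have := pd_comp_affine (f := u i) l (rot t) 0 (x := x)
        (by rw [zero_add]; exact (hc2 i _ (hrot t hx)).differentiableAt (by simp))
      rwa [zero_add] at this
  have r00 : ∀ t, rot t (basisVec 0) 0 = Real.cos t := fun t => by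
    simp [rot_apply_zero, basisVec]
  have r01 : ∀ t, rot t (basisVec 0) 1 = Real.sin t := fun t => by
    simp [rot_apply_one, basisVec]
  have r10 : ∀ t, rot t (basisVec 1) 0 = -Real.sin t := fun t => by
    simp [rot_apply_zero, basisVec]
  have r11 : ∀ t, rot t (basisVec 1) 1 = Real.cos t := fun t => by
    simp [rot_apply_one, basisVec]
  have hdiff : ∀ {g : ι → Plane → ℝ} {w : ℝ}, BddDeriv (fun _ => 1) (fun _ => annulus ρ w) 1 g →
      ∀ i t, ∀ x ∈ annulus ρ w, HasDerivAt (fun τ => g i (rot τ x)) (rotDeriv (g i) (rot t x)) t :=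
    fun hg i t x hx => hasDerivAt_rot
      ((hg.2.1 i).differentiableAt ((isOpen_annulus ρ _).mem_nhds (hrot t hx)))
  have hquot : ∀ {g : ι → Plane → ℝ}, BddDeriv (fun _ => 1) (fun _ => annulus ρ a₁) 1 g →
      UnifBdd (fun _ : κ => annulus ρ a₁)
        (fun p y => (g p.1 (rot p.2.1 y) - g p.1 y) / p.2.1) := by
    intro g hg
    obtain ⟨K, hK⟩ := hg.rotDeriv.unifBdd
    refine ⟨K, fun p x hx => ?_⟩
    have := abs_diffQuot_le p.2.2 (fun t _ => hdiff hg p.1 t x hx)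
      (fun t _ => hK p.1 _ (hrot t hx))
    simpa only [rot_zero] using this
  have hvb : UnifBdd (fun _ : κ => annulus ρ a₁) v := (hquot g1).congr fun p x _ => by
    simp only [v]; rw [zero_add, div_eq_mul_inv, mul_comm]
  have hvz : VanishesAtCircle ρ v := by
    intro p η hη
    obtain ⟨τ, hτ, h⟩ := hz p.1 (η * p.2.1 / 2) (by have := p.2.2; positivity)
    refine ⟨τ, hτ, fun x hx1 hx2 => ?_⟩
    have e1 := h x hx1 hx2
    have e2 := h (rot p.2.1 x) (by rwa [norm_rot]) (by rwa [norm_rot])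
    simp only [v]
    rw [zero_add, abs_mul, abs_inv, abs_of_pos p.2.2, inv_mul_le_iff₀ p.2.2]
    exact (abs_sub _ _).trans (by linarith)
  have hcos := fun t => Real.abs_cos_le_one t
  have hsin := fun t => Real.abs_sin_le_one t
  have hlin : ∀ {c d A B P Q : ℝ}, |c| ≤ 1 → |d| ≤ 1 → |A| ≤ P → |B| ≤ Q →
      |c * A + d * B| ≤ P + Q := by
    intro c d A B P Q hc hd hA hB
    refine (abs_add_le _ _).trans (add_le_add ?_ ?_)
    · rw [abs_mul]; exact (mul_le_of_le_one_left (abs_nonneg _) hc).trans hA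
    · rw [abs_mul]; exact (mul_le_of_le_one_left (abs_nonneg _) hd).trans hB
  -- the transported vector field has bounded difference quotients
  have hβq : ∀ l, UnifBdd (fun _ : κ => annulus ρ a₁) (fun p x =>
      (rot p.2.1 (basisVec l) 0 * β 0 p.1 (rot p.2.1 x)
        + rot p.2.1 (basisVec l) 1 * β 1 p.1 (rot p.2.1 x) - β l p.1 x) / p.2.1) := by
    intro l
    have hβ1 := fun j => (hβ j).mono fun _ => hsub
    obtain ⟨K, _, hK⟩ := UnifBdd.pair fun j => (hβ1 j).unifBdd
    obtain ⟨L, _, hL⟩ := UnifBdd.pair fun j => (hβ1 j).rotDeriv.unifBdd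
    refine ⟨(K + L) + (K + L), fun p x hx => ?_⟩
    fin_cases l
    · have := abs_diffQuot_le (K := (K + L) + (K + L)) p.2.2
        (fun t _ => ((Real.hasDerivAt_cos t).mul (hdiff (hβ1 0) p.1 t x hx)).add
          ((Real.hasDerivAt_sin t).mul (hdiff (hβ1 1) p.1 t x hx)))
        (fun t _ => by
          have b0 := hK 0 p.1 _ (hrot t hx)
          have b1 := hK 1 p.1 _ (hrot t hx)
          have c0 := hL 0 p.1 _ (hrot t hx)
          have c1 := hL 1 p.1 _ (hrot t hx)
          exact (abs_add_le _ _).trans (add_le_add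
            (hlin (by rw [abs_neg]; exact hsin t) (hcos t) b0 c0) (hlin (hcos t) (hsin t) b1 c1)))
      simpa [r00, r01, rot_zero] using this
    · have := abs_diffQuot_le (K := (K + L) + (K + L)) p.2.2
        (fun t _ => ((Real.hasDerivAt_sin t).neg.mul (hdiff (hβ1 0) p.1 t x hx)).add
          ((Real.hasDerivAt_cos t).mul (hdiff (hβ1 1) p.1 t x hx)))
        (fun t _ => by
          have b0 := hK 0 p.1 _ (hrot t hx)
          have b1 := hK 1 p.1 _ (hrot t hx)
          have c0 := hL 0 p.1 _ (hrot t hx)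
          have c1 := hL 1 p.1 _ (hrot t hx)
          exact (abs_add_le _ _).trans (add_le_add
            (hlin (by rw [abs_neg]; exact hcos t)
              (by rw [Pi.neg_apply, abs_neg]; exact hsin t) b0 c0)
            (hlin (by rw [abs_neg]; exact hsin t) (hcos t) b1 c1)))
      simpa [r10, r11, rot_zero] using this
  have hpdb : ∀ l, UnifBdd (fun _ : κ => annulus ρ a₁)
      (fun p x => 1 * pd l (fun y => u p.1 (0 + rot p.2.1 y)) x) := by
    intro l
    obtain ⟨K, _, hK⟩ := UnifBdd.pair fun j => (g1.pd_one j).unifBdd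
    refine ⟨K + K, fun p x hx => ?_⟩
    beta_reduce
    rw [one_mul, hpdr l _ _ x (hsub hx)]
    refine hlin ?_ ?_ (hK 0 p.1 _ (hrot _ hx)) (hK 1 p.1 _ (hrot _ hx))
    · refine (abs_coord_le _ _).trans ?_; rw [norm_rot, norm_basisVec]
    · refine (abs_coord_le _ _).trans ?_; rw [norm_rot, norm_basisVec]
  have hφv : UnifBdd (fun _ : κ => annulus ρ a₁) (fun p x => lap (v p) x
      + (β 0 p.1 x * pd 0 (v p) x + β 1 p.1 x * pd 1 (v p) x)) := by
    obtain ⟨K, hK⟩ := hquot (hφ.mono fun _ => hsub)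
    obtain ⟨K', hK'⟩ := ((hβq 0).mul (hpdb 0)).add ((hβq 1).mul (hpdb 1))
    refine ⟨K + K', fun p x hx => ?_⟩
    have hx' := hsub hx
    have := diffQuot_equation (u := u p.1) (φ := φ p.1) (β := fun l => β l p.1)
      (rot p.2.1) 0 (x := x) 1 p.2.1 (by rw [r00, r10]; linarith [Real.sin_sq_add_cos_sq p.2.1])
      (by rw [r01, r11]; linarith [Real.sin_sq_add_cos_sq p.2.1])
      (by rw [r00, r01, r10, r11]; ring) (hc2 _ _ hx')
      (by rw [zero_add]; exact hc2 _ _ (hrot _ hx'))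
      (by rw [← heq p.1 x hx']; ring)
      (by rw [zero_add, ← heq p.1 _ (hrot p.2.1 hx')]; ring)
    simp only [zero_add] at this
    simp only [v, zero_add]
    have e : ∀ A B C : ℝ, A + (β 0 p.1 x * B + β 1 p.1 x * C)
        = 1 ^ 2 * A + (β 0 p.1 x * (1 * B) + β 1 p.1 x * (1 * C)) := fun A B C => by ring
    rw [e, this]
    have hK'' := hK' p x hx
    simp only [zero_add] at hK''
    exact (abs_sub _ _).trans (add_le_add (hK p x hx) hK'')
  have hβκ : ∀ j, UnifBdd (fun _ : κ => annulus ρ a₁) (fun p => β j p.1) := fun j =>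
    let ⟨K, hK⟩ := (hβ j).unifBdd
    ⟨K, fun p x hx => hK p.1 x (hsub hx)⟩
  obtain ⟨C, hC0, hC⟩ := boundary_decay (u := v) (β := fun j p => β j p.1) hb h2 (h1.trans haρ)
    hvC hvb hvz hβκ hφv (fun p x _ => rfl)
  have gv := boundary_gradient (u := v) (β := fun j p => β j p.1) hb h2 (h1.trans haρ)
    hvC hvb hvz hβκ hφv (fun p x _ => rfl)
  have hTdecay : ∀ i, ∀ x ∈ annulus ρ b, |rotDeriv (u i) x| ≤ C * (ρ - ‖x‖) := by
    intro i x hx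
    have hd := hdiff g1 i 0 x (hsb hx)
    rw [rot_zero] at hd
    refine abs_le_of_slope_le hd zero_lt_one fun t ht0 _ => ?_
    have := hC (i, ⟨t, ht0⟩) x hx
    simp only [v, zero_add] at this
    rw [rot_zero, div_eq_mul_inv, mul_comm]
    exact this
  refine ⟨⟨⟨C * ρ, fun i x hx => (hTdecay i x hx).trans ?_⟩, fun i => ?_, fun l => ?_⟩, ?_⟩
  · gcongr; linarith [norm_nonneg x]
  · exact ((contDiffOn_rotDeriv (n := 1) (isOpen_annulus ρ a) (hu i)).differentiableOn
      (by simp)).mono (hsb.trans hsub)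
  · obtain ⟨K, hK⟩ := (gv.pd_one l).unifBdd
    refine ⟨K, fun i x hx => ?_⟩
    have hxa := hsub (hsb hx)
    have hd : ∀ j, HasDerivAt (fun τ => pd j (u i) (rot τ x)) (rotDeriv (pd j (u i)) x) 0 := by
      intro j
      have := hasDerivAt_rot (f := pd j (u i)) (x := x) (t := 0)
        (by rw [rot_zero]; exact differentiableAt_pd j (hc2 i x hxa))
      rwa [rot_zero] at this
    have hder : HasDerivAt (fun t => rot t (basisVec l) 0 * pd 0 (u i) (rot t x)
        + rot t (basisVec l) 1 * pd 1 (u i) (rot t x)) (pd l (rotDeriv (u i)) x) 0 := by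
      rw [pd_rotDeriv (hc2 i x hxa)]
      fin_cases l
      · have := ((Real.hasDerivAt_cos 0).mul (hd 0)).add ((Real.hasDerivAt_sin 0).mul (hd 1))
        simp only [Fin.zero_eta, r00, r01]
        refine this.congr_deriv ?_
        simp [rot_zero]; ring
      · have := ((Real.hasDerivAt_sin 0).neg.mul (hd 0)).add ((Real.hasDerivAt_cos 0).mul (hd 1))
        simp only [Fin.mk_one, r10, r11]
        refine this.congr_deriv ?_
        simp [rot_zero]
    beta_reduce
    rw [one_mul]
    refine abs_le_of_slope_le hder zero_lt_one fun t ht0 _ => ?_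
    have h3 := hK (i, ⟨t, ht0⟩) x hx
    have d1 := (hcr i t x hxa).differentiableAt (by simp)
    have d2 := (hc2 i x hxa).differentiableAt (by simp)
    have e0 : rot 0 (basisVec l) 0 * pd 0 (u i) (rot 0 x)
        + rot 0 (basisVec l) 1 * pd 1 (u i) (rot 0 x) = pd l (u i) x := by
      rw [rot_zero, rot_zero]
      fin_cases l <;> simp [basisVec]
    simp only [v] at h3
    rw [pd_const_mul l _ (d1.fun_sub d2), pd_sub l d1 d2, hpdr l i t x hxa] at h3
    rw [e0, div_eq_mul_inv, mul_comm]
    exact h3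
  · intro i η hη
    refine ⟨min b (η / (C + 1)), lt_min hb (by positivity), fun x hx1 hx2 => ?_⟩
    have h3 : ρ - ‖x‖ ≤ η / (C + 1) := by linarith [min_le_right b (η / (C + 1))]
    refine (hTdecay i x ⟨by linarith [min_le_left b (η / (C + 1))], hx2⟩).trans ?_
    calc C * (ρ - ‖x‖) ≤ (C + 1) * (η / (C + 1)) := by
          gcongr
          · linarith
      _ = η := by field_simp

/-- Away from the origin the second derivatives are determined by the Laplacian and by the first
derivatives of the angular derivative. -/
lemma BddDeriv.of_rotDeriv_of_lap {k : ℕ} (hbρ : b < ρ)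
    (hu : ∀ i, ContDiffOn ℝ 2 (u i) (annulus ρ b))
    (h1 : BddDeriv (fun _ => 1) (fun _ : ι => annulus ρ b) (k + 1) u)
    (h2 : BddDeriv (fun _ => 1) (fun _ : ι => annulus ρ b) (k + 1)
      (fun i x => _root_.rotDeriv (u i) x))
    (h3 : BddDeriv (fun _ => 1) (fun _ : ι => annulus ρ b) k (fun i x => lap (u i) x)) :
    BddDeriv (fun _ => 1) (fun _ : ι => annulus ρ b) (k + 2) u := by
  have hop : ∀ _ : ι, IsOpen (annulus ρ b) := fun _ => isOpen_annulus ρ b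
  have hC : ∀ i, ∀ x ∈ annulus ρ b, ContDiffAt ℝ 2 (u i) x := fun i x hx =>
    contDiffAt_of_isOpen (hop i) (hu i) hx
  have c0 := bddDeriv_coord (ι := ι) (ρ := ρ) (a := b) (k := k) 0
  have c1 := bddDeriv_coord (ι := ι) (ρ := ρ) (a := b) (k := k) 1
  have hn : ∀ x ∈ annulus ρ b, (ρ - b) ^ 2 ≤ x 0 * x 0 + x 1 * x 1 := by
    intro x hx
    have h4 : (ρ - b) ^ 2 ≤ ‖x‖ ^ 2 := by
      have := hx.1
      gcongr
    rw [norm_sq_plane] at h4; linarith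
  have hpos : 0 < (ρ - b) ^ 2 := by have : 0 < ρ - b := by linarith
                                    positivity
  have hinv := ((c0.mul hop c0).add hop (c1.mul hop c1)).inv hop hpos (fun _ x hx => hn x hx)
  -- `x₀ ∂₀∂₁ u - x₁ ∂₀∂₀ u` and `x₀ ∂₁∂₁ u - x₁ ∂₀∂₁ u`
  have hp := (h2.pd_one 0).sub hop (h1.pd_one 1)
  have hq := (h2.pd_one 1).add hop (h1.pd_one 0)
  have hq' := hq.sub hop (c0.mul hop h3)
  have hA : BddDeriv (fun _ => 1) (fun _ : ι => annulus ρ b) k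
      (fun i x => pd 0 (pd 0 (u i)) x) := by
    refine (hinv.mul hop (((c1.mul hop hp).add hop (c0.mul hop hq')).const_mul hop (-1))).congr hop
      fun i x hx => ?_
    have hne := (hpos.trans_le (hn x hx)).ne'
    beta_reduce
    rw [eq_inv_mul_iff_mul_eq₀ hne, pd_rotDeriv (hC i x hx), pd_rotDeriv (hC i x hx),
      _root_.rotDeriv, _root_.rotDeriv, lap, pd_comm 0 1 (hC i x hx)]
    simp; ring
  have hB : BddDeriv (fun _ => 1) (fun _ : ι => annulus ρ b) k
      (fun i x => pd 0 (pd 1 (u i)) x) := by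
    refine (hinv.mul hop ((c0.mul hop hp).sub hop (c1.mul hop hq'))).congr hop
      fun i x hx => ?_
    have hne := (hpos.trans_le (hn x hx)).ne'
    beta_reduce
    rw [eq_inv_mul_iff_mul_eq₀ hne, pd_rotDeriv (hC i x hx), pd_rotDeriv (hC i x hx),
      _root_.rotDeriv, _root_.rotDeriv, lap, pd_comm 0 1 (hC i x hx)]
    simp; ring
  have hD : BddDeriv (fun _ => 1) (fun _ : ι => annulus ρ b) k (fun i x => pd 1 (pd 1 (u i)) x) :=
    (h3.sub hop hA).congr hop fun i x _ => by simp only [lap]; ring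
  refine ⟨h1.1, h1.2.1, fun j => ?_⟩
  simp only [one_mul]
  refine ⟨(h1.pd_one j).unifBdd, fun i x hx =>
    (differentiableAt_pd j (hC i x hx)).differentiableWithinAt, fun l => ?_⟩
  simp only [one_mul]
  fin_cases j <;> fin_cases l
  · exact hA
  · exact hB.congr hop fun i x hx => pd_comm 0 1 (hC i x hx)
  · exact hB
  · exact hD

/-- Estimates of all orders up to the circle for `Δu + β · ∇u = φ` with zero boundary values. -/
theorem boundary_estimate (k : ℕ) (hb : 0 < b) (hab : b < a) (haρ : a < ρ)
    (hu : ∀ i, ContDiffOn ℝ (k + 2 : ℕ) (u i) (annulus ρ a))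
    (hub : UnifBdd (fun _ => annulus ρ a) u) (hz : VanishesAtCircle ρ u)
    (hβ : ∀ j, BddDeriv (fun _ => 1) (fun _ => annulus ρ a) (k + 1) (β j))
    (hφ : BddDeriv (fun _ => 1) (fun _ => annulus ρ a) (k + 1) φ)
    (heq : ∀ i, ∀ x ∈ annulus ρ a,
      lap (u i) x + (β 0 i x * pd 0 (u i) x + β 1 i x * pd 1 (u i) x) = φ i x) :
    BddDeriv (fun _ => 1) (fun _ : ι => annulus ρ b) (k + 2) u := by
  induction k generalizing u φ a b with
  | zero =>
    have hu2 : ∀ i, ContDiffOn ℝ 2 (u i) (annulus ρ a) := hu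
    have hsub := annulus_mono (ρ := ρ) hab.le
    have hop : ∀ _ : ι, IsOpen (annulus ρ b) := fun _ => isOpen_annulus ρ b
    have g1 := boundary_gradient hb hab haρ hu2 hub hz (fun j => (hβ j).unifBdd) hφ.unifBdd heq
    have g2 := (boundary_rotDeriv hb hab haρ hu2 hub hz hβ hφ heq).1
    refine BddDeriv.of_rotDeriv_of_lap (hab.trans haρ) (fun i => (hu2 i).mono hsub) g1 g2 ?_
    have hβ' := fun j => ((hβ j).pred.mono fun _ => hsub)
    exact ((hφ.pred.mono fun _ => hsub).sub hop (((hβ' 0).mul hop (g1.pd_one 0)).add hop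
      ((hβ' 1).mul hop (g1.pd_one 1)))).congr hop fun i x hx => by
        beta_reduce
        rw [← heq i x (hsub hx)]; ring
  | succ k ih =>
    set a₁ := (a + b) / 2 with ha₁
    have h1 : a₁ < a := by rw [ha₁]; linarith
    have h2 : b < a₁ := by rw [ha₁]; linarith
    have hs1 := annulus_mono (ρ := ρ) h1.le
    have hsb := annulus_mono (ρ := ρ) h2.le
    have hop : ∀ w, ∀ _ : ι, IsOpen (annulus ρ w) := fun w _ => isOpen_annulus ρ w
    have hu2 : ∀ i, ContDiffOn ℝ 2 (u i) (annulus ρ a) := fun i =>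
      (hu i).of_le (by norm_cast; omega)
    have hu3 : ∀ i, ContDiffOn ℝ 3 (u i) (annulus ρ a) := fun i =>
      (hu i).of_le (by norm_cast; omega)
    have g1 := ih (hb.trans h2) h1 haρ (fun i => (hu i).of_le (by norm_cast; omega)) hub hz
      (fun j => (hβ j).pred) hφ.pred heq
    obtain ⟨t1, t2⟩ := boundary_rotDeriv (hb.trans h2) h1 haρ hu2 hub hz
      (fun j => (hβ j).of_le (by omega)) (hφ.of_le (by omega)) heq
    have hβ1 := fun j => ((hβ j).mono fun _ => hs1)
    have hφ1 := hφ.mono fun _ => hs1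
    have gT := ih (u := fun i x => rotDeriv (u i) x)
      (φ := fun i x => rotDeriv (φ i) x - (rotDeriv (β 0 i) x * pd 0 (u i) x
        + rotDeriv (β 1 i) x * pd 1 (u i) x) + (β 0 i x * pd 1 (u i) x - β 1 i x * pd 0 (u i) x))
      hb h2 (h1.trans haρ)
      (fun i => contDiffOn_rotDeriv (isOpen_annulus ρ a₁) ((hu i).mono hs1)) t1.unifBdd t2
      (fun j => (hβ1 j).pred)
      ((hφ1.rotDeriv.sub (hop _) (((hβ1 0).rotDeriv.mul (hop _) (g1.pd_one 0)).add (hop _)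
        ((hβ1 1).rotDeriv.mul (hop _) (g1.pd_one 1)))).add (hop _)
        (((hβ1 0).pred.mul (hop _) (g1.pd_one 1)).sub (hop _)
          ((hβ1 1).pred.mul (hop _) (g1.pd_one 0))))
      (fun i x hx => by
        have hx' := hs1 hx
        have hn : annulus ρ a ∈ nhds x := (isOpen_annulus ρ a).mem_nhds hx'
        have hC2 : ContDiffAt ℝ 2 (u i) x := (hu2 i).contDiffAt hn
        have hCx : ∀ l, ContDiffAt ℝ 2 (pd l (u i)) x := fun l =>
          contDiffAt_pd (n := 2) l ((hu3 i).contDiffAt hn)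
        have hCl : DifferentiableAt ℝ (lap (u i)) x :=
          (differentiableAt_pd 0 (hCx 0)).add (differentiableAt_pd 1 (hCx 1))
        have hdβ : ∀ l, DifferentiableAt ℝ (β l i) x := fun l => ((hβ l).2.1 i).differentiableAt hn
        have hdp : ∀ l, DifferentiableAt ℝ (pd l (u i)) x := fun l => differentiableAt_pd l hC2
        have hT : rotDeriv (fun y => lap (u i) y + (β 0 i y * pd 0 (u i) y
            + β 1 i y * pd 1 (u i) y)) x = rotDeriv (φ i) x := by
          have hE : Set.EqOn (fun y => lap (u i) y + (β 0 i y * pd 0 (u i) y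
            + β 1 i y * pd 1 (u i) y)) (φ i) (annulus ρ a) := fun y hy => heq i y hy
          simp only [rotDeriv]
          rw [pd_congr_on (isOpen_annulus ρ a) 0 hE hx', pd_congr_on (isOpen_annulus ρ a) 1 hE hx']
        have m0 := (hdβ 0).fun_mul (hdp 0)
        have m1 := (hdβ 1).fun_mul (hdp 1)
        rw [rotDeriv_add hCl (m0.fun_add m1), rotDeriv_add m0 m1, rotDeriv_mul (hdβ 0) (hdp 0),
          rotDeriv_mul (hdβ 1) (hdp 1), ← lap_rotDeriv (isOpen_annulus ρ a) (hu3 i) hx'] at hT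
        have e0 := pd_rotDeriv hC2 0
        have e1 := pd_rotDeriv hC2 1
        simp only [if_true, Fin.isValue, zero_ne_one, one_ne_zero, if_false, sub_zero,
          zero_sub] at e0 e1
        have ee : (fun x => rotDeriv (u i) x) = rotDeriv (u i) := rfl
        rw [ee, e0, e1, ← hT]
        ring)
    refine BddDeriv.of_rotDeriv_of_lap (hab.trans haρ)
      (fun i => (hu2 i).mono (hsb.trans hs1)) (g1.mono fun _ => hsb) gT ?_
    have g1b := g1.mono fun _ => hsb
    have hβb := fun j => (((hβ1 j).mono fun _ => hsb).pred)
    exact (((hφ1.mono fun _ => hsb).pred).sub (hop _) (((hβb 0).mul (hop _) (g1b.pd_one 0)).add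
      (hop _) ((hβb 1).mul (hop _) (g1b.pd_one 1)))).congr (hop _) fun i x hx => by
        beta_reduce
        rw [← heq i x (hs1 (hsb hx))]; ring

end boundary

/-! ### Gap profiles -/

section profile
variable {m : ℕ} {α R κ M : ℝ} {h : Plane → ℝ}

lemma isOpen_disc (R : ℝ) : IsOpen (disc R) := Metric.isOpen_ball

lemma mem_disc {x : Plane} : x ∈ disc R ↔ ‖x‖ < 2 * R := by simp [disc]

lemma zero_mem_disc (hR : 0 < R) : (0 : Plane) ∈ disc R := by rw [mem_disc]; simp [hR]

namespace IsGapProfile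

lemma contDiffOn_two (H : IsGapProfile m α R κ M h) (hm : 1 ≤ m) : ContDiffOn ℝ 2 h (disc R) :=
  H.holder.contDiffOn.of_le (by norm_cast; omega)

lemma contDiffAt_two (H : IsGapProfile m α R κ M h) (hm : 1 ≤ m) {x : Plane} (hx : x ∈ disc R) :
    ContDiffAt ℝ 2 h x := contDiffAt_of_isOpen (isOpen_disc R) (H.contDiffOn_two hm) hx

lemma nonneg (H : IsGapProfile m α R κ M h) (hκ : 0 < κ) {x : Plane} (hx : x ∈ disc R) : 0 ≤ h x :=
  le_trans (by positivity) (H.positive x hx)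

lemma le_bound (H : IsGapProfile m α R κ M h) {x : Plane} (hx : x ∈ disc R) : h x ≤ M := by
  have := H.holder.bound 0 (Nat.zero_le _) x hx
  rw [norm_iteratedFDeriv_zero, Real.norm_eq_abs] at this
  exact (le_abs_self _).trans this

lemma bound_nonneg (H : IsGapProfile m α R κ M h) (hR : 0 < R) : 0 ≤ M :=
  (norm_nonneg _).trans (H.holder.bound 0 (Nat.zero_le _) 0 (zero_mem_disc hR))

lemma apply_zero (H : IsGapProfile m α R κ M h) (hα : 0 < α) (hR : 0 < R) : h 0 = 0 := by
  obtain ⟨a, K, _, hK⟩ := H.expansion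
  have := hK 0 (zero_mem_disc hR)
  rw [norm_zero, Real.zero_rpow (by positivity), mul_zero] at this
  have hs : ∑ j ∈ Finset.Icc 1 m, a j * (0 : ℝ) ^ (j + 1) = 0 :=
    Finset.sum_eq_zero fun j _ => by simp
  rw [hs, sub_zero] at this
  exact abs_nonpos_iff.1 this

lemma fderiv_zero (H : IsGapProfile m α R κ M h) (hα : 0 < α) (hR : 0 < R) (hκ : 0 < κ) :
    fderiv ℝ h 0 = 0 := by
  apply IsLocalMin.fderiv_eq_zero
  filter_upwards [(isOpen_disc R).mem_nhds (zero_mem_disc hR)] with x hx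
  rw [H.apply_zero hα hR]; exact H.nonneg hκ hx

lemma norm_fderiv_le (H : IsGapProfile m α R κ M h) (hm : 1 ≤ m) (hα : 0 < α) (hR : 0 < R)
    (hκ : 0 < κ) {x : Plane} (hx : x ∈ disc R) : ‖fderiv ℝ h x‖ ≤ M * ‖x‖ := by
  have hd : ∀ y ∈ disc R, DifferentiableAt ℝ (fderiv ℝ h) y := fun y hy =>
    ((H.contDiffAt_two hm hy).fderiv_right (m := 1) (by norm_num)).differentiableAt (by simp)
  have hb : ∀ y ∈ disc R, ‖fderiv ℝ (fderiv ℝ h) y‖ ≤ M := by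
    intro y hy
    have := H.holder.bound 2 (by omega) y hy
    rwa [← norm_iteratedFDeriv_fderiv, ← norm_iteratedFDeriv_fderiv,
      norm_iteratedFDeriv_zero] at this
  have := (convex_ball (0 : Plane) (2 * R)).norm_image_sub_le_of_norm_fderiv_le hd hb
    (zero_mem_disc hR) hx
  rwa [H.fderiv_zero hα hR hκ, sub_zero, sub_zero] at this

lemma abs_pd_le (H : IsGapProfile m α R κ M h) (hm : 1 ≤ m) (hα : 0 < α) (hR : 0 < R)
    (hκ : 0 < κ) {x : Plane} (hx : x ∈ disc R) (j : Fin 2) : |pd j h x| ≤ M * ‖x‖ :=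
  (_root_.abs_pd_le j h x).trans (H.norm_fderiv_le hm hα hR hκ hx)

lemma abs_pd_pd_le (H : IsGapProfile m α R κ M h) (hm : 1 ≤ m) {x : Plane} (hx : x ∈ disc R)
    (i j : Fin 2) : |pd i (pd j h) x| ≤ M := by
  rw [pd_pd_eq_iteratedFDeriv i j (H.contDiffAt_two hm hx)]
  have := (iteratedFDeriv ℝ 2 h x).le_opNorm ![basisVec i, basisVec j]
  simp only [Fin.prod_univ_two, Matrix.cons_val_zero, Matrix.cons_val_one, norm_basisVec,
    mul_one] at this
  exact this.trans (H.holder.bound 2 (by omega) x hx)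

/-- At the origin, where `h - κ |x|²` has a minimum, the Hessian is at least `2κ`. -/
lemma le_hess_zero (H : IsGapProfile m α R κ M h) (hm : 1 ≤ m) (hα : 0 < α) (hR : 0 < R)
    (v : Plane) : 2 * κ * ‖v‖ ^ 2 ≤ hess h 0 v := by
  have hc := H.contDiffAt_two hm (zero_mem_disc hR)
  set q : Plane → ℝ := fun x => κ * (x 0 * x 0 + x 1 * x 1) with hq
  have hqc : ContDiff ℝ 2 q := contDiff_expSq_arg κ
  have hmax : IsLocalMax (fun x => q x + (-1) * h x) 0 := by
    filter_upwards [(isOpen_disc R).mem_nhds (zero_mem_disc hR)] with x hx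
    have h1 := H.positive x hx
    rw [norm_sq_plane] at h1
    simp only [hq, H.apply_zero hα hR, PiLp.zero_apply]
    linarith
  have hh := hess_nonpos_of_isLocalMax (hqc.contDiffAt.add (contDiffAt_const.mul hc)) hmax v
  have e : ∀ i j, pd i (pd j q) 0 = if j = i then 2 * κ else 0 := by
    intro i j
    have : pd j q = fun x => 2 * κ * x j := funext fun x => pd_expSq_arg κ j x
    rw [this, pd_const_mul i _ (differentiable_coord j 0), pd_coord]
    split_ifs <;> simp
  simp only [hess] at hh ⊢
  simp only [pd_pd_add _ _ hqc.contDiffAt (contDiffAt_const.mul hc), pd_pd_const_mul _ _ _ hc,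
    e] at hh
  rw [norm_sq_plane]
  simp only [if_true, Fin.isValue, zero_ne_one, one_ne_zero, if_false] at hh
  linarith

lemma norm_iteratedFDeriv_two_sub_le (H : IsGapProfile m α R κ M h) (hm : 1 ≤ m) (hR : 0 < R)
    {x : Plane} (hx : x ∈ disc R) :
    ‖iteratedFDeriv ℝ 2 h x - iteratedFDeriv ℝ 2 h 0‖ ≤ max (M * ‖x‖ ^ α) (M * ‖x‖) := by
  rcases hm.eq_or_lt with rfl | hm2
  · refine le_max_of_le_left ?_
    have := H.holder.holder x hx 0 (zero_mem_disc hR)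
    rwa [sub_zero] at this
  · refine le_max_of_le_right ?_
    have hd : ∀ y ∈ disc R, DifferentiableAt ℝ (iteratedFDeriv ℝ 2 h) y := fun y hy =>
      (contDiffAt_of_isOpen (isOpen_disc R) H.holder.contDiffOn hy).differentiableAt_iteratedFDeriv
        (by norm_cast; omega)
    have hb : ∀ y ∈ disc R, ‖fderiv ℝ (iteratedFDeriv ℝ 2 h) y‖ ≤ M := by
      intro y hy
      rw [norm_fderiv_iteratedFDeriv]
      exact H.holder.bound 3 (by omega) y hy
    have := (convex_ball (0 : Plane) (2 * R)).norm_image_sub_le_of_norm_fderiv_le hd hb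
      (zero_mem_disc hR) hx
    rwa [sub_zero] at this

lemma abs_pd_pd_sub_le (H : IsGapProfile m α R κ M h) (hm : 1 ≤ m) (hR : 0 < R)
    {x : Plane} (hx : x ∈ disc R) (i j : Fin 2) :
    |pd i (pd j h) x - pd i (pd j h) 0| ≤ max (M * ‖x‖ ^ α) (M * ‖x‖) := by
  rw [pd_pd_eq_iteratedFDeriv i j (H.contDiffAt_two hm hx),
    pd_pd_eq_iteratedFDeriv i j (H.contDiffAt_two hm (zero_mem_disc hR)),
    ← sub_apply]
  have := (iteratedFDeriv ℝ 2 h x - iteratedFDeriv ℝ 2 h 0).le_opNorm ![basisVec i, basisVec j]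
  simp only [Fin.prod_univ_two, Matrix.cons_val_zero, Matrix.cons_val_one, norm_basisVec,
    mul_one] at this
  exact this.trans (H.norm_iteratedFDeriv_two_sub_le hm hR hx)

/-- Gap profiles are uniformly convex near the origin, on a disc that depends only on the data. -/
lemma exists_hess_ge (m : ℕ) (hm : 1 ≤ m) (hα : 0 < α) (hR : 0 < R) (hκ : 0 < κ) (M : ℝ) :
    ∃ r₀, 0 < r₀ ∧ r₀ ≤ R ∧ ∀ h : Plane → ℝ, IsGapProfile m α R κ M h →
      ∀ x : Plane, ‖x‖ ≤ r₀ → ∀ v, κ * ‖v‖ ^ 2 ≤ hess h x v := by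
  set M' := |M| + 1 with hM'
  have hM'0 : 0 < M' := by positivity
  set c := κ / (2 * M') with hc
  have hc0 : 0 < c := by positivity
  refine ⟨min R (min c (c ^ α⁻¹)), lt_min hR (lt_min hc0 (Real.rpow_pos_of_pos hc0 _)),
    min_le_left _ _, fun h H x hx v => ?_⟩
  have hxR : ‖x‖ ≤ R := hx.trans (min_le_left _ _)
  have hxc : ‖x‖ ≤ c := hx.trans ((min_le_right _ _).trans (min_le_left _ _))
  have hxα : ‖x‖ ^ α ≤ c := by
    have : ‖x‖ ≤ c ^ α⁻¹ := hx.trans ((min_le_right _ _).trans (min_le_right _ _))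
    calc ‖x‖ ^ α ≤ (c ^ α⁻¹) ^ α := Real.rpow_le_rpow (norm_nonneg _) this hα.le
      _ = c := Real.rpow_inv_rpow hc0.le hα.ne'
  have hxd : x ∈ disc R := by rw [mem_disc]; linarith
  have hMM : M ≤ M' := by rw [hM']; linarith [le_abs_self M]
  have hω : max (M * ‖x‖ ^ α) (M * ‖x‖) ≤ κ / 2 := by
    have e : M' * c = κ / 2 := by rw [hc]; field_simp
    have hxα0 : 0 ≤ ‖x‖ ^ α := Real.rpow_nonneg (norm_nonneg _) _
    rw [← e]
    exact max_le (mul_le_mul hMM hxα hxα0 hM'0.le) (mul_le_mul hMM hxc (norm_nonneg _) hM'0.le)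
  have hd : ∀ i j, |pd i (pd j h) x - pd i (pd j h) 0| ≤ κ / 2 := fun i j =>
    (H.abs_pd_pd_sub_le hm hR hxd i j).trans hω
  have h0 := H.le_hess_zero hm hα hR v
  have hp : ∀ i j, -(κ / 2 * (|v i| * |v j|)) ≤
      v i * v j * (pd i (pd j h) x - pd i (pd j h) 0) := by
    intro i j
    have : |v i * v j * (pd i (pd j h) x - pd i (pd j h) 0)| ≤ κ / 2 * (|v i| * |v j|) := by
      rw [abs_mul, abs_mul, mul_comm]
      exact mul_le_mul_of_nonneg_right (hd i j) (by positivity)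
    exact (abs_le.1 this).1
  have h1 := hp 0 0
  have h2 := hp 0 1
  have h3 := hp 1 0
  have h4 := hp 1 1
  have h5 : (|v 0| + |v 1|) ^ 2 ≤ 2 * ‖v‖ ^ 2 := by
    rw [norm_sq_plane, ← sq_abs (v 0), ← sq_abs (v 1)]
    nlinarith [sq_nonneg (|v 0| - |v 1|)]
  have h6 : κ / 2 * (|v 0| + |v 1|) ^ 2 ≤ κ / 2 * (2 * ‖v‖ ^ 2) := by gcongr
  simp only [hess] at h0 ⊢
  nlinarith

lemma lap_ge_of_hess {f : Plane → ℝ} {x : Plane} {c : ℝ}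
    (hf : ∀ v, c * ‖v‖ ^ 2 ≤ hess f x v) : 2 * c ≤ lap f x := by
  have h0 := hf (basisVec 0)
  have h1 := hf (basisVec 1)
  rw [hess_basisVec, norm_basisVec] at h0 h1
  unfold lap; linarith

/-- The radial derivative is nonnegative where the Hessian is. -/
lemma radial_nonneg (H : IsGapProfile m α R κ M h) (hm : 1 ≤ m) (hα : 0 < α) (hR : 0 < R)
    (hκ : 0 < κ) {r₀ : ℝ} (hr : r₀ ≤ R)
    (hh : ∀ x : Plane, ‖x‖ ≤ r₀ → ∀ v, κ * ‖v‖ ^ 2 ≤ hess h x v) {x : Plane} (hx : ‖x‖ ≤ r₀) :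
    0 ≤ x 0 * pd 0 h x + x 1 * pd 1 h x := by
  have hxn : ∀ t ∈ Set.Icc (0 : ℝ) 1, ‖(0 : Plane) + t • x‖ ≤ r₀ := by
    intro t ht
    rw [zero_add, norm_smul, Real.norm_eq_abs, abs_of_nonneg ht.1]
    exact (mul_le_of_le_one_left (norm_nonneg _) ht.2).trans hx
  have hder : ∀ t ∈ Set.Icc (0 : ℝ) 1, HasDerivAt
      (fun τ : ℝ => x 0 * pd 0 h (0 + τ • x) + x 1 * pd 1 h (0 + τ • x))
      (hess h (0 + t • x) x) t := fun t ht => hasDerivAt_line_line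
    (H.contDiffAt_two hm (by rw [mem_disc]; linarith [hxn t ht]))
  obtain ⟨c, hc, hce⟩ := exists_hasDerivAt_eq_slope _ _ zero_lt_one
    (fun t ht => (hder t ht).continuousAt.continuousWithinAt)
    (fun t ht => hder t (Set.Ioo_subset_Icc_self ht))
  have h1 := hh _ (hxn c (Set.Ioo_subset_Icc_self hc)) x
  have h2 : 0 ≤ κ * ‖x‖ ^ 2 := by positivity
  have hz : ∀ j, pd j h 0 = 0 := fun j => by simp [pd, H.fderiv_zero hα hR hκ]
  simp only [one_smul, zero_smul, zero_add, hz, sub_zero, div_one, mul_zero, add_zero] at hce h1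
  linarith

end IsGapProfile
end profile

/-! ### The supremum bound -/

/-- The operator `gapOperator` in coordinates. -/
noncomputable def gapOp (ε : ℝ) (h U : Plane → ℝ) (x : Plane) : ℝ :=
  lap U x + 3 / (ε + h x) * (pd 0 h x * pd 0 U x + pd 1 h x * pd 1 U x)

lemma gapOperator_eq {ε : ℝ} {h U : Plane → ℝ} {x : Plane} (hU : ContDiffAt ℝ 2 U x) :
    gapOperator ε h U x = gapOp ε h U x := by
  rw [gapOperator, laplacian_eq_lap hU, inner_gradient_eq, gapOp]

lemma vanishesAtCircle_of_continuousOn {ι : Type*} {ρ : ℝ} (hρ : 0 < ρ) {u : ι → Plane → ℝ}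
    (hc : ∀ i, ContinuousOn (u i) (Metric.closedBall (0 : Plane) ρ))
    (h0 : ∀ i x, ‖x‖ = ρ → u i x = 0) : VanishesAtCircle ρ u := by
  intro i η hη
  have huc := (isCompact_closedBall (0 : Plane) ρ).uniformContinuousOn_of_continuous (hc i)
  obtain ⟨δ, hδ, hd⟩ := Metric.uniformContinuousOn_iff.1 huc η hη
  refine ⟨min δ ρ, lt_min hδ hρ, fun x hx1 hx2 => ?_⟩
  have hx0 : 0 < ‖x‖ := by linarith [min_le_right δ ρ]
  set y : Plane := (ρ / ‖x‖) • x with hy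
  have hyn : ‖y‖ = ρ := by
    rw [hy, norm_smul, Real.norm_eq_abs, abs_of_pos (by positivity)]; field_simp
  have hxy : dist x y < δ := by
    have e : x - y = (1 - ρ / ‖x‖) • x := by rw [hy, sub_smul, one_smul]
    have h1 : 1 ≤ ρ / ‖x‖ := by rw [one_le_div hx0]; exact hx2.le
    rw [dist_eq_norm, e, norm_smul, Real.norm_eq_abs, abs_of_nonpos (by linarith)]
    have : -(1 - ρ / ‖x‖) * ‖x‖ = ρ - ‖x‖ := by field_simp; ring
    rw [this]; linarith [min_le_left δ ρ]
  have := hd x (by simpa using hx2.le) y (by simpa using hyn.le) hxy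
  rw [h0 i y hyn, Real.dist_eq, sub_zero] at this
  exact this.le

section barrier
variable {m : ℕ} {α R κ M ε : ℝ} {h : Plane → ℝ}

lemma pd_rpow_gap {s : ℝ} {x : Plane} (hd : DifferentiableAt ℝ h x) (hw : 0 < ε + h x)
    (j : Fin 2) :
    pd j (fun y => (ε + h y) ^ s) x = s * (ε + h x) ^ (s - 1) * pd j h x := by
  have hG : HasDerivAt (fun t : ℝ => (ε + t) ^ s) (s * (ε + h x) ^ (s - 1)) (h x) := by
    have := ((hasDerivAt_id (h x)).const_add ε).rpow_const (p := s) (Or.inl hw.ne')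
    simpa using this
  exact pd_comp j hG hd

lemma lap_rpow_gap {s : ℝ} {x : Plane} (hd : ContDiffAt ℝ 2 h x) (hw : 0 < ε + h x) :
    lap (fun y => (ε + h y) ^ s) x = s * (ε + h x) ^ (s - 1) * lap h x
      + s * (s - 1) * (ε + h x) ^ (s - 2) * (pd 0 h x ^ 2 + pd 1 h x ^ 2) := by
  have hG : ∀ p t : ℝ, 0 < ε + t →
      HasDerivAt (fun t : ℝ => (ε + t) ^ p) (p * (ε + t) ^ (p - 1)) t := by
    intro p t ht
    have := ((hasDerivAt_id t).const_add ε).rpow_const (p := p) (Or.inl ht.ne')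
    simpa using this
  have hev : ∀ᶠ t in nhds (h x), 0 < ε + t :=
    (continuous_const.add continuous_id).continuousAt.eventually_const_lt hw
  have := lap_comp (f := h) (G := fun t : ℝ => (ε + t) ^ s)
    (G' := fun t => s * (ε + t) ^ (s - 1)) hd (hev.mono fun t ht => hG s t ht)
    ((hG (s - 1) (h x) hw).const_mul s)
  rw [this]; ring_nf

/-- A power `(ε + h) ^ s` with `-2 ≤ s ≤ 0` satisfies `L (w ^ s) ≤ s w ^ (s - 1) Δh`, because the
gradient terms combine to `s (s + 2) w ^ (s - 2) |∇h|²`. -/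
lemma gapOp_rpow_le {s : ℝ} (hs2 : -2 ≤ s) (hs0 : s ≤ 0) {x : Plane} (hd : ContDiffAt ℝ 2 h x)
    (hw : 0 < ε + h x) :
    gapOp ε h (fun y => (ε + h y) ^ s) x ≤ s * (ε + h x) ^ (s - 1) * lap h x := by
  have hdd := hd.differentiableAt (by simp)
  rw [gapOp, lap_rpow_gap hd hw, pd_rpow_gap hdd hw, pd_rpow_gap hdd hw]
  have e : (ε + h x) ^ (s - 1) = (ε + h x) * (ε + h x) ^ (s - 2) := by
    rw [show s - 1 = 1 + (s - 2) by ring, Real.rpow_add hw, Real.rpow_one]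
  have hp : 0 < (ε + h x) ^ (s - 2) := Real.rpow_pos_of_pos hw _
  have h1 : s * (s + 2) * ((ε + h x) ^ (s - 2) * (pd 0 h x ^ 2 + pd 1 h x ^ 2)) ≤ 0 :=
    mul_nonpos_of_nonpos_of_nonneg (mul_nonpos_of_nonpos_of_nonneg hs0 (by linarith))
      (by positivity)
  have h2 : 3 / (ε + h x) * (pd 0 h x * (s * (ε + h x) ^ (s - 1) * pd 0 h x)
      + pd 1 h x * (s * (ε + h x) ^ (s - 1) * pd 1 h x))
      = 3 * s * (ε + h x) ^ (s - 2) * (pd 0 h x ^ 2 + pd 1 h x ^ 2) := by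
    rw [e]; field_simp
  rw [h2]; linarith

lemma gapOp_expSq {Λ : ℝ} {x : Plane} :
    gapOp ε h (expSq Λ) x = (4 * Λ ^ 2 * ‖x‖ ^ 2 + 4 * Λ
      + 6 * Λ * ((x 0 * pd 0 h x + x 1 * pd 1 h x) / (ε + h x))) * expSq Λ x := by
  rw [gapOp, lap_expSq, pd_expSq, pd_expSq]; ring

lemma abs_radial_le (H : IsGapProfile m α R κ M h) (hm : 1 ≤ m) (hα : 0 < α) (hR : 0 < R)
    (hκ : 0 < κ) (hε : 0 < ε) {x : Plane} (hx : x ∈ disc R) :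
    |(x 0 * pd 0 h x + x 1 * pd 1 h x) / (ε + h x)| ≤ M / κ := by
  have hM := H.bound_nonneg hR
  have hw : 0 < ε + h x := by linarith [H.nonneg hκ hx]
  rw [abs_div, abs_of_pos hw, div_le_div_iff₀ hw hκ, ← fderiv_apply_eq_pd]
  have h1 := (fderiv ℝ h x).le_opNorm x
  have h2 := H.norm_fderiv_le hm hα hR hκ hx
  have h3 := H.positive x hx
  rw [Real.norm_eq_abs] at h1
  calc |fderiv ℝ h x x| * κ ≤ (M * ‖x‖ * ‖x‖) * κ := by
        gcongr
        exact h1.trans (by gcongr)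
    _ = M * (κ * ‖x‖ ^ 2) := by ring
    _ ≤ M * (ε + h x) := by gcongr; linarith

end barrier

/-- A solution of the boundary value problem for a gap profile, with all the data of the problem.
Such tuples index the families to which the uniform estimates are applied. -/
structure GapSolution (m : ℕ) (α R κ M ε₀ γ C₀ : ℝ) where
  /-- the regularization parameter -/
  ε : ℝ
  /-- the gap profile -/
  h : Plane → ℝ
  /-- the right-hand side -/
  F : Plane → ℝ
  /-- the solution -/
  U : Plane → ℝ
  ε_pos : 0 < ε
  ε_le : ε ≤ ε₀
  profile : IsGapProfile m α R κ M h
  F_contDiffOn : ContDiffOn ℝ ∞ F (disc R)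
  F_bound : ∀ l ≤ m, ∀ x ∈ disc R,
    ‖iteratedFDeriv ℝ l F x‖ ≤ C₀ * (ε + h x) ^ (γ - (l : ℝ) / 2)
  U_contDiffOn : ContDiffOn ℝ (m + 1 : ℕ) U (disc R)
  U_continuousOn : ContinuousOn U (Metric.closedBall (0 : Plane) (2 * R))
  U_boundary : ∀ x : Plane, ‖x‖ = 2 * R → U x = 0
  equation : ∀ x ∈ disc R, gapOperator ε h U x = F x

namespace GapSolution
variable {m : ℕ} {α R κ M ε₀ γ C₀ : ℝ}

/-- The regularized gap `ε + h`. -/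
def w (P : GapSolution m α R κ M ε₀ γ C₀) (x : Plane) : ℝ := P.ε + P.h x

lemma w_pos (P : GapSolution m α R κ M ε₀ γ C₀) (hκ : 0 < κ) {x : Plane} (hx : x ∈ disc R) :
    0 < P.w x := add_pos_of_pos_of_nonneg P.ε_pos (P.profile.nonneg hκ hx)

lemma w_le (P : GapSolution m α R κ M ε₀ γ C₀) {x : Plane} (hx : x ∈ disc R) :
    P.w x ≤ |ε₀| + |M| + 1 := by
  have h1 := P.ε_le
  have h2 := P.profile.le_bound hx
  unfold w
  linarith [le_abs_self ε₀, le_abs_self M]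

lemma le_w (P : GapSolution m α R κ M ε₀ γ C₀) {x : Plane} (hx : x ∈ disc R) :
    κ * ‖x‖ ^ 2 ≤ P.w x := by
  have h1 := P.ε_pos
  have h2 := P.profile.positive x hx
  unfold w
  linarith

lemma U_contDiffAt (P : GapSolution m α R κ M ε₀ γ C₀) (hm : 1 ≤ m) {x : Plane}
    (hx : x ∈ disc R) : ContDiffAt ℝ 2 P.U x :=
  (contDiffAt_of_isOpen (isOpen_disc R) P.U_contDiffOn hx).of_le (by norm_cast; omega)

lemma gapOp_U (P : GapSolution m α R κ M ε₀ γ C₀) (hm : 1 ≤ m) {x : Plane} (hx : x ∈ disc R) :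
    gapOp P.ε P.h P.U x = P.F x := by
  rw [← gapOperator_eq (P.U_contDiffAt hm hx)]; exact P.equation x hx

lemma vanishes (hR : 0 < R) :
    VanishesAtCircle (2 * R) (fun P : GapSolution m α R κ M ε₀ γ C₀ => P.U) :=
  vanishesAtCircle_of_continuousOn (by linarith) (fun P => P.U_continuousOn)
    (fun P => P.U_boundary)

lemma abs_F_le (P : GapSolution m α R κ M ε₀ γ C₀) (hκ : 0 < κ) {x : Plane} (hx : x ∈ disc R) :
    |P.F x| ≤ |C₀| * P.w x ^ γ := by
  have := P.F_bound 0 (Nat.zero_le _) x hx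
  rw [norm_iteratedFDeriv_zero, Real.norm_eq_abs, Nat.cast_zero, zero_div, sub_zero] at this
  refine this.trans (mul_le_mul_of_nonneg_right (le_abs_self _) ?_)
  exact Real.rpow_nonneg (P.w_pos hκ hx).le _

/-- The supremum bound, by comparison with `K₁ (ε + h) ^ (γ + 1) + K₂ (exp (4ΛR²) - exp (Λ|x|²))`.
The first term is a supersolution near the origin, where `h` is convex; the second one compensates
for it elsewhere and is a supersolution everywhere. -/
theorem sup_bound (hm : 1 ≤ m) (hα : 0 < α) (hR : 0 < R) (hκ : 0 < κ) (hγ3 : -3 ≤ γ)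
    (hγ1 : γ < -1) :
    ∃ C : ℝ, ∀ P : GapSolution m α R κ M ε₀ γ C₀, ∀ x ∈ disc R, |P.U x| ≤ C * P.w x ^ (γ + 1) := by
  obtain ⟨r₀, hr₀, hr₀R, hhess⟩ := IsGapProfile.exists_hess_ge m hm hα hR hκ M
  set s := γ + 1 with hs
  have hs0 : s < 0 := by rw [hs]; linarith
  have hs2 : -2 ≤ s := by rw [hs]; linarith
  have hsγ : s - 1 = γ := by rw [hs]; ring
  set Λ := 1 + 2 * |M| / (κ * r₀ ^ 2) with hΛ
  have hΛ1 : 1 ≤ Λ := le_add_of_nonneg_right (by positivity)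
  have hΛ0 : 0 ≤ Λ := by linarith
  set Q := (κ * r₀ ^ 2) ^ γ with hQ
  have hQ0 : 0 < Q := Real.rpow_pos_of_pos (by positivity) _
  -- `K₁` makes the first term dominate `F` near the origin, and `K₂` corrects it elsewhere
  set K₁ := (|C₀| + 1) / (2 * κ * (-s)) with hK₁
  have hns : 0 < -s := by linarith
  have hK₁0 : 0 < K₁ := by positivity
  have hK₁s : K₁ * (2 * κ * (-s)) = |C₀| + 1 :=
    div_mul_cancel₀ _ (by positivity)
  set K₂ := |C₀| * Q + K₁ * (-s) * (2 * |M|) * Q + 1 with hK₂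
  have hK₂0 : 0 < K₂ := by positivity
  set W := |ε₀| + |M| + 1 with hW
  have hW0 : 0 < W := by positivity
  set E := Real.exp (Λ * (2 * R) ^ 2) with hE
  -- the barrier is a strict supersolution
  have hbar : ∀ P : GapSolution m α R κ M ε₀ γ C₀, ∀ x ∈ disc R,
      |C₀| * P.w x ^ γ < -(K₁ * gapOp P.ε P.h (fun y => P.w y ^ s) x)
        + K₂ * gapOp P.ε P.h (expSq Λ) x := by
    intro P x hx
    have hw := P.w_pos hκ hx
    have h1 : gapOp P.ε P.h (fun y => P.w y ^ s) x ≤ s * P.w x ^ γ * lap P.h x := by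
      have := gapOp_rpow_le hs2 hs0.le (P.profile.contDiffAt_two hm hx) hw
      rwa [hsγ] at this
    have hwγ : 0 < P.w x ^ γ := Real.rpow_pos_of_pos hw _
    have hexp := one_le_expSq hΛ0 x
    rcases le_or_gt ‖x‖ r₀ with hxr | hxr
    · have hl := IsGapProfile.lap_ge_of_hess (hhess P.h P.profile x hxr)
      have hrad := P.profile.radial_nonneg hm hα hR hκ hr₀R (hhess P.h P.profile) hxr
      have h2 : 0 ≤ gapOp P.ε P.h (expSq Λ) x := by
        rw [gapOp_expSq]
        have : 0 ≤ (x 0 * pd 0 P.h x + x 1 * pd 1 P.h x) / (P.ε + P.h x) := div_nonneg hrad hw.le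
        positivity
      have h3 : s * P.w x ^ γ * lap P.h x ≤ s * P.w x ^ γ * (2 * κ) := by
        have : s * P.w x ^ γ ≤ 0 := mul_nonpos_of_nonpos_of_nonneg hs0.le hwγ.le
        exact mul_le_mul_of_nonpos_left hl this
      have h4 : K₁ * gapOp P.ε P.h (fun y => P.w y ^ s) x ≤ K₁ * (s * P.w x ^ γ * (2 * κ)) := by
        gcongr; exact h1.trans h3
      have h5 : K₁ * (s * P.w x ^ γ * (2 * κ)) = -((|C₀| + 1) * P.w x ^ γ) := by
        rw [← hK₁s]; ring
      have h6 := mul_nonneg hK₂0.le h2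
      linarith
    · have hwq : κ * r₀ ^ 2 ≤ P.w x := le_trans (by gcongr) (P.le_w hx)
      have hwQ : P.w x ^ γ ≤ Q :=
        Real.rpow_le_rpow_of_nonpos (by positivity) hwq (by linarith)
      have hlap : |lap P.h x| ≤ 2 * |M| := by
        have a0 := P.profile.abs_pd_pd_le hm hx 0 0
        have a1 := P.profile.abs_pd_pd_le hm hx 1 1
        refine (abs_add_le _ _).trans ?_
        linarith [le_abs_self M]
      have h3 : s * P.w x ^ γ * lap P.h x ≤ (-s) * (2 * |M|) * Q := by
        have h7 : -lap P.h x ≤ 2 * |M| := (neg_le_abs _).trans hlap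
        calc s * P.w x ^ γ * lap P.h x = (-s) * (P.w x ^ γ * (-lap P.h x)) := by ring
          _ ≤ (-s) * (P.w x ^ γ * (2 * |M|)) := by gcongr
          _ ≤ (-s) * (Q * (2 * |M|)) := by gcongr
          _ = _ := by ring
      have h2 : 4 ≤ gapOp P.ε P.h (expSq Λ) x := by
        rw [gapOp_expSq]
        have hrad := (abs_le.1 (abs_radial_le P.profile hm hα hR hκ P.ε_pos hx)).1
        set ξ := (x 0 * pd 0 P.h x + x 1 * pd 1 P.h x) / (P.ε + P.h x) with hξ
        have h8 : 2 * |M| / κ ≤ Λ * r₀ ^ 2 := by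
          rw [hΛ, add_mul]
          have : 2 * |M| / (κ * r₀ ^ 2) * r₀ ^ 2 = 2 * |M| / κ := by field_simp
          rw [this]; linarith [sq_nonneg r₀]
        have h9 : Λ * r₀ ^ 2 ≤ Λ * ‖x‖ ^ 2 := by gcongr
        have h10 : M / κ ≤ |M| / κ := by gcongr; exact le_abs_self M
        have h11 : 2 * |M| / κ = 2 * (|M| / κ) := by ring
        have h12 : 0 ≤ |M| / κ := by positivity
        have h13 : 0 ≤ Λ * (4 * (Λ * ‖x‖ ^ 2) + 6 * ξ) := by
          apply mul_nonneg hΛ0; linarith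
        have h14 : 4 ≤ 4 * Λ ^ 2 * ‖x‖ ^ 2 + 4 * Λ + 6 * Λ * ξ := by nlinarith
        calc (4 : ℝ) ≤ (4 * Λ ^ 2 * ‖x‖ ^ 2 + 4 * Λ + 6 * Λ * ξ) * 1 := by linarith
          _ ≤ _ := by gcongr
      have h4 : K₁ * gapOp P.ε P.h (fun y => P.w y ^ s) x ≤ K₁ * ((-s) * (2 * |M|) * Q) := by
        gcongr; exact h1.trans h3
      have h5 := mul_le_mul_of_nonneg_left h2 hK₂0.le
      have h6 : |C₀| * P.w x ^ γ ≤ |C₀| * Q := by gcongr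
      linarith
  have main : ∀ P : GapSolution m α R κ M ε₀ γ C₀, ∀ σ : ℝ, |σ| = 1 → ∀ x ∈ disc R,
      σ * P.U x ≤ K₁ * P.w x ^ s + K₂ * (E - expSq Λ x) := by
    intro P σ hσ x hx
    have hx' := mem_disc.1 hx
    refine le_of_forall_pos_le_add fun η hη => ?_
    obtain ⟨τ, hτ, hUτ⟩ := vanishes hR P η hη
    set τ' := min (τ / 2) (2 * R - ‖x‖) with hτ'
    have hτ'0 : 0 < τ' := lt_min (by positivity) (by linarith)
    have hτ'τ : τ' < τ := (min_le_left _ _).trans_lt (by linarith)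
    have hKd : Metric.closedBall (0 : Plane) (2 * R - τ') ⊆ disc R := fun y hy => by
      rw [mem_disc]; have : ‖y‖ ≤ 2 * R - τ' := by simpa using hy
      linarith
    set V : Plane → ℝ := fun y =>
      (σ * P.U y + K₂ * expSq Λ y - K₁ * P.w y ^ s) - (K₂ * E + η) with hV
    have c1 : ∀ y ∈ disc R, ContDiffAt ℝ 2 (fun y => σ * P.U y) y := fun y hy =>
      contDiffAt_const.mul (P.U_contDiffAt hm hy)
    have c2 : ∀ y, ContDiffAt ℝ 2 (fun y => K₂ * expSq Λ y) y := fun y =>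
      contDiffAt_const.mul (contDiff_expSq Λ).contDiffAt
    have c3' : ∀ y ∈ disc R, ContDiffAt ℝ 2 (fun y => P.w y ^ s) y := fun y hy =>
      (contDiffAt_const.add (P.profile.contDiffAt_two hm hy)).rpow_const_of_ne (P.w_pos hκ hy).ne'
    have c3 : ∀ y ∈ disc R, ContDiffAt ℝ 2 (fun y => K₁ * P.w y ^ s) y := fun y hy =>
      contDiffAt_const.mul (c3' y hy)
    have cV : ∀ y ∈ disc R, ContDiffAt ℝ 2 V y := fun y hy =>
      (((c1 y hy).add (c2 y)).sub (c3 y hy)).sub contDiffAt_const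
    have hle := nonpos_of_maximum_principle (isCompact_closedBall (0 : Plane) (2 * R - τ')) (V := V)
      (fun y hy => (cV y (hKd hy)).continuousAt.continuousWithinAt) (by
        intro y hy hpos
        have hyd := hKd hy
        have hyn : ‖y‖ ≤ 2 * R - τ' := by simpa using hy
        have hyR := mem_disc.1 hyd
        have hgap : 0 ≤ K₂ * (E - expSq Λ y) := by
          refine mul_nonneg hK₂0.le (le_trans ?_ (le_expSq_gap hΛ0 hyR.le))
          have : ‖y‖ ^ 2 ≤ (2 * R) ^ 2 := by gcongr
          exact mul_nonneg hΛ0 (by linarith)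
        have hws : 0 ≤ K₁ * P.w y ^ s :=
          mul_nonneg hK₁0.le (Real.rpow_nonneg (P.w_pos hκ hyd).le _)
        have hU : η < σ * P.U y := by simp only [hV] at hpos; linarith
        have hlt : ‖y‖ < 2 * R - τ' := by
          rcases hyn.lt_or_eq with h' | h'
          · exact h'
          · exfalso
            have h1 := hUτ y (by linarith) hyR
            have h2 : σ * P.U y ≤ |P.U y| := by
              refine (le_abs_self _).trans ?_; rw [abs_mul, hσ, one_mul]
            linarith
        refine ⟨Metric.closedBall_mem_nhds_of_mem (by simpa using hlt), cV y hyd, fun p0 p1 => ?_⟩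
        have d1 := (P.U_contDiffAt hm hyd).differentiableAt (by simp)
        have d2 : DifferentiableAt ℝ (expSq Λ) y :=
          (contDiff_expSq Λ (n := 1)).differentiable (by simp) y
        have d3 := (c3' y hyd).differentiableAt (by simp)
        have hpd : ∀ j, pd j V y = σ * pd j P.U y + K₂ * pd j (expSq Λ) y
            - K₁ * pd j (fun y => P.w y ^ s) y := by
          intro j
          rw [hV, pd_sub j (((d1.const_mul _).fun_add (d2.const_mul _)).fun_sub (d3.const_mul _))
            (differentiableAt_const _), pd_sub j ((d1.const_mul _).fun_add (d2.const_mul _))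
            (d3.const_mul _), pd_add j (d1.const_mul _) (d2.const_mul _), pd_const_mul j _ d1,
            pd_const_mul j _ d2, pd_const_mul j _ d3, pd_const, sub_zero]
        have hl : lap V y = σ * lap P.U y + K₂ * lap (expSq Λ) y
            - K₁ * lap (fun y => P.w y ^ s) y := by
          rw [hV, lap_sub (((c1 y hyd).add (c2 y)).sub (c3 y hyd)) contDiffAt_const,
            lap_sub ((c1 y hyd).add (c2 y)) (c3 y hyd), lap_add (c1 y hyd) (c2 y),
            lap_const_mul _ (P.U_contDiffAt hm hyd),
            lap_const_mul _ (contDiff_expSq Λ).contDiffAt, lap_const_mul _ (c3' y hyd),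
            lap_const, sub_zero]
        rw [hpd] at p0 p1
        have hb := hbar P y hyd
        have hF := P.gapOp_U hm hyd
        have hσF : -(|C₀| * P.w y ^ γ) ≤ σ * P.F y := by
          have : |σ * P.F y| ≤ |C₀| * P.w y ^ γ := by
            rw [abs_mul, hσ, one_mul]; exact P.abs_F_le hκ hyd
          exact (abs_le.1 this).1
        have key : lap V y = σ * gapOp P.ε P.h P.U y + K₂ * gapOp P.ε P.h (expSq Λ) y
            - K₁ * gapOp P.ε P.h (fun y => P.w y ^ s) y := by
          rw [hl]; simp only [gapOp]
          linear_combination (-(3 / (P.ε + P.h y)) * pd 0 P.h y) * p0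
            + (-(3 / (P.ε + P.h y)) * pd 1 P.h y) * p1
        rw [key, hF]
        linarith)
    have hxK : x ∈ Metric.closedBall (0 : Plane) (2 * R - τ') := by
      have := min_le_right (τ / 2) (2 * R - ‖x‖)
      rw [mem_closedBall_zero_iff]; linarith
    have := hle x hxK
    simp only [hV] at this
    linarith
  refine ⟨K₁ + K₂ * E * W ^ (-s), fun P x hx => ?_⟩
  have hw := P.w_pos hκ hx
  have hE0 : 0 < E := Real.exp_pos _
  have h1 : |P.U x| ≤ K₁ * P.w x ^ s + K₂ * E := by
    have hge : K₂ * (E - expSq Λ x) ≤ K₂ * E := by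
      have := one_le_expSq hΛ0 x
      gcongr; linarith
    have a1 := main P 1 (by simp) x hx
    have a2 := main P (-1) (by simp) x hx
    rw [abs_le']
    constructor <;> linarith
  have h2 : 1 ≤ W ^ (-s) * P.w x ^ s := by
    rw [Real.rpow_neg hW0.le, ← div_eq_inv_mul, one_le_div (Real.rpow_pos_of_pos hW0 _)]
    exact Real.rpow_le_rpow_of_nonpos hw (P.w_le hx) hs0.le
  calc |P.U x| ≤ K₁ * P.w x ^ s + K₂ * E * 1 := by rw [mul_one]; exact h1
    _ ≤ K₁ * P.w x ^ s + K₂ * E * (W ^ (-s) * P.w x ^ s) := by gcongr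
    _ = _ := by ring

end GapSolution

namespace GapSolution
variable {m : ℕ} {α R κ M ε₀ γ C₀ : ℝ}

/-! ### Derivative bounds near the boundary circle -/

lemma contDiffOn_h (P : GapSolution m α R κ M ε₀ γ C₀) :
    ContDiffOn ℝ (m + 1 : ℕ) P.h (disc R) := P.profile.holder.contDiffOn

lemma differentiableAt_h (P : GapSolution m α R κ M ε₀ γ C₀) {x : Plane} (hx : x ∈ disc R) :
    DifferentiableAt ℝ P.h x :=
  (contDiffAt_of_isOpen (isOpen_disc R) P.contDiffOn_h hx).differentiableAt (by norm_cast)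

lemma F_contDiffOn_nat (P : GapSolution m α R κ M ε₀ γ C₀) (n : ℕ) :
    ContDiffOn ℝ n P.F (disc R) := P.F_contDiffOn.of_le (by exact_mod_cast le_top)

lemma annulus_subset_disc : annulus (2 * R) R ⊆ disc R := fun _ hx =>
  mem_disc.2 hx.2

/-- Near the circle `ε + h` is bounded from below, so that the boundary estimate applies with a
constant that depends only on the data. -/
theorem boundary_bound (hm : 1 ≤ m) (hα : 0 < α) (hR : 0 < R) (hκ : 0 < κ) (hγ3 : -3 ≤ γ)
    (hγ1 : γ < -1) :
    ∃ K : ℝ, ∀ P : GapSolution m α R κ M ε₀ γ C₀, ∀ l ≤ m + 1, ∀ x ∈ annulus (2 * R) (R / 2),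
      ‖iteratedFDeriv ℝ l P.U x‖ ≤ K := by
  obtain ⟨k, rfl⟩ : ∃ k, m = k + 1 := ⟨m - 1, by omega⟩
  set I := GapSolution (k + 1) α R κ M ε₀ γ C₀
  have hsub := annulus_subset_disc (R := R)
  have hop : ∀ _ : I, IsOpen (annulus (2 * R) R) := fun _ => isOpen_annulus _ _
  set q := κ * R ^ 2 with hq
  have hq0 : 0 < q := by positivity
  have hwq : ∀ P : I, ∀ x ∈ annulus (2 * R) R, q ≤ P.w x := fun P x hx => by
    have h1 : R ≤ ‖x‖ := by linarith [hx.1]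
    exact le_trans (by rw [hq]; gcongr) (P.le_w (hsub hx))
  have hwe : ∀ e : ℝ, e ≤ 0 → ∀ P : I, ∀ x ∈ annulus (2 * R) R, P.w x ^ e ≤ q ^ e :=
    fun e he P x hx => Real.rpow_le_rpow_of_nonpos hq0 (hwq P x hx) he
  have hh : BddDeriv (fun _ => 1) (fun _ : I => annulus (2 * R) R) (k + 2) (fun P => P.h) :=
    bddDeriv_of_iteratedFDeriv (fun _ => zero_le_one) hop (fun P => P.contDiffOn_h.mono hsub)
      ⟨M, fun P l hl x hx => by
        rw [one_pow, one_mul]; exact P.profile.holder.bound l hl x (hsub hx)⟩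
  have hw : BddDeriv (fun _ => 1) (fun _ : I => annulus (2 * R) R) (k + 2) (fun P => P.w) :=
    (bddDeriv_const (c := fun P : I => P.ε) ⟨|ε₀|, fun P => by
      rw [abs_of_pos P.ε_pos]; exact P.ε_le.trans (le_abs_self _)⟩).add hop hh
  have hβ : ∀ j, BddDeriv (fun _ => 1) (fun _ : I => annulus (2 * R) R) (k + 1)
      (fun P x => 3 * (pd j P.h x * (P.w x)⁻¹)) := fun j =>
    ((hh.pd_one j).mul hop (hw.pred.inv hop hq0 hwq)).const_mul hop 3
  have hF : BddDeriv (fun _ => 1) (fun _ : I => annulus (2 * R) R) (k + 1) (fun P => P.F) :=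
    bddDeriv_of_iteratedFDeriv (fun _ => zero_le_one) hop
      (fun P => (P.F_contDiffOn_nat (k + 1)).mono hsub)
      ⟨∑ l ∈ Finset.range (k + 2), |C₀| * q ^ (γ - (l : ℝ) / 2), fun P l hl x hx => by
        rw [one_pow, one_mul]
        refine (P.F_bound l hl x (hsub hx)).trans ?_
        have h1 : C₀ * (P.ε + P.h x) ^ (γ - (l : ℝ) / 2) ≤ |C₀| * q ^ (γ - (l : ℝ) / 2) :=
          mul_le_mul (le_abs_self _)
            (hwe _ (by have : (0 : ℝ) ≤ (l : ℝ) / 2 := by positivity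
                       linarith) P x hx)
            (Real.rpow_nonneg (P.w_pos hκ (hsub hx)).le _) (abs_nonneg _)
        refine h1.trans (Finset.single_le_sum (f := fun l : ℕ => |C₀| * q ^ (γ - (l : ℝ) / 2))
          (fun i _ => ?_) (Finset.mem_range.2 (by omega)))
        positivity⟩
  have hU : UnifBdd (fun _ : I => annulus (2 * R) R) (fun P => P.U) := by
    obtain ⟨C, hC⟩ := sup_bound (ε₀ := ε₀) (M := M) (C₀ := C₀) hm hα hR hκ hγ3 hγ1
    refine ⟨|C| * q ^ (γ + 1), fun P x hx => (hC P x (hsub hx)).trans ?_⟩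
    exact mul_le_mul (le_abs_self _) (hwe _ (by linarith) P x hx)
      (Real.rpow_nonneg (P.w_pos hκ (hsub hx)).le _) (abs_nonneg _)
  have hest := boundary_estimate (ι := I) k (b := R / 2) (a := R) (ρ := 2 * R) (by linarith)
    (by linarith) (by linarith) (fun P => P.U_contDiffOn.mono hsub) hU (vanishes hR) hβ hF
    (fun P x hx => by
      rw [← P.gapOp_U hm (hsub hx), gapOp]
      change _ = lap P.U x + 3 / P.w x * _
      rw [div_eq_mul_inv]; ring)
  obtain ⟨K, hK⟩ := hest.iteratedFDeriv_le (fun _ => zero_le_one) (fun _ => isOpen_annulus _ _)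
    (fun P => P.U_contDiffOn.mono ((annulus_mono (by linarith)).trans hsub))
  refine ⟨K, fun P l hl x hx => ?_⟩
  have := hK P l hl x hx
  rwa [one_pow, one_mul] at this

/-! ### Derivative bounds in the interior -/

/-- On a disc whose radius is a small multiple of `√(w x)` the gap is comparable to `w x`, and its
gradient is at most a multiple of `√(w x)`. -/
lemma exists_scale (hm : 1 ≤ m) (hα : 0 < α) (hR : 0 < R) (hκ : 0 < κ) (M ε₀ γ C₀ : ℝ) :
    ∃ c A : ℝ, 0 < c ∧ c ≤ 1 ∧ ∀ P : GapSolution m α R κ M ε₀ γ C₀, ∀ x : Plane,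
      ‖x‖ ≤ 3 * R / 2 → ∀ y ∈ Metric.ball x (c * √(P.w x)), y ∈ disc R ∧
        P.w x / 2 ≤ P.w y ∧ P.w y ≤ 2 * P.w x ∧ ‖fderiv ℝ P.h y‖ ≤ A * √(P.w x) := by
  set W := |ε₀| + |M| + 1 with hW
  have hW0 : 0 < W := by positivity
  -- the gradient bound: `|∇h y| ≤ M |y|` and `|y| ≤ √(w x / κ) + √(w x)`
  set B := (|M| + 1) * (√κ⁻¹ + 1) with hB
  have hB0 : 0 < B := by positivity
  set c := min 1 (min (R / (4 * √W)) (1 / (2 * B))) with hc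
  have hsW : 0 < √W := Real.sqrt_pos.2 hW0
  have hc0 : 0 < c := by
    refine lt_min one_pos (lt_min ?_ ?_) <;> positivity
  have hc1 : c ≤ 1 := min_le_left _ _
  have hcR : c ≤ R / (4 * √W) := (min_le_right _ _).trans (min_le_left _ _)
  have hcB : c ≤ 1 / (2 * B) := (min_le_right _ _).trans (min_le_right _ _)
  refine ⟨c, B, hc0, hc1, fun P x hx => ?_⟩
  have hxd : x ∈ disc R := mem_disc.2 (by linarith)
  have hw := P.w_pos hκ hxd
  set s := √(P.w x) with hs
  have hs0 : 0 < s := Real.sqrt_pos.2 hw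
  have hss : s * s = P.w x := Real.mul_self_sqrt hw.le
  have hsle : s ≤ √W := Real.sqrt_le_sqrt (P.w_le hxd)
  have hxs : ‖x‖ ≤ √κ⁻¹ * s := by
    rw [hs, ← Real.sqrt_mul (by positivity)]
    apply Real.le_sqrt_of_sq_le
    rw [inv_mul_eq_div, le_div_iff₀ hκ, mul_comm]
    exact P.le_w hxd
  have hrR : c * s ≤ R / 4 := by
    calc c * s ≤ R / (4 * √W) * √W := by gcongr
      _ = R / 4 := by field_simp
  have hsubset : Metric.ball x (c * s) ⊆ disc R := by
    apply Metric.ball_subset_ball'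
    rw [dist_zero_right]; linarith
  have hM := P.profile.bound_nonneg hR
  have hgrad : ∀ y ∈ Metric.ball x (c * s), ‖fderiv ℝ P.h y‖ ≤ B * s := by
    intro y hy
    have hyx : ‖y‖ ≤ ‖x‖ + c * s := by
      rw [Metric.mem_ball, dist_eq_norm] at hy
      linarith [norm_sub_norm_le y x]
    have h1 : c * s ≤ 1 * s := by gcongr
    calc ‖fderiv ℝ P.h y‖ ≤ M * ‖y‖ := P.profile.norm_fderiv_le hm hα hR hκ (hsubset hy)
      _ ≤ (|M| + 1) * (√κ⁻¹ * s + 1 * s) := by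
          gcongr
          · linarith [le_abs_self M]
          · linarith
      _ = B * s := by rw [hB]; ring
  intro y hy
  have hdiff : |P.w y - P.w x| ≤ P.w x / 2 := by
    have := (convex_ball x (c * s)).norm_image_sub_le_of_norm_fderiv_le
      (fun z hz => P.differentiableAt_h (hsubset hz)) hgrad
      (Metric.mem_ball_self (by positivity)) hy
    have e : P.w y - P.w x = P.h y - P.h x := by simp [w]
    rw [e, ← Real.norm_eq_abs]
    refine this.trans ?_
    have h1 : ‖y - x‖ ≤ c * s := by rw [← dist_eq_norm]; exact le_of_lt hy
    have h2 : B * c ≤ 1 / 2 := by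
      calc B * c ≤ B * (1 / (2 * B)) := by gcongr
        _ = 1 / 2 := by field_simp
    calc B * s * ‖y - x‖ ≤ B * s * (c * s) := by gcongr
      _ = B * c * P.w x := by rw [← hss]; ring
      _ ≤ 1 / 2 * P.w x := by gcongr
      _ = P.w x / 2 := by ring
  have h3 := abs_le.1 hdiff
  exact ⟨hsubset hy, by linarith [h3.1], by linarith [h3.2], hgrad y hy⟩

lemma sqrt_pow_eq {t : ℝ} (ht : 0 ≤ t) (l : ℕ) : √t ^ l = t ^ ((l : ℝ) / 2) := by
  rw [Real.sqrt_eq_rpow, ← Real.rpow_natCast, ← Real.rpow_mul ht]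
  congr 1; ring

/-- The weighted bounds away from the circle: the interior estimate for `U` and `F`, divided by
`(w x) ^ (γ + 1)`, on discs of radius `c √(w x)`. -/
theorem interior_bound (hm : 1 ≤ m) (hα : 0 < α) (hR : 0 < R) (hκ : 0 < κ) (hγ3 : -3 ≤ γ)
    (hγ1 : γ < -1) :
    ∃ K : ℝ, ∀ P : GapSolution m α R κ M ε₀ γ C₀, ∀ l ≤ m + 1, ∀ x : Plane, ‖x‖ ≤ 3 * R / 2 →
      ‖iteratedFDeriv ℝ l P.U x‖ ≤ K * P.w x ^ (γ - (l : ℝ) / 2 + 1) := by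
  obtain ⟨k, rfl⟩ : ∃ k, m = k + 1 := ⟨m - 1, by omega⟩
  obtain ⟨c, A, hc0, hc1, hscale⟩ := exists_scale hm hα hR hκ M ε₀ γ C₀
  -- the family is indexed by the solutions together with the centres of the discs
  let κ' := {p : GapSolution (k + 1) α R κ M ε₀ γ C₀ × Plane // ‖p.2‖ ≤ 3 * R / 2}
  let w₀ : κ' → ℝ := fun i => i.1.1.w i.1.2
  let r : κ' → ℝ := fun i => c * √(w₀ i)
  let S : κ' → Set Plane := fun i => Metric.ball i.1.2 (1 * r i)
  have hS : ∀ i, ∀ y ∈ S i, y ∈ disc R ∧ w₀ i / 2 ≤ i.1.1.w y ∧ i.1.1.w y ≤ 2 * w₀ i ∧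
      ‖fderiv ℝ i.1.1.h y‖ ≤ A * √(w₀ i) := fun i y hy => by
    refine hscale i.1.1 i.1.2 i.2 y ?_
    simp only [S, one_mul] at hy
    exact hy
  have hcd : ∀ i : κ', i.1.2 ∈ disc R := fun i => mem_disc.2 (by linarith [i.2])
  have hw₀ : ∀ i, 0 < w₀ i := fun i => i.1.1.w_pos hκ (hcd i)
  have hsq : ∀ i, 0 < √(w₀ i) := fun i => Real.sqrt_pos.2 (hw₀ i)
  have hr : ∀ i, 0 < r i := fun i => mul_pos hc0 (hsq i)
  have hrs : ∀ i, r i ≤ √(w₀ i) := fun i => mul_le_of_le_one_left (hsq i).le hc1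
  have hop : ∀ i, IsOpen (S i) := fun i => Metric.isOpen_ball
  have hsub : ∀ i, S i ⊆ disc R := fun i y hy => (hS i y hy).1
  set W := |ε₀| + |M| + 1 with hW
  have hW1 : 1 ≤ W := by rw [hW]; linarith [abs_nonneg ε₀, abs_nonneg M]
  have hsW : ∀ i, √(w₀ i) ≤ W := fun i => by
    rw [Real.sqrt_le_left (by linarith)]
    have : w₀ i ≤ W := i.1.1.w_le (hcd i)
    nlinarith
  have hw₀s : ∀ i, w₀ i = √(w₀ i) ^ 2 := fun i => (Real.sq_sqrt (hw₀ i).le).symm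
  -- the rescaled gap
  have hh : BddDeriv r S (k + 2) (fun i y => (w₀ i)⁻¹ * i.1.1.h y) := by
    refine bddDeriv_of_iteratedFDeriv (fun i => (hr i).le) hop
      (fun i => contDiffOn_const.mul (i.1.1.contDiffOn_h.mono (hsub i)))
      ⟨max 2 (max A (|M| * W ^ k)), fun i l hl y hy => ?_⟩
    have hy' := hS i y hy
    have hca : ContDiffAt ℝ l i.1.1.h y :=
      (contDiffAt_of_isOpen (isOpen_disc R) i.1.1.contDiffOn_h hy'.1).of_le (by exact_mod_cast hl)
    have e : iteratedFDeriv ℝ l (fun y => (w₀ i)⁻¹ * i.1.1.h y) y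
        = (w₀ i)⁻¹ • iteratedFDeriv ℝ l i.1.1.h y :=
      iteratedFDeriv_const_smul_apply (a := (w₀ i)⁻¹) hca
    rw [e, norm_smul, Real.norm_eq_abs, abs_of_pos (inv_pos.2 (hw₀ i))]
    match l, hl with
    | 0, _ =>
      refine le_max_of_le_left ?_
      rw [pow_zero, one_mul, norm_iteratedFDeriv_zero, Real.norm_eq_abs,
        abs_of_nonneg (i.1.1.profile.nonneg hκ hy'.1), inv_mul_le_iff₀ (hw₀ i)]
      have h1 := hy'.2.2.1
      have h2 := i.1.1.ε_pos
      unfold w at h1; linarith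
    | 1, _ =>
      refine le_max_of_le_right (le_max_of_le_left ?_)
      have e1 : ‖iteratedFDeriv ℝ 1 i.1.1.h y‖ = ‖fderiv ℝ i.1.1.h y‖ := by
        rw [← norm_iteratedFDeriv_fderiv, norm_iteratedFDeriv_zero]
      rw [pow_one, e1]
      calc r i * ((w₀ i)⁻¹ * ‖fderiv ℝ i.1.1.h y‖)
          ≤ √(w₀ i) * ((w₀ i)⁻¹ * (A * √(w₀ i))) := by
            have := hw₀ i
            gcongr
            · exact hrs i
            · exact hy'.2.2.2
        _ = A := by
            have := hsq i
            rw [mul_comm, mul_assoc, mul_assoc, ← sq, ← hw₀s, mul_comm A, ← mul_assoc,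
              inv_mul_cancel₀ (hw₀ i).ne', one_mul]
    | l + 2, hl =>
      refine le_max_of_le_right (le_max_of_le_right ?_)
      have hb := (i.1.1.profile.holder.bound (l + 2) hl y hy'.1).trans (le_abs_self M)
      calc r i ^ (l + 2) * ((w₀ i)⁻¹ * ‖iteratedFDeriv ℝ (l + 2) i.1.1.h y‖)
          ≤ √(w₀ i) ^ (l + 2) * ((w₀ i)⁻¹ * |M|) := by
            have := hw₀ i
            have := hr i
            gcongr
            exact hrs i
        _ = |M| * √(w₀ i) ^ l := by
            rw [pow_add, ← hw₀s]; field_simp [(hw₀ i).ne']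
        _ ≤ |M| * W ^ l := by gcongr; exact hsW i
        _ ≤ |M| * W ^ k := by gcongr; omega
  have hq : BddDeriv r S (k + 2) (fun i y => (w₀ i)⁻¹ * i.1.1.w y) :=
    ((bddDeriv_const (c := fun i : κ' => (w₀ i)⁻¹ * i.1.1.ε) ⟨1, fun i => by
      rw [abs_of_pos (mul_pos (inv_pos.2 (hw₀ i)) i.1.1.ε_pos), inv_mul_le_iff₀ (hw₀ i), mul_one]
      exact le_add_of_nonneg_right (i.1.1.profile.nonneg hκ (hcd i))⟩).add hop hh).congr hop
      fun i y _ => by simp only [w]; ring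
  have hβ : ∀ j, BddDeriv r S (k + 1) (fun i y => 3 * (r i * pd j i.1.1.h y) * (i.1.1.w y)⁻¹) := by
    intro j
    have hinv := hq.pred.inv hop (c := 1 / 2) (by norm_num) (fun i y hy => by
      rw [le_inv_mul_iff₀ (hw₀ i)]; linarith [(hS i y hy).2.1])
    refine (((hh.2.2 j).mul hop hinv).const_mul hop 3).congr hop fun i y hy => ?_
    have hy' := hsub i hy
    have h1 := hw₀ i
    have h2 := i.1.1.w_pos hκ hy'
    beta_reduce
    rw [pd_const_mul j _ (i.1.1.differentiableAt_h hy')]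
    field_simp
  have hpow : ∀ e : ℝ, e ≤ 0 → ∀ i, ∀ y ∈ S i, i.1.1.w y ^ e ≤ 2 ^ (-e) * w₀ i ^ e := by
    intro e he i y hy
    have h1 := Real.rpow_le_rpow_of_nonpos (by linarith [hw₀ i]) (hS i y hy).2.1 he
    rw [Real.div_rpow (hw₀ i).le (by norm_num)] at h1
    rw [Real.rpow_neg (by norm_num), inv_mul_eq_div]
    exact h1
  -- the rescaled right-hand side
  have hF : BddDeriv r S (k + 1)
      (fun i y => (r i ^ 2 * w₀ i ^ (-(γ + 1))) * i.1.1.F y) := by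
    refine bddDeriv_of_iteratedFDeriv (fun i => (hr i).le) hop
      (fun i => contDiffOn_const.mul ((i.1.1.F_contDiffOn_nat (k + 1)).mono (hsub i)))
      ⟨|C₀| * 2 ^ (((k + 1 : ℕ) : ℝ) / 2 - γ), fun i l hl y hy => ?_⟩
    have hy' := hsub i hy
    have hca : ContDiffAt ℝ l i.1.1.F y :=
      contDiffAt_of_isOpen (isOpen_disc R) (i.1.1.F_contDiffOn_nat l) hy'
    have e : iteratedFDeriv ℝ l (fun y => (r i ^ 2 * w₀ i ^ (-(γ + 1))) * i.1.1.F y) y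
        = (r i ^ 2 * w₀ i ^ (-(γ + 1))) • iteratedFDeriv ℝ l i.1.1.F y :=
      iteratedFDeriv_const_smul_apply (a := r i ^ 2 * w₀ i ^ (-(γ + 1))) hca
    have hw₀p : 0 < w₀ i ^ (-(γ + 1)) := Real.rpow_pos_of_pos (hw₀ i) _
    have hri := hr i
    rw [e, norm_smul, Real.norm_eq_abs, abs_of_pos (by positivity)]
    have hl0 : (0 : ℝ) ≤ (l : ℝ) / 2 := by positivity
    have hFb : ‖iteratedFDeriv ℝ l i.1.1.F y‖
        ≤ |C₀| * (2 ^ (-(γ - (l : ℝ) / 2)) * w₀ i ^ (γ - (l : ℝ) / 2)) :=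
      (i.1.1.F_bound l hl y hy').trans (mul_le_mul (le_abs_self _)
        (hpow _ (by linarith) i y hy) (Real.rpow_nonneg (i.1.1.w_pos hκ hy').le _) (abs_nonneg _))
    have hcancel : √(w₀ i) ^ (l + 2) * w₀ i ^ (-(γ + 1)) * w₀ i ^ (γ - (l : ℝ) / 2) = 1 := by
      rw [sqrt_pow_eq (hw₀ i).le, ← Real.rpow_add (hw₀ i), ← Real.rpow_add (hw₀ i)]
      rw [show ((l + 2 : ℕ) : ℝ) / 2 + -(γ + 1) + (γ - (l : ℝ) / 2) = 0 by push_cast; ring,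
        Real.rpow_zero]
    calc r i ^ l * (r i ^ 2 * w₀ i ^ (-(γ + 1)) * ‖iteratedFDeriv ℝ l i.1.1.F y‖)
        = r i ^ (l + 2) * (w₀ i ^ (-(γ + 1)) * ‖iteratedFDeriv ℝ l i.1.1.F y‖) := by
          rw [pow_add]; ring
      _ ≤ √(w₀ i) ^ (l + 2) * (w₀ i ^ (-(γ + 1)) *
            (|C₀| * (2 ^ (-(γ - (l : ℝ) / 2)) * w₀ i ^ (γ - (l : ℝ) / 2)))) := by
          gcongr
          exact hrs i
      _ = |C₀| * 2 ^ (-(γ - (l : ℝ) / 2)) * (√(w₀ i) ^ (l + 2) * w₀ i ^ (-(γ + 1))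
            * w₀ i ^ (γ - (l : ℝ) / 2)) := by ring
      _ = |C₀| * 2 ^ (-(γ - (l : ℝ) / 2)) := by rw [hcancel, mul_one]
      _ ≤ _ := by
          gcongr
          · norm_num
          · have : (l : ℝ) ≤ ((k + 1 : ℕ) : ℝ) := by exact_mod_cast hl
            linarith
  have hU : UnifBdd S (fun i y => w₀ i ^ (-(γ + 1)) * i.1.1.U y) := by
    obtain ⟨C, hC⟩ := sup_bound (ε₀ := ε₀) (M := M) (C₀ := C₀) hm hα hR hκ hγ3 hγ1
    refine ⟨|C| * 2 ^ (-(γ + 1)), fun i y hy => ?_⟩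
    have hw₀p : 0 < w₀ i ^ (-(γ + 1)) := Real.rpow_pos_of_pos (hw₀ i) _
    rw [abs_mul, abs_of_pos hw₀p]
    have h1 : |i.1.1.U y| ≤ |C| * (2 ^ (-(γ + 1)) * w₀ i ^ (γ + 1)) :=
      (hC i.1.1 y (hsub i hy)).trans (mul_le_mul (le_abs_self _)
        (hpow _ (by linarith) i y hy) (Real.rpow_nonneg (i.1.1.w_pos hκ (hsub i hy)).le _)
        (abs_nonneg _))
    have hcancel : w₀ i ^ (-(γ + 1)) * w₀ i ^ (γ + 1) = 1 := by
      rw [← Real.rpow_add (hw₀ i), neg_add_cancel, Real.rpow_zero]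
    calc w₀ i ^ (-(γ + 1)) * |i.1.1.U y|
        ≤ w₀ i ^ (-(γ + 1)) * (|C| * (2 ^ (-(γ + 1)) * w₀ i ^ (γ + 1))) := by gcongr
      _ = |C| * 2 ^ (-(γ + 1)) * (w₀ i ^ (-(γ + 1)) * w₀ i ^ (γ + 1)) := by ring
      _ = _ := by rw [hcancel, mul_one]
  have hUC : ∀ i : κ', ContDiffOn ℝ (k + 2 : ℕ) (fun y => w₀ i ^ (-(γ + 1)) * i.1.1.U y) (disc R) :=
    fun i => contDiffOn_const.mul i.1.1.U_contDiffOn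
  have hest := interior_estimate (r := r) (c := fun i : κ' => i.1.2) hr k
    (show (1 / 2 : ℝ) < 1 by norm_num) (fun i => (hUC i).mono (hsub i)) hU hβ hF
    (fun i y hy => by
      have hy' := hsub i hy
      have hc2 := i.1.1.U_contDiffAt hm hy'
      have hd := hc2.differentiableAt (by simp)
      have hg : lap i.1.1.U y + 3 * (i.1.1.w y)⁻¹ * (pd 0 i.1.1.h y * pd 0 i.1.1.U y
          + pd 1 i.1.1.h y * pd 1 i.1.1.U y) = i.1.1.F y := by
        rw [← i.1.1.gapOp_U hm hy', gapOp, div_eq_mul_inv (3 : ℝ)]; rfl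
      rw [lap_const_mul _ hc2, pd_const_mul 0 _ hd, pd_const_mul 1 _ hd, ← hg]
      ring)
  have hsub2 : ∀ i, Metric.ball i.1.2 (1 / 2 * r i) ⊆ S i := fun i =>
    Metric.ball_subset_ball (by have := hr i; linarith)
  obtain ⟨K, hK⟩ := hest.iteratedFDeriv_le (fun i => (hr i).le) (fun i => Metric.isOpen_ball)
    (fun i => (hUC i).mono ((hsub2 i).trans (hsub i)))
  refine ⟨|K| * (c ^ (k + 2))⁻¹, fun P l hl x hx => ?_⟩
  set i : κ' := ⟨(P, x), hx⟩ with hi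
  have hxd : x ∈ disc R := hcd i
  have h1 := hK i l hl x (Metric.mem_ball_self (by have := hr i; positivity))
  have hca : ContDiffAt ℝ l P.U x :=
    (contDiffAt_of_isOpen (isOpen_disc R) P.U_contDiffOn hxd).of_le (by exact_mod_cast hl)
  have e : iteratedFDeriv ℝ l (fun y => w₀ i ^ (-(γ + 1)) * i.1.1.U y) x
      = w₀ i ^ (-(γ + 1)) • iteratedFDeriv ℝ l P.U x :=
    iteratedFDeriv_const_smul_apply (a := w₀ i ^ (-(γ + 1))) hca
  have hw₀p : 0 < w₀ i ^ (-(γ + 1)) := Real.rpow_pos_of_pos (hw₀ i) _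
  rw [e, norm_smul, Real.norm_eq_abs, abs_of_pos hw₀p] at h1
  set N := ‖iteratedFDeriv ℝ l P.U x‖ with hN
  have hexp : r i ^ l * w₀ i ^ (-(γ + 1)) = c ^ l * (w₀ i ^ (γ - (l : ℝ) / 2 + 1))⁻¹ := by
    simp only [r]
    rw [mul_pow, sqrt_pow_eq (hw₀ i).le, mul_assoc, ← Real.rpow_add (hw₀ i),
      ← Real.rpow_neg (hw₀ i).le]
    congr 2; ring
  have hw₀e : 0 < w₀ i ^ (γ - (l : ℝ) / 2 + 1) := Real.rpow_pos_of_pos (hw₀ i) _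
  have h2 : c ^ l * (w₀ i ^ (γ - (l : ℝ) / 2 + 1))⁻¹ * N ≤ |K| := by
    rw [← hexp, mul_assoc]; exact h1.trans (le_abs_self K)
  have h3 : c ^ (k + 2) ≤ c ^ l := pow_le_pow_of_le_one hc0.le hc1 hl
  have h4 : c ^ (k + 2) * (w₀ i ^ (γ - (l : ℝ) / 2 + 1))⁻¹ * N ≤ |K| :=
    le_trans (by gcongr) h2
  calc N = c ^ (k + 2) * (w₀ i ^ (γ - (l : ℝ) / 2 + 1))⁻¹ * N
        * (c ^ (k + 2))⁻¹ * w₀ i ^ (γ - (l : ℝ) / 2 + 1) := by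
        generalize w₀ i ^ (γ - (l : ℝ) / 2 + 1) = T at hw₀e
        field_simp
    _ ≤ |K| * (c ^ (k + 2))⁻¹ * w₀ i ^ (γ - (l : ℝ) / 2 + 1) := by gcongr

end GapSolution

/-! ### The weighted estimate -/

theorem mainTheorem4 (m : ℕ) (hm : 1 ≤ m) (α : ℝ) (hα0 : 0 < α) (hα1 : α < 1)
    (R : ℝ) (hR : 0 < R) (κ : ℝ) (hκ : 0 < κ) (M : ℝ) (ε₀ : ℝ)
    (γ : ℝ) (hγ3 : -3 ≤ γ) (hγ1 : γ < -1) (C₀ : ℝ) :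
    ∃ C : ℝ, 0 < C ∧
      ∀ (ε : ℝ) (h F U : Plane → ℝ),
        0 < ε → ε ≤ ε₀ →
        IsGapProfile m α R κ M h →
        ContDiffOn ℝ ∞ F (disc R) →
        (∀ l ≤ m, ∀ x ∈ disc R,
          ‖iteratedFDeriv ℝ l F x‖ ≤ C₀ * (ε + h x) ^ (γ - (l : ℝ) / 2)) →
        ContDiffOn ℝ (m + 1 : ℕ) U (disc R) →
        ContinuousOn U (Metric.closedBall (0 : Plane) (2 * R)) →
        (∀ x : Plane, ‖x‖ = 2 * R → U x = 0) →
        (∀ x ∈ disc R, gapOperator ε h U x = F x) →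
        ∀ l ≤ m + 1, ∀ x ∈ disc R,
          ‖iteratedFDeriv ℝ l U x‖ ≤ C * (ε + h x) ^ (γ - (l : ℝ) / 2 + 1) := by

  obtain ⟨K₁, hK₁⟩ := GapSolution.interior_bound (M := M) (ε₀ := ε₀) (C₀ := C₀) hm hα0 hR hκ hγ3 hγ1
  obtain ⟨K₂, hK₂⟩ := GapSolution.boundary_bound (M := M) (ε₀ := ε₀) (C₀ := C₀) hm hα0 hR hκ hγ3 hγ1
  set W := |ε₀| + |M| + 1 with hW
  have hW1 : 1 ≤ W := by rw [hW]; linarith [abs_nonneg ε₀, abs_nonneg M]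
  -- the most negative exponent that occurs
  set e₀ : ℝ := γ - ((m + 1 : ℕ) : ℝ) / 2 + 1 with he₀
  have hWe : 0 < W ^ (-e₀) := Real.rpow_pos_of_pos (by linarith) _
  refine ⟨|K₁| + |K₂| * W ^ (-e₀) + 1, by positivity, ?_⟩
  intro ε h F U hε hε₀ hprof hFc hFb hUc hUcont hU0 heq l hl x hx
  let P : GapSolution m α R κ M ε₀ γ C₀ :=
    ⟨ε, h, F, U, hε, hε₀, hprof, hFc, hFb, hUc, hUcont, hU0, heq⟩
  have hw : 0 < ε + h x := P.w_pos hκ hx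
  have hwW : ε + h x ≤ W := P.w_le hx
  set e : ℝ := γ - (l : ℝ) / 2 + 1 with he
  have hwe : 0 < (ε + h x) ^ e := Real.rpow_pos_of_pos hw _
  rcases le_or_gt ‖x‖ (3 * R / 2) with hxR | hxR
  · have h1 : ‖iteratedFDeriv ℝ l U x‖ ≤ K₁ * (ε + h x) ^ e := hK₁ P l hl x hxR
    refine h1.trans (mul_le_mul_of_nonneg_right ?_ hwe.le)
    have : 0 ≤ |K₂| * W ^ (-e₀) := by positivity
    linarith [le_abs_self K₁]
  · have h1 : ‖iteratedFDeriv ℝ l U x‖ ≤ K₂ :=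
      hK₂ P l hl x ⟨by linarith, mem_disc.1 hx⟩
    have he0 : e ≤ 0 := by
      have : (0 : ℝ) ≤ (l : ℝ) / 2 := by positivity
      rw [he]; linarith
    have hee : e₀ ≤ e := by
      have : (l : ℝ) ≤ ((m + 1 : ℕ) : ℝ) := by exact_mod_cast hl
      rw [he, he₀]; linarith
    have h2 : 1 ≤ W ^ (-e₀) * (ε + h x) ^ e := by
      calc (1 : ℝ) ≤ W ^ (-e₀ + e) := Real.one_le_rpow hW1 (by linarith)
        _ = W ^ (-e₀) * W ^ e := Real.rpow_add (by linarith) _ _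
        _ ≤ W ^ (-e₀) * (ε + h x) ^ e :=
          mul_le_mul_of_nonneg_left (Real.rpow_le_rpow_of_nonpos hw hwW he0) hWe.le
    calc ‖iteratedFDeriv ℝ l U x‖ ≤ |K₂| * 1 := by rw [mul_one]; exact h1.trans (le_abs_self _)
      _ ≤ |K₂| * (W ^ (-e₀) * (ε + h x) ^ e) := by gcongr
      _ = |K₂| * W ^ (-e₀) * (ε + h x) ^ e := by ring
      _ ≤ _ := by
        apply mul_le_mul_of_nonneg_right _ hwe.le
        linarith [abs_nonneg K₁]
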